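/- Let $d\ge 1$, $\alpha\in(0,2)$, $\kappa>0$ and $\beta\in\mathbb R$ with $\alpha>\kappa\beta>\alpha-2$. Write $f\approx g$ if there is a constant $c>0$ with $c^{-1}f\le g\le cf$ on the indicated domain. Let $\nu(dy)=g(y)\,dy$ be a Lévy measure on $\mathbb R^d$ which is symmetric, i.e. $g(-y)=g(y)$, and satisfies $$g(y)\approx |y|^{-d-\alpha}\left[\log(1+|y|^{-\kappa})\right]^{-\beta},\qquad y\in\mathbb R^d\setminus\{0\}.$$ Let $\{P_t\}_{t\ge0}$ be the convolution semigroup of probability measures on $\mathbb R^d$ with Lévy measure $\nu$ and drift $0$, that is, $$\int e^{i\langle\xi,y\rangle}P_t(dy)=e^{-t\Phi(\xi)},\qquad \Phi(\xi)=-\int\left(e^{i\langle\xi,y\rangle}-1-i\langle\xi,y\rangle\mathbf 1_{\{|y|<1\}}\right)\nu(dy),\qquad \xi\in\mathbb R^d,\ t\ge 0.$$ Then, for every $t>0$, $P_t$ is absolutely continuous with respect to the Lebesgue measure and has a density $p_t\in C^\infty(\mathbb R^d)$, and these densities satisfy $$p_t(x)\approx\min\left\{t^{-d/\alpha}\left(\log(1+1/t)\right)^{d\beta/\alpha},\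 t|x|^{-d-\alpha}\left[\log(1+|x|^{-\kappa})\right]^{-\beta}\right\},\qquad t\in(0,1),\ x\in\mathbb R^d,$$ $$p_t(x)\approx\min\left\{t^{-d/(\alpha-\kappa\beta)},\ t|x|^{-d-\alpha}\left[\log(1+|x|^{-\kappa})\right]^{-\beta}\right\},\qquad t\ge1,\ x\in\mathbb R^d.$$ Furthermore, for every multi-index $\eta\in\mathbb N_0^d$ there are constants $C,C'>0$ such that for all $x\in\mathbb R^d$ $$|\partial_x^\eta p_t(x)|\le C\,t^{(-d-|\eta|)/\alpha}\left(\log(1+1/t)\right)^{(d+|\eta|)\beta/\alpha}\min\left\{1,\ \frac{t^{1+d/\alpha}\left[\log(1+|x|^{-\kappa})\right]^{-\beta}}{|x|^{d+\alpha}\left(\log(1+1/t)\right)^{d\beta/\alpha}}\right\},\qquad t\in(0,1),$$ $$|\partial_x^\eta p_t(x)|\le C'\,t^{(-d-|\eta|)/(\alpha-\kappa\beta)}\min\left\{1,\ t^{1+d/(\alpha-\kappa\beta)}|x|^{-d-\alpha}\left[\log(1+|x|^{-\kappa})\right]^{-\beta}\right\},\qquad t\ge1.$$ At $x=0$ the second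 term of each minimum is read as $+\infty$. All constants are independent of $t$ and $x$. -/

import Mathlib

open MeasureTheory
open scoped RealInnerProductSpace

noncomputable section

/-- A Lévy measure on `ℝ^d`: no mass at the origin, and `∫ (1 ∧ |y|²) ν(dy) < ∞`. -/
def IsLevyMeasure {d : ℕ} (ν : Measure (EuclideanSpace ℝ (Fin d))) : Prop :=
  ν {0} = 0 ∧ ∫⁻ y, ENNReal.ofReal (min 1 (‖y‖ ^ 2)) ∂ν < ⊤

/-- The Lévy–Khintchine exponent
`Φ(ξ) = -∫ (e^{i⟨ξ,y⟩} - 1 - i⟨ξ,y⟩ 1_{B(0,1)}(y)) ν(dy) - i⟨ξ,b⟩`. -/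
def levyExponent {d : ℕ} (ν : Measure (EuclideanSpace ℝ (Fin d)))
    (b ξ : EuclideanSpace ℝ (Fin d)) : ℂ :=
  -(∫ y, (Complex.exp (Complex.I * (⟪ξ, y⟫ : ℝ)) - 1 -
      Complex.I * (⟪ξ, y⟫ : ℝ) *
        (Metric.ball (0 : EuclideanSpace ℝ (Fin d)) 1).indicator (fun _ => (1 : ℂ)) y) ∂ν) -
    Complex.I * (⟪ξ, b⟫ : ℝ)

/-- `(P_t)_{t ≥ 0}` is the convolution semigroup of probability measures with Lévy measure `ν` and
drift `b`: the Fourier transform of `P_t` is `exp (-t Φ)`. (Values at `t < 0` play no role;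
the Fourier transform determines `P_t` uniquely.) -/
structure IsLevySemigroup {d : ℕ} (ν : Measure (EuclideanSpace ℝ (Fin d)))
    (b : EuclideanSpace ℝ (Fin d)) (P : ℝ → Measure (EuclideanSpace ℝ (Fin d))) : Prop where
  isProbabilityMeasure : ∀ t, 0 ≤ t → IsProbabilityMeasure (P t)
  conv_eq : ∀ s t, 0 ≤ s → 0 ≤ t → P (s + t) = Measure.conv (P s) (P t)
  charFun_eq : ∀ t, 0 ≤ t → ∀ ξ, charFun (P t) ξ = Complex.exp (-(t : ℂ) * levyExponent ν b ξ)

/-- `f ≈ g` on `S`: there is a constant `c > 0` with `c⁻¹ f ≤ g ≤ c f` on `S`. -/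
def ComparableOn {X : Type*} (S : Set X) (f g : X → ℝ) : Prop :=
  ∃ c : ℝ, 0 < c ∧ ∀ x ∈ S, c⁻¹ * f x ≤ g x ∧ g x ≤ c * f x

/-- `|x|^{-d-α} [log (1 + |x|^{-κ})]^{-β}`, meaningful for `x ≠ 0`. -/
def logStableDensity {d : ℕ} (α κ β : ℝ) (x : EuclideanSpace ℝ (Fin d)) : ℝ :=
  ‖x‖ ^ (-(d : ℝ) - α) * Real.log (1 + ‖x‖ ^ (-κ)) ^ (-β)

/-- `min {A, B |x|^{-d-α} [log (1 + |x|^{-κ})]^{-β}}` for `B > 0`; at `x = 0` the second term is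
`+∞`, so the minimum is `A`. -/
def minLogStable {d : ℕ} (α κ β A B : ℝ) (x : EuclideanSpace ℝ (Fin d)) : ℝ :=
  open Classical in if x = 0 then A else min A (B * logStableDensity α κ β x)

/-- The partial derivative in the `i`-th coordinate. -/
def partialDeriv {d : ℕ} (i : Fin d) (f : EuclideanSpace ℝ (Fin d) → ℝ) :
    EuclideanSpace ℝ (Fin d) → ℝ :=
  fun x => lineDeriv ℝ f x (EuclideanSpace.single i 1)

/-- `∂^η f` for a multi-index `η`: the `i`-th partial derivative is applied `η i` times, for every
`i`. -/
def multiDeriv {d : ℕ} (η : Fin d → ℕ) (f : EuclideanSpace ℝ (Fin d) → ℝ) :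
    EuclideanSpace ℝ (Fin d) → ℝ :=
  (List.finRange d).foldr (fun i g => (partialDeriv i)^[η i] g) f

end

/-! Scaling reduces everything to time one. Write `f` for `logProfile` and `h` for `spaceScale` at
time `t`. If `X_t` has law `P t`, then `X_t / h` is infinitely divisible with Lévy density `t h^d
g(h y)`. The scale `h` is chosen so that `t h^d f(h)` stays between two positive constants
(`exists_spaceScale_comparable`); hence the rescaled density is comparable, uniformly in `t`, with
the profile `F(r) = f(h r) / f(h)`. By Bernoulli's inequality for the logarithm, `F` decays with
exponents between `-d-b` and `-d-a`, where `a = min α (α - κβ)` and `b = max α (α - κβ)`. The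
hypotheses on `α, κ, β` say exactly that `0 < a` and `b < 2`. It remains to bound the time-one
density and its derivatives by `F(max 1 |x|)`, with constants depending only on the dimension, `a`,
`b` and the comparability constant (`exists_uniform_density_bounds`).

At time one the Lévy density is cut by height, `g = (g - min g 1) + min g 1`. The first part has
bounded support, hence finite moments of every order `k ≥ 2`, and its exponent is at least a
multiple of `|ξ|^a` up to a constant. So `exp(-Φ)` for this part is smooth, with all derivatives
decaying faster than any polynomial, and its Fourier transform `q` inherits this uniformly. In
particular every derivative of `q` is dominated by `F(max 1 |x|)`, and `q` is bounded below near the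
origin.

The second part is integrable and contributes a compound Poisson law, a multiple of `convExp`. The
density is the mixture of translates of `q` under this law. For the upper bound, convolution with
`min g 1` sends `F(max 1 |x|)` to at most a constant multiple of itself
(`IsJumpDensity.lintegral_trunc_sub_le`), so the exponential series costs only a constant factor;
derivatives fall on `q` alone. For the lower bound, only the term with a single large jump, landing
close to `x`, is kept (`IsJumpDensity.le_re_fourier`). -/

open FourierTransform Filter Topology
open scoped ENNReal

/-! ### Convolution exponentials (unnormalised compound Poisson laws) -/

section ConvExp

variable {V : Type*} [NormedAddCommGroup V] [InnerProductSpace ℝ V]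
  [MeasurableSpace V] [BorelSpace V] [SecondCountableTopology V]

/-- The `n`-fold convolution power of a measure. -/
noncomputable def convPow (ν : Measure V) : ℕ → Measure V
  | 0 => Measure.dirac 0
  | n + 1 => Measure.conv ν (convPow ν n)

/-- The convolution exponential `∑ ν^{*n} / n!`. -/
noncomputable def convExp (ν : Measure V) : Measure V :=
  Measure.sum fun n => ((n.factorial : ℝ≥0∞)⁻¹) • convPow ν n

instance isFiniteMeasure_convPow (ν : Measure V) [IsFiniteMeasure ν] (n : ℕ) :
    IsFiniteMeasure (convPow ν n) := by
  induction n with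
  | zero => unfold convPow; infer_instance
  | succ n ih => unfold convPow; infer_instance

/-- If one jump costs a factor `K`, then `n` jumps cost `K ^ n`: the jumps are peeled off one at a
time. -/
theorem lintegral_convPow_le (ν : Measure V) [IsFiniteMeasure ν] {u : V → ℝ≥0∞}
    (hu : Measurable u) {K : ℝ≥0∞} (h : ∀ x, ∫⁻ y, u (x - y) ∂ν ≤ K * u x) (n : ℕ) (x : V) :
    ∫⁻ y, u (x - y) ∂(convPow ν n) ≤ K ^ n * u x := by
  have hux : ∀ x, Measurable fun y => u (x - y) := fun x => hu.comp (by fun_prop)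
  induction n generalizing x with
  | zero =>
    unfold convPow
    rw [lintegral_dirac' _ (hux x)]
    simp
  | succ n ih =>
    unfold convPow
    rw [Measure.lintegral_conv (hux x)]
    calc ∫⁻ y, ∫⁻ z, u (x - (y + z)) ∂(convPow ν n) ∂ν
        ≤ ∫⁻ y, K ^ n * u (x - y) ∂ν := by
          refine lintegral_mono fun y => ?_
          simpa only [sub_sub] using ih (x - y)
      _ = K ^ n * ∫⁻ y, u (x - y) ∂ν :=
          lintegral_const_mul _ (hux x)
      _ ≤ K ^ n * (K * u x) := by gcongr; exact h x
      _ = K ^ (n + 1) * u x := by rw [pow_succ, mul_assoc]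

theorem tsum_ofReal_pow_div_factorial {k : ℝ} (hk : 0 ≤ k) :
    ∑' n : ℕ, ((n.factorial : ℝ≥0∞)⁻¹) * ENNReal.ofReal k ^ n = ENNReal.ofReal (Real.exp k) := by
  have h : HasSum (fun n : ℕ => (n.factorial : ℝ)⁻¹ * k ^ n) (Real.exp k) := by
    have := NormedSpace.expSeries_div_hasSum_exp (𝔸 := ℝ) k
    rw [← Real.exp_eq_exp_ℝ] at this
    simpa only [div_eq_inv_mul] using this
  rw [← h.tsum_eq, ENNReal.ofReal_tsum_of_nonneg (fun n => by positivity) h.summable]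
  refine tsum_congr fun n => ?_
  rw [ENNReal.ofReal_mul (by positivity), ENNReal.ofReal_pow hk,
    ENNReal.ofReal_inv_of_pos (by positivity), ENNReal.ofReal_natCast]

/-- Summing the costs `k ^ n / n!` of `n` jumps gives `exp k`. This is what carries tail bounds
through arbitrarily many large jumps. -/
theorem lintegral_convExp_le (ν : Measure V) [IsFiniteMeasure ν] {u : V → ℝ≥0∞}
    (hu : Measurable u) {k : ℝ} (hk : 0 ≤ k)
    (h : ∀ x, ∫⁻ y, u (x - y) ∂ν ≤ ENNReal.ofReal k * u x) (x : V) :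
    ∫⁻ y, u (x - y) ∂(convExp ν) ≤ ENNReal.ofReal (Real.exp k) * u x := by
  unfold convExp
  rw [lintegral_sum_measure, ← tsum_ofReal_pow_div_factorial hk, ← ENNReal.tsum_mul_right]
  refine ENNReal.tsum_le_tsum fun n => ?_
  rw [lintegral_smul_measure, smul_eq_mul, mul_assoc]
  gcongr
  exact lintegral_convPow_le ν hu h n x

instance isFiniteMeasure_convExp (ν : Measure V) [IsFiniteMeasure ν] :
    IsFiniteMeasure (convExp ν) := by
  have := lintegral_convExp_le ν (u := fun _ => 1) measurable_const
    (k := ν.real Set.univ) measureReal_nonneg (fun x => by simp) 0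
  refine ⟨lt_of_le_of_lt (by simpa using this) ENNReal.ofReal_lt_top⟩

/-- Only the one-jump term is kept; the lower bound for the density needs no more. -/
theorem le_convExp (ν : Measure V) [IsFiniteMeasure ν] : ν ≤ convExp ν := by
  have h : convPow ν 1 = ν := by
    simp [convPow]
  have := Measure.le_sum (fun n => ((n.factorial : ℝ≥0∞)⁻¹) • convPow ν n) 1
  simpa [h, convExp] using this

theorem charFun_convPow (ν : Measure V) [IsFiniteMeasure ν] (n : ℕ) (ξ : V) :
    charFun (convPow ν n) ξ = charFun ν ξ ^ n := by
  induction n with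
  | zero => simp [convPow, charFun_dirac]
  | succ n ih => rw [convPow, charFun_conv, ih, pow_succ']

theorem charFun_convExp (ν : Measure V) [IsFiniteMeasure ν] (ξ : V) :
    charFun (convExp ν) ξ = Complex.exp (charFun ν ξ) := by
  have hint : Integrable (fun y : V => Complex.exp ((⟪y, ξ⟫ : ℝ) * Complex.I)) (convExp ν) := by
    refine (integrable_const (1 : ℂ)).mono (by fun_prop) (ae_of_all _ fun y => ?_)
    rw [Complex.norm_exp_ofReal_mul_I]; simp
  have h1 := hasSum_integral_measure (μ := fun n => ((n.factorial : ℝ≥0∞)⁻¹) • convPow ν n) hint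
  have h2 := NormedSpace.expSeries_div_hasSum_exp (𝔸 := ℂ) (charFun ν ξ)
  rw [← Complex.exp_eq_exp_ℂ] at h2
  have h3 : ∀ n : ℕ, ∫ y, Complex.exp ((⟪y, ξ⟫ : ℝ) * Complex.I)
      ∂(((n.factorial : ℝ≥0∞)⁻¹) • convPow ν n) = charFun ν ξ ^ n / n.factorial := by
    intro n
    rw [integral_smul_measure, ← charFun_apply, charFun_convPow]
    simp [div_eq_inv_mul]
  simp_rw [h3] at h1
  exact h1.unique h2

end ConvExp

/-! ### Fourier transform of a product with a characteristic function -/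

section FourierConv

variable {V : Type*} [NormedAddCommGroup V] [InnerProductSpace ℝ V] [FiniteDimensional ℝ V]
  [MeasurableSpace V] [BorelSpace V]
  {E : Type*} [NormedAddCommGroup E] [NormedSpace ℂ E] [CompleteSpace E]

/-- Fubini. The argument `2π ξ` reconciles the kernel `e^{i⟨y,ξ⟩}` of `charFun` with the kernel
`e^{-2πi⟨ξ,x⟩}` of `𝓕`. Vector values allow the identity to be applied to derivatives. -/
theorem fourier_charFun_smul (π : Measure V) [IsFiniteMeasure π] {w : V → E}
    (hw : Integrable w) (x : V) :
    𝓕 (fun ξ => charFun π ((2 * Real.pi) • ξ) • w ξ) x = ∫ y, 𝓕 w (x - y) ∂π := by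
  simp only [Real.fourier_eq']
  have h1 : ∀ ξ : V, Complex.exp (↑(-2 * Real.pi * ⟪ξ, x⟫) * Complex.I) •
      charFun π ((2 * Real.pi) • ξ) • w ξ =
      ∫ y, Complex.exp (↑(-2 * Real.pi * ⟪ξ, x - y⟫) * Complex.I) • w ξ ∂π := by
    intro ξ
    rw [integral_smul_const, smul_smul, charFun_apply, ← integral_const_mul]
    congr 2
    ext y
    rw [← Complex.exp_add]
    congr 1
    rw [inner_sub_right, inner_smul_right, real_inner_comm y ξ]
    push_cast
    ring
  simp_rw [h1]
  refine integral_integral_swap ?_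
  refine (hw.comp_fst π).mono ?_ (ae_of_all _ fun p => ?_)
  · refine AEStronglyMeasurable.smul (by fun_prop) ?_
    exact hw.aestronglyMeasurable.comp_fst
  · rw [Function.uncurry_def, norm_smul, Complex.norm_exp_ofReal_mul_I, one_mul]

end FourierConv

/-! ### Fourier transforms compensated at the origin -/

section CompFourier

open VectorFourier

variable {V : Type*} [NormedAddCommGroup V] [InnerProductSpace ℝ V] [FiniteDimensional ℝ V]
  [MeasurableSpace V] [BorelSpace V]
  {E : Type*} [NormedAddCommGroup E] [NormedSpace ℂ E]

theorem norm_fourierChar_sub_one_le (θ : ℝ) : ‖((Real.fourierChar θ : Circle) : ℂ) - 1‖ ≤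
    2 * Real.pi * |θ| := by
  have := Real.norm_exp_I_mul_ofReal_sub_one_le (x := 2 * Real.pi * θ)
  rw [Real.fourierChar_apply, mul_comm _ Complex.I]
  simpa [abs_mul, abs_of_pos Real.pi_pos] using this

theorem norm_exp_mul_I_sub_sub_le (θ : ℝ) :
    ‖Complex.exp (θ * Complex.I) - 1 - θ * Complex.I‖ ≤ 3 * θ ^ 2 := by
  have hn : ‖(θ : ℂ) * Complex.I‖ = |θ| := by simp
  rcases le_total |θ| 1 with h | h
  · have := Complex.norm_exp_sub_one_sub_id_le (x := θ * Complex.I) (by rw [hn]; exact h)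
    rw [hn, sq_abs] at this
    nlinarith [sq_nonneg θ]
  · calc _ ≤ ‖Complex.exp (θ * Complex.I)‖ + ‖(1 : ℂ)‖ + ‖(θ : ℂ) * Complex.I‖ :=
          (norm_sub_le _ _).trans (add_le_add_left (norm_sub_le _ _) _)
      _ = 1 + 1 + |θ| := by rw [hn, Complex.norm_exp_ofReal_mul_I, norm_one]
      _ ≤ 3 * |θ| ^ 2 := by nlinarith
      _ = 3 * θ ^ 2 := by rw [sq_abs]

theorem norm_fourierSMulRight_inner_le (f : V → E) (v : V) :
    ‖fourierSMulRight (innerSL ℝ) f v‖ ≤ 2 * Real.pi * (‖v‖ * ‖f v‖) := by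
  rw [norm_fourierSMulRight, innerSL_apply_norm]
  exact le_of_eq (by ring)

/-- The Fourier transform of `f`, with the integrand compensated to first order. -/
noncomputable def compFourier (f : V → E) (ξ : V) : E :=
  ∫ v, (Real.fourierChar (-⟪v, ξ⟫) • f v - f v - fourierSMulRight (innerSL ℝ) f v ξ)

/-- The Fourier transform of `f`, with the integrand compensated to order zero. -/
noncomputable def compFourierZero (f : V → E) (ξ : V) : E :=
  ∫ v, (Real.fourierChar (-⟪v, ξ⟫) • f v - f v)

theorem aestronglyMeasurable_fourierChar_smul {f : V → E} (hf : AEStronglyMeasurable f) (ξ : V) :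
    AEStronglyMeasurable (fun v => Real.fourierChar (-⟪v, ξ⟫) • f v) volume :=
  .fun_smul ((Real.continuous_fourierChar.comp (by fun_prop)).aestronglyMeasurable) hf

theorem norm_fourierChar_smul_sub_le (f : V → E) (v ξ : V) :
    ‖Real.fourierChar (-⟪v, ξ⟫) • f v - f v‖ ≤ 2 * Real.pi * ‖ξ‖ * (‖v‖ * ‖f v‖) := by
  have h : Real.fourierChar (-⟪v, ξ⟫) • f v - f v =
      (((Real.fourierChar (-⟪v, ξ⟫) : Circle) : ℂ) - 1) • f v := by
    rw [sub_smul, one_smul]; rfl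
  rw [h, norm_smul]
  calc _ ≤ (2 * Real.pi * (‖v‖ * ‖ξ‖)) * ‖f v‖ := by
        gcongr
        refine (norm_fourierChar_sub_one_le _).trans ?_
        rw [abs_neg]
        gcongr
        exact abs_real_inner_le_norm v ξ
    _ = _ := by ring

theorem hasFDerivAt_compFourierZero {f : V → E} (hf : AEStronglyMeasurable f)
    (h1 : Integrable fun v => ‖v‖ * ‖f v‖) (ξ : V) :
    HasFDerivAt (compFourierZero f) (𝓕 (fourierSMulRight (innerSL ℝ) f) ξ) ξ := by
  refine hasFDerivAt_integral_of_dominated_of_fderiv_le (Metric.ball_mem_nhds ξ one_pos)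
    (bound := fun v => 2 * Real.pi * (‖v‖ * ‖f v‖))
    (F' := fun ξ v => Real.fourierChar (-⟪v, ξ⟫) • fourierSMulRight (innerSL ℝ) f v)
    (.of_forall fun ξ => (aestronglyMeasurable_fourierChar_smul hf ξ).sub hf) ?_
    (aestronglyMeasurable_fourierChar_smul hf.fourierSMulRight ξ) ?_ (h1.const_mul _) ?_
  · exact (h1.const_mul (2 * Real.pi * ‖ξ‖)).mono'
      ((aestronglyMeasurable_fourierChar_smul hf ξ).sub hf)
      (ae_of_all _ fun v => norm_fourierChar_smul_sub_le f v ξ)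
  · refine ae_of_all _ fun v ξ' _ => ?_
    rw [Circle.norm_smul _ (fourierSMulRight (innerSL ℝ) f v)]
    exact norm_fourierSMulRight_inner_le f v
  · refine ae_of_all _ fun v ξ' _ => ?_
    exact (hasFDerivAt_fourierChar_smul (innerSL ℝ) f v ξ').sub_const (f v)

theorem integrable_compFourier_integrand {f : V → E} (hf : AEStronglyMeasurable f)
    (h2 : Integrable fun v => ‖v‖ ^ 2 * ‖f v‖) (ξ : V) :
    Integrable fun v => Real.fourierChar (-⟪v, ξ⟫) • f v - f v -
      fourierSMulRight (innerSL ℝ) f v ξ := by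
  have hmeas : ∀ ξ : V, AEStronglyMeasurable (fun v => Real.fourierChar (-⟪v, ξ⟫) • f v - f v -
      fourierSMulRight (innerSL ℝ) f v ξ) volume := fun ξ =>
    ((aestronglyMeasurable_fourierChar_smul hf ξ).sub hf).sub
      (hf.fourierSMulRight.apply_continuousLinearMap ξ)
  refine (h2.const_mul (3 * (2 * Real.pi * ‖ξ‖) ^ 2)).mono' (hmeas ξ)
    (ae_of_all _ fun v => ?_)
  have h : Real.fourierChar (-⟪v, ξ⟫) • f v - f v - fourierSMulRight (innerSL ℝ) f v ξ =
      (Complex.exp ((2 * Real.pi * (-⟪v, ξ⟫) : ℝ) * Complex.I) - 1 -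
        (2 * Real.pi * (-⟪v, ξ⟫) : ℝ) * Complex.I) • f v := by
    rw [sub_smul, sub_smul, one_smul, fourierSMulRight_apply, innerSL_apply_apply,
      Circle.smul_def, Real.fourierChar_apply, ← Complex.coe_smul (⟪v, ξ⟫ : ℝ), smul_smul]
    congr 2
    push_cast
    ring
  rw [h, norm_smul]
  calc _ ≤ (3 * (2 * Real.pi * (-⟪v, ξ⟫)) ^ 2) * ‖f v‖ := by
        gcongr; exact norm_exp_mul_I_sub_sub_le _
    _ = 3 * (2 * Real.pi) ^ 2 * |⟪v, ξ⟫| ^ 2 * ‖f v‖ := by rw [sq_abs]; ring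
    _ ≤ 3 * (2 * Real.pi) ^ 2 * (‖v‖ * ‖ξ‖) ^ 2 * ‖f v‖ := by
        gcongr; exact abs_real_inner_le_norm v ξ
    _ = _ := by ring

/-- Each derivative brings down a factor `v` and lowers the order of compensation by one. After two
derivatives an ordinary Fourier transform of an integrable function is left, so a density that is
not integrable at `0` causes no difficulty. -/
theorem hasFDerivAt_compFourier {f : V → E} (hf : AEStronglyMeasurable f)
    (h2 : Integrable fun v => ‖v‖ ^ 2 * ‖f v‖) (ξ : V) :
    HasFDerivAt (compFourier f) (compFourierZero (fourierSMulRight (innerSL ℝ) f) ξ) ξ := by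
  have hmeas : ∀ ξ : V, AEStronglyMeasurable (fun v => Real.fourierChar (-⟪v, ξ⟫) • f v - f v -
      fourierSMulRight (innerSL ℝ) f v ξ) volume := fun ξ =>
    ((aestronglyMeasurable_fourierChar_smul hf ξ).sub hf).sub
      (hf.fourierSMulRight.apply_continuousLinearMap ξ)
  refine hasFDerivAt_integral_of_dominated_of_fderiv_le (Metric.ball_mem_nhds ξ one_pos)
    (bound := fun v => 2 * Real.pi * (‖ξ‖ + 1) * (2 * Real.pi) * (‖v‖ ^ 2 * ‖f v‖))
    (F' := fun ξ v => Real.fourierChar (-⟪v, ξ⟫) • fourierSMulRight (innerSL ℝ) f v -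
      fourierSMulRight (innerSL ℝ) f v)
    (.of_forall hmeas) ?_
    ((aestronglyMeasurable_fourierChar_smul hf.fourierSMulRight ξ).sub hf.fourierSMulRight) ?_
    (h2.const_mul _) ?_
  · exact integrable_compFourier_integrand hf h2 ξ
  · refine ae_of_all _ fun v ξ' hξ' => ?_
    have hξ'' : ‖ξ'‖ ≤ ‖ξ‖ + 1 := by
      have := norm_le_norm_add_norm_sub ξ ξ'
      rw [mem_ball_iff_norm] at hξ'
      rw [norm_sub_rev] at this
      linarith
    calc _ ≤ 2 * Real.pi * ‖ξ'‖ * (‖v‖ * ‖fourierSMulRight (innerSL ℝ) f v‖) :=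
          norm_fourierChar_smul_sub_le (fourierSMulRight (innerSL ℝ) f) v ξ'
      _ ≤ 2 * Real.pi * (‖ξ‖ + 1) * (‖v‖ * (2 * Real.pi * (‖v‖ * ‖f v‖))) := by
          gcongr; exact norm_fourierSMulRight_inner_le f v
      _ = _ := by ring
  · refine ae_of_all _ fun v ξ' _ => ?_
    exact ((hasFDerivAt_fourierChar_smul (innerSL ℝ) f v ξ').sub_const (f v)).sub
      (ContinuousLinearMap.hasFDerivAt _)

theorem norm_fourierSMulRight_twice_le (f : V → E) (v : V) :
    ‖fourierSMulRight (innerSL ℝ) (fourierSMulRight (innerSL ℝ) f) v‖ ≤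
      (2 * Real.pi) ^ 2 * (‖v‖ ^ 2 * ‖f v‖) := by
  calc _ ≤ 2 * Real.pi * (‖v‖ * (2 * Real.pi * (‖v‖ * ‖f v‖))) :=
        (norm_fourierSMulRight_inner_le _ v).trans
          (by gcongr; exact norm_fourierSMulRight_inner_le f v)
    _ = _ := by ring

section

variable {f : V → E} (hf : AEStronglyMeasurable f)
  (h : ∀ k : ℕ, 2 ≤ k → Integrable fun v => ‖v‖ ^ k * ‖f v‖)

include hf h

theorem integrable_pow_mul_norm_fourierSMulRight_twice (k : ℕ) : Integrable fun v =>
    ‖v‖ ^ k * ‖fourierSMulRight (innerSL ℝ) (fourierSMulRight (innerSL ℝ) f) v‖ := by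
  refine ((h (k + 2) (by omega)).const_mul ((2 * Real.pi) ^ 2)).mono'
    (((continuous_norm.pow k).aestronglyMeasurable).mul
      hf.fourierSMulRight.fourierSMulRight.norm) (ae_of_all _ fun v => ?_)
  rw [Real.norm_of_nonneg (by positivity)]
  calc _ ≤ ‖v‖ ^ k * ((2 * Real.pi) ^ 2 * (‖v‖ ^ 2 * ‖f v‖)) := by
        gcongr; exact norm_fourierSMulRight_twice_le f v
    _ = _ := by ring

theorem fderiv_compFourier :
    fderiv ℝ (compFourier f) = compFourierZero (fourierSMulRight (innerSL ℝ) f) :=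
  funext fun ξ => (hasFDerivAt_compFourier hf (h 2 le_rfl) ξ).fderiv

theorem hasFDerivAt_fderiv_compFourier (ξ : V) : HasFDerivAt (fderiv ℝ (compFourier f))
    (𝓕 (fourierSMulRight (innerSL ℝ) (fourierSMulRight (innerSL ℝ) f)) ξ) ξ := by
  rw [fderiv_compFourier hf h]
  refine hasFDerivAt_compFourierZero hf.fourierSMulRight ?_ ξ
  refine ((h 2 le_rfl).const_mul (2 * Real.pi)).mono'
    (continuous_norm.aestronglyMeasurable.mul hf.fourierSMulRight.norm)
    (ae_of_all _ fun v => ?_)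
  rw [Real.norm_of_nonneg (by positivity)]
  calc _ ≤ ‖v‖ * (2 * Real.pi * (‖v‖ * ‖f v‖)) := by
        gcongr; exact norm_fourierSMulRight_inner_le f v
    _ = _ := by ring

theorem contDiff_compFourier : ContDiff ℝ (⊤ : ℕ∞) (compFourier f) := by
  rw [contDiff_infty_iff_fderiv]
  refine ⟨fun ξ => (hasFDerivAt_compFourier hf (h 2 le_rfl) ξ).differentiableAt, ?_⟩
  rw [contDiff_infty_iff_fderiv]
  refine ⟨fun ξ => (hasFDerivAt_fderiv_compFourier hf h ξ).differentiableAt, ?_⟩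
  rw [funext fun ξ => (hasFDerivAt_fderiv_compFourier hf h ξ).fderiv]
  exact Real.contDiff_fourier fun n _ => integrable_pow_mul_norm_fourierSMulRight_twice hf h n

/-- The first derivative is still compensated to order zero, which produces the factor `‖ξ‖`; from
the second derivative on the bounds are uniform in `ξ`. -/
theorem norm_iteratedFDeriv_one_compFourier_le (ξ : V) :
    ‖iteratedFDeriv ℝ 1 (compFourier f) ξ‖ ≤
      (2 * Real.pi) ^ 2 * ‖ξ‖ * ∫ v, ‖v‖ ^ 2 * ‖f v‖ := by
  rw [← norm_iteratedFDeriv_fderiv, norm_iteratedFDeriv_zero, fderiv_compFourier hf h,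
    ← integral_const_mul]
  refine norm_integral_le_of_norm_le ((h 2 le_rfl).const_mul _) (ae_of_all _ fun v => ?_)
  calc _ ≤ 2 * Real.pi * ‖ξ‖ * (‖v‖ * ‖fourierSMulRight (innerSL ℝ) f v‖) :=
        norm_fourierChar_smul_sub_le (fourierSMulRight (innerSL ℝ) f) v ξ
    _ ≤ 2 * Real.pi * ‖ξ‖ * (‖v‖ * (2 * Real.pi * (‖v‖ * ‖f v‖))) := by
        gcongr; exact norm_fourierSMulRight_inner_le f v
    _ = _ := by ring

theorem norm_iteratedFDeriv_add_two_compFourier_le (k : ℕ) (ξ : V) :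
    ‖iteratedFDeriv ℝ (k + 2) (compFourier f) ξ‖ ≤
      (2 * Real.pi) ^ (k + 2) * ∫ v, ‖v‖ ^ (k + 2) * ‖f v‖ := by
  rw [← norm_iteratedFDeriv_fderiv, ← norm_iteratedFDeriv_fderiv,
    funext fun ξ => (hasFDerivAt_fderiv_compFourier hf h ξ).fderiv,
    Real.iteratedFDeriv_fourier (N := ⊤)
      (fun n _ => integrable_pow_mul_norm_fourierSMulRight_twice hf h n)
      hf.fourierSMulRight.fourierSMulRight le_top, ← integral_const_mul]
  refine norm_integral_le_of_norm_le ((h (k + 2) (by omega)).const_mul _) (ae_of_all _ fun v => ?_)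
  rw [Circle.norm_smul]
  calc _ ≤ (2 * Real.pi * ‖innerSL (E := V) ℝ‖) ^ k * ‖v‖ ^ k *
        ‖fourierSMulRight (innerSL ℝ) (fourierSMulRight (innerSL ℝ) f) v‖ :=
        norm_fourierPowSMulRight_le _ _ _ _
    _ ≤ (2 * Real.pi * 1) ^ k * ‖v‖ ^ k * ((2 * Real.pi) ^ 2 * (‖v‖ ^ 2 * ‖f v‖)) := by
        gcongr
        · exact norm_innerSL_le _
        · exact norm_fourierSMulRight_twice_le f v
    _ = _ := by ring

end

end CompFourier

/-! ### Smoothness and decay of `exp (-Φ)` for regular jump densities -/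

section SymExponent

variable {V : Type*} [NormedAddCommGroup V] [InnerProductSpace ℝ V] [FiniteDimensional ℝ V]
  [MeasurableSpace V] [BorelSpace V]

/-- The characteristic exponent of the symmetric Lévy measure with density `G`. -/
noncomputable def symExponent (G : V → ℝ) (ξ : V) : ℝ :=
  ∫ y, (1 - Real.cos ⟪ξ, y⟫) * G y

/-- `exp (-Φ (2πξ))`, where `Φ` is the characteristic exponent of the density `G`; its Fourier
transform is the transition density at time one. -/
noncomputable def expSymExponent (G : V → ℝ) (ξ : V) : ℂ :=
  (Real.exp (-symExponent G ((2 * Real.pi) • ξ)) : ℝ)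

/-- A Lévy density with moments of all orders `k ≥ 2`, bounded by `M k`, and with exponent at
least `c |ξ|^a - C`. -/
structure IsRegularJumpDensity (a c C : ℝ) (M : ℕ → ℝ) (G : V → ℝ) : Prop where
  measurable : Measurable G
  nonneg : ∀ y, 0 ≤ G y
  integrable : ∀ k : ℕ, 2 ≤ k → Integrable fun y => ‖y‖ ^ k * G y
  moment_le : ∀ k : ℕ, 2 ≤ k → ∫ y, ‖y‖ ^ k * G y ≤ M k
  le_symExponent : ∀ ξ, c * ‖ξ‖ ^ a - C ≤ symExponent G ξ

theorem integrable_one_sub_cos_mul {G : V → ℝ} (hG : Measurable G)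
    (h2 : Integrable fun y => ‖y‖ ^ 2 * G y) (ξ : V) :
    Integrable fun y => (1 - Real.cos ⟪ξ, y⟫) * G y := by
  refine (h2.norm.const_mul (‖ξ‖ ^ 2)).mono' (by fun_prop) (ae_of_all _ fun y => ?_)
  rw [norm_mul, norm_mul, Real.norm_of_nonneg (by linarith [Real.cos_le_one ⟪ξ, y⟫]),
    Real.norm_of_nonneg (by positivity : (0 : ℝ) ≤ ‖y‖ ^ 2), ← mul_assoc]
  gcongr
  have h1 := Real.one_sub_sq_div_two_le_cos (x := ⟪ξ, y⟫)
  have h3 := abs_real_inner_le_norm ξ y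
  have h4 : ⟪ξ, y⟫ ^ 2 ≤ (‖ξ‖ * ‖y‖) ^ 2 := sq_le_sq' (by linarith [neg_abs_le ⟪ξ, y⟫])
    (le_trans (le_abs_self _) h3)
  nlinarith [sq_nonneg ⟪ξ, y⟫]

theorem symExponent_nonneg {G : V → ℝ} (hG : ∀ y, 0 ≤ G y) (ξ : V) : 0 ≤ symExponent G ξ :=
  integral_nonneg fun y => mul_nonneg (by linarith [Real.cos_le_one ⟪ξ, y⟫]) (hG y)

theorem symExponent_le {G : V → ℝ} (hG : Measurable G) (hG0 : ∀ y, 0 ≤ G y)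
    (h2 : Integrable fun y => ‖y‖ ^ 2 * G y) (ξ : V) :
    symExponent G ξ ≤ ‖ξ‖ ^ 2 * ∫ y, ‖y‖ ^ 2 * G y := by
  rw [← integral_const_mul]
  refine integral_mono (integrable_one_sub_cos_mul hG h2 ξ) (h2.const_mul _) fun y => ?_
  have h1 := Real.one_sub_sq_div_two_le_cos (x := ⟪ξ, y⟫)
  have h3 := abs_real_inner_le_norm ξ y
  have h4 : ⟪ξ, y⟫ ^ 2 ≤ (‖ξ‖ * ‖y‖) ^ 2 := sq_le_sq' (by linarith [neg_abs_le ⟪ξ, y⟫])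
    (le_trans (le_abs_self _) h3)
  have h5 : 1 - Real.cos ⟪ξ, y⟫ ≤ ‖ξ‖ ^ 2 * ‖y‖ ^ 2 := by nlinarith [sq_nonneg ⟪ξ, y⟫]
  calc _ ≤ ‖ξ‖ ^ 2 * ‖y‖ ^ 2 * G y := mul_le_mul_of_nonneg_right h5 (hG0 y)
    _ = _ := by ring

/-- Polynomials are dominated by stretched exponentials. -/
theorem exists_one_add_pow_mul_exp_le {a c : ℝ} (ha : 0 < a) (hc : 0 < c) (N : ℕ) :
    ∃ C : ℝ, 0 < C ∧ ∀ r : ℝ, 0 ≤ r → (1 + r) ^ N * Real.exp (-(c * r ^ a)) ≤ C := by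
  -- With `N ≤ n a`, the single term `(c r^a)^n / n!` of the exponential series already dominates
  -- `r^N` for `r ≥ 1`.
  obtain ⟨n, hn⟩ := exists_nat_ge (N / a)
  have hNa : (N : ℝ) ≤ n * a := by rwa [div_le_iff₀ ha] at hn
  refine ⟨2 ^ N * (1 + n.factorial / c ^ n), by positivity, fun r hr => ?_⟩
  rcases le_total r 1 with h1 | h1
  · calc (1 + r) ^ N * Real.exp (-(c * r ^ a)) ≤ (1 + 1) ^ N * 1 := by
          gcongr
          exact Real.exp_le_one_iff.2 (by have := Real.rpow_nonneg hr a; nlinarith)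
      _ ≤ 2 ^ N * (1 + n.factorial / c ^ n) := by
          norm_num
          positivity
  · have hr0 : 0 < r := by linarith
    have h2 := Real.pow_div_factorial_le_exp (c * r ^ a) (by positivity) n
    have h3 : r ^ N ≤ (r ^ a) ^ n := by
      rw [← Real.rpow_natCast, ← Real.rpow_natCast, ← Real.rpow_mul hr]
      exact Real.rpow_le_rpow_of_exponent_le h1 (by linarith)
    have h4 : (1 + r) ^ N ≤ 2 ^ N * r ^ N := by rw [← mul_pow]; gcongr; linarith
    have h5 : r ^ N ≤ n.factorial / c ^ n * Real.exp (c * r ^ a) := by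
      refine h3.trans ?_
      rw [div_mul_eq_mul_div, le_div_iff₀ (by positivity)]
      rw [div_le_iff₀ (by positivity), mul_pow] at h2
      linarith
    have h6 : Real.exp (c * r ^ a) * Real.exp (-(c * r ^ a)) = 1 := by
      rw [← Real.exp_add]; simp
    calc (1 + r) ^ N * Real.exp (-(c * r ^ a))
        ≤ 2 ^ N * (n.factorial / c ^ n * Real.exp (c * r ^ a)) * Real.exp (-(c * r ^ a)) := by
          gcongr; exact h4.trans (by gcongr)
      _ = 2 ^ N * (n.factorial / c ^ n) * (Real.exp (c * r ^ a) * Real.exp (-(c * r ^ a))) := by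
          ring
      _ ≤ _ := by rw [h6, mul_one]; gcongr; linarith

namespace IsRegularJumpDensity

variable {a c C : ℝ} {M : ℕ → ℝ} {G : V → ℝ}

theorem integrable_norm (hG : IsRegularJumpDensity a c C M G) (k : ℕ) (hk : 2 ≤ k) :
    Integrable fun y => ‖y‖ ^ k * ‖(G y : ℂ)‖ := by
  refine (hG.integrable k hk).congr (ae_of_all _ fun y => ?_)
  simp [abs_of_nonneg (hG.nonneg y)]

theorem aestronglyMeasurable_ofReal (hG : IsRegularJumpDensity a c C M G) :
    AEStronglyMeasurable (fun y => (G y : ℂ)) volume :=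
  (Complex.measurable_ofReal.comp hG.measurable).aestronglyMeasurable

/-- The first-order compensator is purely imaginary, so the real part of the integrand is `(cos - 1)
G`, without any symmetry of `G`. This transfers smoothness and derivative bounds to the exponent. -/
theorem re_compFourier (hG : IsRegularJumpDensity a c C M G) :
    Complex.reCLM ∘ compFourier (fun y => (G y : ℂ)) =
      fun ξ => -symExponent G ((2 * Real.pi) • ξ) := by
  funext ξ
  simp only [Function.comp_apply, compFourier, symExponent, ← integral_neg]
  by_cases hint : Integrable fun v : V => Real.fourierChar (-⟪v, ξ⟫) • (G v : ℂ) - (G v : ℂ) -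
      VectorFourier.fourierSMulRight (innerSL ℝ) (fun y => (G y : ℂ)) v ξ
  · rw [← Complex.reCLM.integral_comp_comm hint]
    refine integral_congr_ae (ae_of_all _ fun v => ?_)
    have h1 : ⟪(2 * Real.pi) • ξ, v⟫ = 2 * Real.pi * ⟪v, ξ⟫ := by
      rw [inner_smul_left, real_inner_comm]; simp
    have h2 : (VectorFourier.fourierSMulRight (innerSL ℝ) (fun y => (G y : ℂ)) v ξ).re = 0 := by
      rw [VectorFourier.fourierSMulRight_apply, innerSL_apply_apply]
      simp
    have h3 : (Real.fourierChar (-⟪v, ξ⟫) • (G v : ℂ)).re =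
        Real.cos (2 * Real.pi * ⟪v, ξ⟫) * G v := by
      rw [Circle.smul_def, Real.fourierChar_apply, smul_eq_mul, Complex.re_mul_ofReal,
        Complex.exp_ofReal_mul_I_re]
      simp
    simp only [Complex.reCLM_apply, Complex.sub_re, h1, h2, h3, Complex.ofReal_re]
    ring
  · exact absurd (integrable_compFourier_integrand hG.aestronglyMeasurable_ofReal
      (hG.integrable_norm 2 le_rfl) ξ) hint

theorem contDiff_neg_symExponent (hG : IsRegularJumpDensity a c C M G) :
    ContDiff ℝ (⊤ : ℕ∞) fun ξ => -symExponent G ((2 * Real.pi) • ξ) := by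
  rw [← hG.re_compFourier]
  exact Complex.reCLM.contDiff.comp
    (contDiff_compFourier hG.aestronglyMeasurable_ofReal hG.integrable_norm)

/-- Since first moments may be infinite, the case `n = 1` uses the second moment, whence `max n 2`,
and pays with the factor `1 + ‖ξ‖`. -/
theorem norm_iteratedFDeriv_neg_symExponent_le (hG : IsRegularJumpDensity a c C M G) {n : ℕ}
    (hn : 1 ≤ n) (ξ : V) :
    ‖iteratedFDeriv ℝ n (fun ξ => -symExponent G ((2 * Real.pi) • ξ)) ξ‖ ≤
      ((2 * Real.pi) ^ (n + 1) * M (max n 2)) * (1 + ‖ξ‖) := by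
  have hmom : ∀ k, 2 ≤ k → ∫ y, ‖y‖ ^ k * ‖(G y : ℂ)‖ ≤ M k := fun k hk => by
    refine le_trans (le_of_eq (integral_congr_ae (ae_of_all _ fun y => ?_))) (hG.moment_le k hk)
    simp [abs_of_nonneg (hG.nonneg y)]
  have hM : ∀ k, 2 ≤ k → 0 ≤ M k := fun k hk =>
    le_trans (integral_nonneg fun y => mul_nonneg (by positivity) (hG.nonneg y))
      (hG.moment_le k hk)
  have hcd := contDiff_compFourier hG.aestronglyMeasurable_ofReal hG.integrable_norm
  have hpi : 1 ≤ 2 * Real.pi := by linarith [Real.pi_gt_three]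
  rw [← hG.re_compFourier]
  refine (Complex.reCLM.norm_iteratedFDeriv_comp_left hcd.contDiffAt
    (by exact_mod_cast le_top)).trans ?_
  rw [Complex.reCLM_norm, one_mul]
  obtain rfl | ⟨k, rfl⟩ : n = 1 ∨ ∃ k, n = k + 2 := by
    rcases n with _ | _ | k
    · omega
    · exact Or.inl rfl
    · exact Or.inr ⟨k, rfl⟩
  · refine (norm_iteratedFDeriv_one_compFourier_le hG.aestronglyMeasurable_ofReal
      hG.integrable_norm ξ).trans ?_
    have h2 := hM 2 le_rfl
    calc _ ≤ (2 * Real.pi) ^ 2 * (1 + ‖ξ‖) * M 2 := by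
          gcongr
          · linarith
          · exact hmom 2 le_rfl
      _ = _ := by norm_num; ring
  · refine (norm_iteratedFDeriv_add_two_compFourier_le hG.aestronglyMeasurable_ofReal
      hG.integrable_norm k ξ).trans ?_
    have h2 := hM (k + 2) (by omega)
    rw [max_eq_left (by omega)]
    calc _ ≤ (2 * Real.pi) ^ (k + 2 + 1) * M (k + 2) * 1 := by
          rw [mul_one]
          exact mul_le_mul (pow_le_pow_right₀ hpi (Nat.le_succ _)) (hmom _ (by omega))
            (integral_nonneg fun y => by positivity) (by positivity)
      _ ≤ _ := by gcongr; linarith [norm_nonneg ξ]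

theorem contDiff_expSymExponent (hG : IsRegularJumpDensity a c C M G) :
    ContDiff ℝ (⊤ : ℕ∞) (expSymExponent G) :=
  Complex.ofRealCLM.contDiff.comp (Real.contDiff_exp.comp hG.contDiff_neg_symExponent)

theorem norm_expSymExponent_le (hG : IsRegularJumpDensity a c C M G) (ha : 0 < a) (hc : 0 < c)
    (ξ : V) : Real.exp (-symExponent G ((2 * Real.pi) • ξ)) ≤
      Real.exp C * Real.exp (-(c * ‖ξ‖ ^ a)) := by
  rw [← Real.exp_add, Real.exp_le_exp]
  have h1 := hG.le_symExponent ((2 * Real.pi) • ξ)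
  have hpi : 1 ≤ 2 * Real.pi := by linarith [Real.pi_gt_three]
  have h2 : ‖ξ‖ ^ a ≤ ‖(2 * Real.pi) • ξ‖ ^ a := by
    refine Real.rpow_le_rpow (norm_nonneg _) ?_ ha.le
    rw [norm_smul, Real.norm_of_nonneg (by positivity)]
    exact le_mul_of_one_le_left (norm_nonneg _) hpi
  nlinarith

theorem norm_iteratedFDeriv_expSymExponent_le (hG : IsRegularJumpDensity a c C M G)
    (ha : 0 < a) (hc : 0 < c) (n : ℕ) (ξ : V) :
    ‖iteratedFDeriv ℝ n (expSymExponent G) ξ‖ ≤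
      n.factorial * (Real.exp C * Real.exp (-(c * ‖ξ‖ ^ a))) *
        ((1 + ∑ i ∈ Finset.range (n + 1), (2 * Real.pi) ^ (i + 1) * |M (max i 2)|) *
          (1 + ‖ξ‖)) ^ n := by
  have h0 : expSymExponent G =
      Complex.ofRealLI ∘ (Real.exp ∘ fun ξ => -symExponent G ((2 * Real.pi) • ξ)) := rfl
  have hcd : ContDiff ℝ (⊤ : ℕ∞) (Real.exp ∘ fun ξ => -symExponent G ((2 * Real.pi) • ξ)) :=
    Real.contDiff_exp.comp hG.contDiff_neg_symExponent
  rw [h0, Complex.ofRealLI.norm_iteratedFDeriv_comp_left hcd.contDiffAt (by exact_mod_cast le_top)]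
  refine (norm_iteratedFDeriv_comp_le (N := ((⊤ : ℕ∞) : WithTop ℕ∞)) Real.contDiff_exp
    hG.contDiff_neg_symExponent (by exact_mod_cast le_top) ξ
    (C := Real.exp (-symExponent G ((2 * Real.pi) • ξ)))
    (D := (1 + ∑ i ∈ Finset.range (n + 1), (2 * Real.pi) ^ (i + 1) * |M (max i 2)|) * (1 + ‖ξ‖))
    (fun i _ => ?_) (fun i hi hin => ?_)).trans ?_
  · rw [norm_iteratedFDeriv_eq_norm_iteratedDeriv, iteratedDeriv_eq_iterate, Real.iter_deriv_exp,
      Real.norm_of_nonneg (Real.exp_nonneg _)]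
  · have hS : (2 * Real.pi) ^ (i + 1) * |M (max i 2)| ≤
        ∑ i ∈ Finset.range (n + 1), (2 * Real.pi) ^ (i + 1) * |M (max i 2)| :=
      Finset.single_le_sum (f := fun i => (2 * Real.pi) ^ (i + 1) * |M (max i 2)|)
        (fun i _ => by positivity) (Finset.mem_range.2 (by omega))
    have hS0 : 0 ≤ (2 * Real.pi) ^ (i + 1) * |M (max i 2)| := by positivity
    refine (hG.norm_iteratedFDeriv_neg_symExponent_le hi ξ).trans ?_
    -- The bound for composites asks for `D ^ i`; the summand `1` in `D` ensures `D ≥ 1`, so a bound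
    -- by `D` suffices.
    refine le_trans ?_ (le_self_pow₀ ?_ (by omega))
    · have := le_abs_self (M (max i 2))
      gcongr
      refine le_trans ?_ (hS.trans (by linarith))
      gcongr
    · exact one_le_mul_of_one_le_of_one_le (by linarith) (by linarith [norm_nonneg ξ])
  · gcongr
    exact hG.norm_expSymExponent_le ha hc ξ

end IsRegularJumpDensity

/-- Integrable majorants for the derivatives of `expSymExponent G`, uniform in `G`. -/
theorem exists_majorant_iteratedFDeriv_expSymExponent {a c : ℝ} (C : ℝ) (M : ℕ → ℝ) (ha : 0 < a)
    (hc : 0 < c) (k n : ℕ) : ∃ B : ℝ, 0 < B ∧ ∀ G : V → ℝ, IsRegularJumpDensity a c C M G →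
      ∀ ξ, ‖ξ‖ ^ k * ‖iteratedFDeriv ℝ n (expSymExponent G) ξ‖ ≤
        B * (1 + ‖ξ‖) ^ (-(Module.finrank ℝ V + 1 : ℝ)) := by
  set S := 1 + ∑ i ∈ Finset.range (n + 1), (2 * Real.pi) ^ (i + 1) * |M (max i 2)| with hSdef
  have hS : 0 < S := add_pos_of_pos_of_nonneg one_pos (Finset.sum_nonneg fun i _ => by positivity)
  -- `k` powers absorb the weight, `n` the growth from differentiating the exponential, and `finrank
  -- + 1` leave an integrable majorant.
  obtain ⟨K, hK, hKr⟩ := exists_one_add_pow_mul_exp_le ha hc (k + n + (Module.finrank ℝ V + 1))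
  refine ⟨n.factorial * Real.exp C * S ^ n * K, by positivity, fun G hG ξ => ?_⟩
  have h1 : 0 < 1 + ‖ξ‖ := by positivity
  rw [Real.rpow_neg h1.le, ← div_eq_mul_inv, le_div_iff₀ (by positivity)]
  have h2 : (1 + ‖ξ‖) ^ (Module.finrank ℝ V + 1 : ℝ) = (1 + ‖ξ‖) ^ (Module.finrank ℝ V + 1) := by
    exact_mod_cast Real.rpow_natCast (1 + ‖ξ‖) (Module.finrank ℝ V + 1)
  rw [h2]
  have h3 := hG.norm_iteratedFDeriv_expSymExponent_le ha hc n ξ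
  calc _ ≤ (1 + ‖ξ‖) ^ k * (n.factorial * (Real.exp C * Real.exp (-(c * ‖ξ‖ ^ a))) *
        (S * (1 + ‖ξ‖)) ^ n) * (1 + ‖ξ‖) ^ (Module.finrank ℝ V + 1) := by
        gcongr; linarith
    _ = n.factorial * Real.exp C * S ^ n * ((1 + ‖ξ‖) ^ (k + n + (Module.finrank ℝ V + 1)) *
        Real.exp (-(c * ‖ξ‖ ^ a))) := by
        rw [mul_pow, pow_add, pow_add]; ring
    _ ≤ _ := by gcongr; exact hKr _ (norm_nonneg _)

theorem integrable_one_add_norm_finrank :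
    Integrable fun ξ : V => (1 + ‖ξ‖) ^ (-(Module.finrank ℝ V + 1 : ℝ)) :=
  integrable_one_add_norm (by linarith)

theorem IsRegularJumpDensity.integrable_pow_mul_iteratedFDeriv {a c C : ℝ} {M : ℕ → ℝ}
    {G : V → ℝ} (hG : IsRegularJumpDensity a c C M G) (ha : 0 < a) (hc : 0 < c) (k n : ℕ) :
    Integrable fun ξ => ‖ξ‖ ^ k * ‖iteratedFDeriv ℝ n (expSymExponent G) ξ‖ := by
  obtain ⟨B, hB, h⟩ := exists_majorant_iteratedFDeriv_expSymExponent (V := V) C M ha hc k n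
  refine (integrable_one_add_norm_finrank.const_mul B).mono' ?_ (ae_of_all _ fun ξ => ?_)
  · exact ((continuous_norm.pow k).mul (hG.contDiff_expSymExponent.continuous_iteratedFDeriv
      (by exact_mod_cast le_top)).norm).aestronglyMeasurable
  · rw [Real.norm_of_nonneg (by positivity)]
    exact h G hG ξ

/-- The density `𝓕 (expSymExponent G)` has rapidly decreasing derivatives, uniformly in `G`. -/
theorem exists_pow_mul_iteratedFDeriv_fourier_le {a c : ℝ} (C : ℝ) (M : ℕ → ℝ) (ha : 0 < a)
    (hc : 0 < c) (k n : ℕ) : ∃ B : ℝ, 0 < B ∧ ∀ G : V → ℝ, IsRegularJumpDensity a c C M G →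
      ∀ x, ‖x‖ ^ n * ‖iteratedFDeriv ℝ k (𝓕 (expSymExponent G)) x‖ ≤ B := by
  choose B hB h using fun p : ℕ × ℕ =>
    exists_majorant_iteratedFDeriv_expSymExponent (V := V) C M ha hc p.1 p.2
  set I := ∫ ξ : V, (1 + ‖ξ‖) ^ (-(Module.finrank ℝ V + 1 : ℝ))
  have hI : 0 ≤ I := integral_nonneg fun ξ => by positivity
  have hS : 0 ≤ ∑ p ∈ Finset.range (k + 1) ×ˢ Finset.range (n + 1), B p * I :=
    Finset.sum_nonneg fun p _ => mul_nonneg (hB p).le hI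
  refine ⟨(2 * Real.pi) ^ k * (2 * k + 2) ^ n *
    ∑ p ∈ Finset.range (k + 1) ×ˢ Finset.range (n + 1), B p * I + 1, by positivity,
    fun G hG x => ?_⟩
  refine (Real.pow_mul_norm_iteratedFDeriv_fourier_le (K := ⊤) (N := ⊤)
    hG.contDiff_expSymExponent (fun k n _ _ => hG.integrable_pow_mul_iteratedFDeriv ha hc k n)
    le_top le_top x).trans ?_
  refine le_trans ?_ (le_add_of_nonneg_right zero_le_one)
  gcongr with p _
  rw [← integral_const_mul]
  exact integral_mono (hG.integrable_pow_mul_iteratedFDeriv ha hc _ _)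
    (integrable_one_add_norm_finrank.const_mul _) (h p G hG)

end SymExponent

/-! ### Scaling profiles and their truncations -/

/-- A profile normalised at `1` whose scaling exponents lie between `-n-b` and `-n-a`. -/
structure IsScalingProfile (n : ℕ) (a b : ℝ) (F : ℝ → ℝ) : Prop where
  one : F 1 = 1
  le_mul : ∀ r l : ℝ, 0 < r → 1 ≤ l → l ^ (-(n : ℝ) - b) * F r ≤ F (l * r)
  mul_le : ∀ r l : ℝ, 0 < r → 1 ≤ l → F (l * r) ≤ l ^ (-(n : ℝ) - a) * F r

/-- The truncation at level one of a decreasing profile. -/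
def truncProfile (F : ℝ → ℝ) (r : ℝ) : ℝ := F (max 1 r)

namespace IsScalingProfile

variable {n : ℕ} {a b : ℝ} {F : ℝ → ℝ}

theorem rpow_le_of_le_one (hF : IsScalingProfile n a b F) {r : ℝ} (hr : 0 < r) (h1 : r ≤ 1) :
    r ^ (-(n : ℝ) - a) ≤ F r := by
  have h := hF.mul_le r r⁻¹ hr ((one_le_inv₀ hr).2 h1)
  rw [inv_mul_cancel₀ hr.ne', hF.one, Real.inv_rpow hr.le, ← div_eq_inv_mul,
    le_div_iff₀ (by positivity), one_mul] at h
  exact h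

theorem le_rpow_of_le_one (hF : IsScalingProfile n a b F) {r : ℝ} (hr : 0 < r) (h1 : r ≤ 1) :
    F r ≤ r ^ (-(n : ℝ) - b) := by
  have h := hF.le_mul r r⁻¹ hr ((one_le_inv₀ hr).2 h1)
  rw [inv_mul_cancel₀ hr.ne', hF.one, Real.inv_rpow hr.le, ← div_eq_inv_mul,
    div_le_iff₀ (by positivity), one_mul] at h
  exact h

theorem rpow_le_of_one_le (hF : IsScalingProfile n a b F) {r : ℝ} (h1 : 1 ≤ r) :
    r ^ (-(n : ℝ) - b) ≤ F r := by
  simpa [hF.one] using hF.le_mul 1 r one_pos h1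

theorem le_rpow_of_one_le (hF : IsScalingProfile n a b F) {r : ℝ} (h1 : 1 ≤ r) :
    F r ≤ r ^ (-(n : ℝ) - a) := by
  simpa [hF.one] using hF.mul_le 1 r one_pos h1

theorem pos (hF : IsScalingProfile n a b F) {r : ℝ} (hr : 0 < r) : 0 < F r := by
  rcases le_total r 1 with h | h
  · exact lt_of_lt_of_le (by positivity) (hF.rpow_le_of_le_one hr h)
  · exact lt_of_lt_of_le (by positivity) (hF.rpow_le_of_one_le h)

theorem antitone (hF : IsScalingProfile n a b F) (ha : 0 < a) {r s : ℝ} (hr : 0 < r)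
    (hrs : r ≤ s) : F s ≤ F r := by
  have h1 : 1 ≤ s / r := (one_le_div hr).2 hrs
  have h := hF.mul_le r (s / r) hr h1
  rw [div_mul_cancel₀ _ hr.ne'] at h
  refine h.trans (mul_le_of_le_one_left (hF.pos hr).le ?_)
  exact Real.rpow_le_one_of_one_le_of_nonpos h1 (by linarith [(Nat.cast_nonneg n : (0 : ℝ) ≤ n)])

theorem trunc_pos (hF : IsScalingProfile n a b F) (r : ℝ) : 0 < truncProfile F r :=
  hF.pos (lt_of_lt_of_le one_pos (le_max_left _ _))

theorem trunc_antitone (hF : IsScalingProfile n a b F) (ha : 0 < a) :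
    Antitone (truncProfile F) := fun _ _ h =>
  hF.antitone ha (lt_of_lt_of_le one_pos (le_max_left _ _)) (max_le_max le_rfl h)

theorem trunc_measurable (hF : IsScalingProfile n a b F) (ha : 0 < a) :
    Measurable (truncProfile F) := (hF.trunc_antitone ha).measurable

theorem trunc_of_le_one (hF : IsScalingProfile n a b F) {r : ℝ} (h : r ≤ 1) :
    truncProfile F r = 1 := by
  rw [truncProfile, max_eq_left h, hF.one]

theorem trunc_le_one (hF : IsScalingProfile n a b F) (ha : 0 < a) (r : ℝ) :
    truncProfile F r ≤ 1 := by
  rw [← hF.one]; exact hF.antitone ha one_pos (le_max_left _ _)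

theorem trunc_eq_min (hF : IsScalingProfile n a b F) (ha : 0 < a) {r : ℝ} (hr : 0 < r) :
    truncProfile F r = min 1 (F r) := by
  rcases le_total r 1 with h | h
  · rw [hF.trunc_of_le_one h, min_eq_left]
    rw [← hF.one]; exact hF.antitone ha hr h
  · rw [truncProfile, max_eq_right h, min_eq_right]
    rw [← hF.one]; exact hF.antitone ha one_pos h

/-- Doubling property of the truncated profile. -/
theorem trunc_le_two_rpow_mul (hF : IsScalingProfile n a b F) (ha : 0 < a) {r s : ℝ}
    (h : s ≤ 2 * max 1 r) :
    truncProfile F r ≤ 2 ^ ((n : ℝ) + b) * truncProfile F s := by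
  have h1 : (0 : ℝ) < max 1 r := lt_of_lt_of_le one_pos (le_max_left _ _)
  have h2 : max 1 s ≤ 2 * max 1 r := max_le (by linarith [le_max_left 1 r]) h
  have h3 := hF.le_mul (max 1 r) 2 h1 one_le_two
  have h4 := hF.antitone ha (lt_of_lt_of_le one_pos (le_max_left 1 s)) h2
  have h5 : (2 : ℝ) ^ ((n : ℝ) + b) * 2 ^ (-(n : ℝ) - b) = 1 := by
    rw [← Real.rpow_add two_pos]; ring_nf; simp
  calc truncProfile F r = 2 ^ ((n : ℝ) + b) * (2 ^ (-(n : ℝ) - b) * F (max 1 r)) := by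
        rw [← mul_assoc, h5, one_mul, truncProfile]
    _ ≤ 2 ^ ((n : ℝ) + b) * F (max 1 s) := by gcongr; exact h3.trans h4
    _ = _ := rfl

/-- A majorant that depends only on `n` and `a`, integrable in dimension `n`; it makes all mass
bounds uniform in `F`. -/
theorem trunc_le_rpow (hF : IsScalingProfile n a b F) (ha : 0 < a) {r : ℝ} (hr : 0 ≤ r) :
    truncProfile F r ≤ 2 ^ ((n : ℝ) + a) * (1 + r) ^ (-((n : ℝ) + a)) := by
  have h1 : (0 : ℝ) < max 1 r := lt_of_lt_of_le one_pos (le_max_left _ _)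
  have h2 : (1 + r) / 2 ≤ max 1 r := by
    rcases le_total r 1 with h | h
    · rw [max_eq_left h]; linarith
    · rw [max_eq_right h]; linarith
  have h3 : truncProfile F r ≤ ((1 + r) / 2) ^ (-((n : ℝ) + a)) := by
    refine (hF.le_rpow_of_one_le (le_max_left _ _)).trans ?_
    rw [show -(n : ℝ) - a = -((n : ℝ) + a) by ring]
    exact Real.rpow_le_rpow_of_nonpos (by positivity) h2
      (by linarith [(Nat.cast_nonneg n : (0 : ℝ) ≤ n)])
  refine h3.trans (le_of_eq ?_)
  rw [Real.div_rpow (by positivity) two_pos.le, Real.rpow_neg two_pos.le, div_inv_eq_mul, mul_comm]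

/-- A profile decays no faster than `r^{-n-b}`, so polynomial decay of order `m ≥ n + b` is absorbed
with a constant independent of `F`. -/
theorem le_trunc (hF : IsScalingProfile n a b F) {m : ℕ} (hm : (n : ℝ) + b ≤ m) {r B c : ℝ}
    (hB0 : 0 ≤ B) (hr : 0 ≤ r) (h0 : c ≤ B) (hm' : r ^ m * c ≤ B) : c ≤ B * truncProfile F r := by
  rcases le_total r 1 with h | h
  · rw [hF.trunc_of_le_one h, mul_one]; exact h0
  · have hr0 : 0 < r := by linarith
    have hB : c ≤ B * r ^ (-(m : ℝ)) := by
      rw [Real.rpow_neg hr, Real.rpow_natCast, ← div_eq_mul_inv, le_div_iff₀ (by positivity)]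
      linarith
    refine hB.trans (mul_le_mul_of_nonneg_left ?_ hB0)
    rw [truncProfile, max_eq_right h]
    refine le_trans ?_ (hF.rpow_le_of_one_le h)
    exact Real.rpow_le_rpow_of_exponent_le h (by linarith)

end IsScalingProfile

/-! ### Splitting a jump density by height; the singular part -/

section JumpDensity

variable {V : Type*} [NormedAddCommGroup V]

/-- A symmetric jump density comparable with the radial profile `F` with constant `c`. -/
structure IsJumpDensity [MeasurableSpace V] (c : ℝ) (F : ℝ → ℝ) (g : V → ℝ) : Prop where
  measurable : Measurable g
  nonneg : ∀ y, 0 ≤ g y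
  symm : ∀ y, g (-y) = g y
  le : ∀ y, y ≠ 0 → c⁻¹ * F ‖y‖ ≤ g y
  ge : ∀ y, y ≠ 0 → g y ≤ c * F ‖y‖

/-- The bounded part of a jump density. -/
def boundedPart (g : V → ℝ) (y : V) : ℝ := min (g y) 1

/-- The unbounded part of a jump density. -/
def singularPart (g : V → ℝ) (y : V) : ℝ := g y - min (g y) 1

variable [InnerProductSpace ℝ V] [FiniteDimensional ℝ V] [MeasurableSpace V] [BorelSpace V]

namespace IsJumpDensity

variable {n : ℕ} {a b c : ℝ} {F : ℝ → ℝ} {g : V → ℝ}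

section

variable (hg : IsJumpDensity c F g)
include hg

theorem boundedPart_nonneg (y : V) : 0 ≤ boundedPart g y := le_min (hg.nonneg y) zero_le_one

theorem boundedPart_measurable : Measurable (boundedPart g) := hg.measurable.min measurable_const

theorem singularPart_nonneg (y : V) : 0 ≤ singularPart g y :=
  sub_nonneg.2 (min_le_left _ _)

theorem singularPart_measurable : Measurable (singularPart g) :=
  hg.measurable.sub (hg.measurable.min measurable_const)

theorem boundedPart_neg (y : V) : boundedPart g (-y) = boundedPart g y := by
  rw [boundedPart, hg.symm, boundedPart]

theorem singularPart_neg (y : V) : singularPart g (-y) = singularPart g y := by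
  rw [singularPart, hg.symm, singularPart]

theorem singularPart_le (y : V) : singularPart g y ≤ g y :=
  sub_le_self _ (hg.boundedPart_nonneg y)

theorem boundedPart_le (hF : IsScalingProfile n a b F) (ha : 0 < a) (hc : 1 ≤ c) (y : V) :
    boundedPart g y ≤ c * truncProfile F ‖y‖ := by
  -- Comparability says nothing about `g 0`; there the cap at `1` suffices.
  by_cases hy : y = 0
  · rw [hy, norm_zero, hF.trunc_of_le_one zero_le_one]
    exact (min_le_right _ _).trans (by linarith)
  · rw [hF.trunc_eq_min ha (norm_pos_iff.2 hy), mul_min_of_nonneg _ _ (by linarith), mul_one]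
    exact le_min ((min_le_right _ _).trans hc) ((min_le_left _ _).trans (hg.ge y hy))

theorem le_boundedPart (hF : IsScalingProfile n a b F) (ha : 0 < a) (hc : 1 ≤ c) {y : V}
    (hy : y ≠ 0) : c⁻¹ * truncProfile F ‖y‖ ≤ boundedPart g y := by
  rw [hF.trunc_eq_min ha (norm_pos_iff.2 hy), mul_min_of_nonneg _ _ (by positivity), mul_one]
  exact le_min ((min_le_right _ _).trans (hg.le y hy))
    ((min_le_left _ _).trans (inv_le_one_of_one_le₀ hc))

/-- Beyond radius `c^{1/a}` one has `g ≤ c |y|^{-n-a} ≤ 1`, so nothing exceeds the cap. The cut by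
height thus gives support in a ball of controlled radius. -/
theorem singularPart_eq_zero (hF : IsScalingProfile n a b F) (ha : 0 < a) (hc : 1 ≤ c) {y : V}
    (hy : c ^ a⁻¹ ≤ ‖y‖) : singularPart g y = 0 := by
  have h1 : 1 ≤ ‖y‖ := (Real.one_le_rpow hc (by positivity)).trans hy
  have h0 : 0 < ‖y‖ := by linarith
  have h2 : c ≤ ‖y‖ ^ ((n : ℝ) + a) := by
    calc c = (c ^ a⁻¹) ^ a := by rw [← Real.rpow_mul (by linarith), inv_mul_cancel₀ ha.ne',
          Real.rpow_one]
      _ ≤ ‖y‖ ^ a := Real.rpow_le_rpow (by positivity) hy ha.le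
      _ ≤ _ := Real.rpow_le_rpow_of_exponent_le h1
        (by linarith [(Nat.cast_nonneg n : (0 : ℝ) ≤ n)])
  have h3 : g y ≤ 1 := by
    refine (hg.ge y (norm_pos_iff.1 h0)).trans ?_
    have h4 := hF.le_rpow_of_one_le h1
    rw [show -(n : ℝ) - a = -((n : ℝ) + a) by ring, Real.rpow_neg h0.le] at h4
    calc c * F ‖y‖ ≤ ‖y‖ ^ ((n : ℝ) + a) * (‖y‖ ^ ((n : ℝ) + a))⁻¹ := by
          gcongr
          exact (hF.pos h0).le
      _ = 1 := mul_inv_cancel₀ (by positivity)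
  rw [singularPart, min_eq_left h3, sub_self]

/-- So close to the origin `c⁻¹ |y|^{-n-a} ≥ 2`, hence removing at most `1` loses at most half of
this lower bound for `g`. -/
theorem le_singularPart (hF : IsScalingProfile n a b F) (ha : 0 < a) (hc : 1 ≤ c) {y : V}
    (h0 : y ≠ 0) (hy : ‖y‖ ≤ (2 * c) ^ (-a⁻¹)) :
    (2 * c)⁻¹ * ‖y‖ ^ (-(n : ℝ) - a) ≤ singularPart g y := by
  have hy0 : 0 < ‖y‖ := norm_pos_iff.2 h0
  have h1 : ‖y‖ ≤ 1 := hy.trans (Real.rpow_le_one_of_one_le_of_nonpos (by linarith)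
    (by simp [ha.le]))
  have h2 : 2 * c ≤ ‖y‖ ^ (-(n : ℝ) - a) := by
    calc 2 * c = ((2 * c) ^ (-a⁻¹)) ^ (-a) := by
          rw [← Real.rpow_mul (by linarith), neg_mul_neg, inv_mul_cancel₀ ha.ne', Real.rpow_one]
      _ ≤ ‖y‖ ^ (-a) := Real.rpow_le_rpow_of_nonpos hy0 hy (by linarith)
      _ ≤ _ := Real.rpow_le_rpow_of_exponent_ge hy0 h1
        (by linarith [(Nat.cast_nonneg n : (0 : ℝ) ≤ n)])
  have h3 := hF.rpow_le_of_le_one hy0 h1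
  have h4 : c⁻¹ * ‖y‖ ^ (-(n : ℝ) - a) ≤ g y :=
    le_trans (by gcongr) (hg.le y h0)
  have h5 : (1 : ℝ) ≤ (2 * c)⁻¹ * ‖y‖ ^ (-(n : ℝ) - a) := by
    rw [← div_eq_inv_mul, le_div_iff₀ (by linarith)]; linarith
  have h6 : c⁻¹ = 2 * (2 * c)⁻¹ := by rw [mul_inv]; ring
  rw [h6] at h4
  rw [singularPart]
  linarith [min_le_right (g y) 1]

end

end IsJumpDensity

variable [Nontrivial V]

theorem integrableOn_norm_rpow_ball {s : ℝ} (hs : -(Module.finrank ℝ V : ℝ) < s) (R : ℝ) :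
    IntegrableOn (fun y : V => ‖y‖ ^ s) (Metric.ball 0 R) := by
  rw [integrableOn_fun_norm_addHaar volume (f := fun r : ℝ => r ^ s)]
  rcases le_or_gt R 0 with hR | hR
  · simp [Set.Ioo_eq_empty (not_lt.2 hR)]
  have hfr : 1 ≤ Module.finrank ℝ V := Module.finrank_pos
  refine ((intervalIntegral.integrableOn_Ioo_rpow_iff
    (s := s + (Module.finrank ℝ V - 1 : ℕ)) hR).2 ?_).congr_fun ?_ measurableSet_Ioo
  · rw [Nat.cast_sub hfr]; push_cast; linarith
  · intro r hr
    simp only [smul_eq_mul]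
    rw [Real.rpow_add_natCast hr.1.ne', mul_comm]

/-- A majorant for the `k`-th moment integrand of the singular part of a jump density. -/
noncomputable def momentMajorant (V : Type*) [NormedAddCommGroup V] [InnerProductSpace ℝ V]
    (a b c : ℝ) (k : ℕ) : V → ℝ :=
  (Metric.ball 0 (c ^ a⁻¹)).indicator fun y =>
    c * (c ^ a⁻¹) ^ k * (‖y‖ ^ (2 - (Module.finrank ℝ V : ℝ) - b) + 1)

/-- The condition `b < 2` keeps the power `2 - d - b` above the threshold `-d` for integrability at
the origin. -/
theorem integrable_momentMajorant {a b c : ℝ} (hb : b < 2) (k : ℕ) :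
    Integrable (momentMajorant V a b c k) := by
  refine IntegrableOn.integrable_indicator (Integrable.const_mul (Integrable.add ?_ ?_) _)
    measurableSet_ball
  · exact integrableOn_norm_rpow_ball (by linarith) _
  · exact integrableOn_const (measure_ball_lt_top.ne)

namespace IsJumpDensity

variable {a b c : ℝ} {F : ℝ → ℝ} {g : V → ℝ}

theorem pow_mul_singularPart_le (hg : IsJumpDensity c F g)
    (hF : IsScalingProfile (Module.finrank ℝ V) a b F) (ha : 0 < a) (hc : 1 ≤ c) {k : ℕ}
    (hk : 2 ≤ k) (y : V) : ‖y‖ ^ k * singularPart g y ≤ momentMajorant V a b c k y := by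
  have hR : 1 ≤ c ^ a⁻¹ := Real.one_le_rpow hc (by positivity)
  by_cases hy : y ∈ Metric.ball (0 : V) (c ^ a⁻¹)
  · rw [momentMajorant, Set.indicator_of_mem hy]
    rw [mem_ball_zero_iff] at hy
    by_cases h0 : y = 0
    · rw [h0, norm_zero, zero_pow (by omega), zero_mul]
      positivity
    have hy0 : 0 < ‖y‖ := norm_pos_iff.2 h0
    have h1 := (hg.singularPart_le y).trans (hg.ge y h0)
    have hs := hg.singularPart_nonneg y
    rcases le_total ‖y‖ 1 with h | h
    · calc ‖y‖ ^ k * singularPart g y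
          ≤ ‖y‖ ^ 2 * (c * ‖y‖ ^ (-(Module.finrank ℝ V : ℝ) - b)) := by
            refine mul_le_mul (pow_le_pow_of_le_one hy0.le h hk) (h1.trans ?_) hs (by positivity)
            gcongr
            exact hF.le_rpow_of_le_one hy0 h
        _ = c * 1 * (‖y‖ ^ (2 - (Module.finrank ℝ V : ℝ) - b)) := by
            rw [show 2 - (Module.finrank ℝ V : ℝ) - b = (2 : ℕ) + (-(Module.finrank ℝ V : ℝ) - b) by
              push_cast; ring, Real.rpow_add hy0, Real.rpow_natCast]
            ring
        _ ≤ _ := by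
            gcongr
            · exact one_le_pow₀ hR
            · linarith
    · calc ‖y‖ ^ k * singularPart g y ≤ (c ^ a⁻¹) ^ k * (c * 1) := by
            refine mul_le_mul (pow_le_pow_left₀ hy0.le hy.le k) (h1.trans ?_) hs (by positivity)
            gcongr
            rw [← hF.one]
            exact hF.antitone ha one_pos h
        _ = c * (c ^ a⁻¹) ^ k * (0 + 1) := by ring
        _ ≤ _ := by gcongr; positivity
  · rw [momentMajorant, Set.indicator_of_notMem hy,
      hg.singularPart_eq_zero hF ha hc (by simpa using hy), mul_zero]

theorem integrable_pow_mul_singularPart (hg : IsJumpDensity c F g)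
    (hF : IsScalingProfile (Module.finrank ℝ V) a b F) (ha : 0 < a) (hb : b < 2) (hc : 1 ≤ c)
    {k : ℕ} (hk : 2 ≤ k) : Integrable fun y => ‖y‖ ^ k * singularPart g y := by
  refine (integrable_momentMajorant (V := V) (a := a) (c := c) hb k).mono'
    ((continuous_norm.pow k).aestronglyMeasurable.mul
      hg.singularPart_measurable.aestronglyMeasurable) (ae_of_all _ fun y => ?_)
  rw [Real.norm_of_nonneg (mul_nonneg (by positivity) (hg.singularPart_nonneg y))]
  exact hg.pow_mul_singularPart_le hF ha hc hk y

/-- The constant in the lower bound for the exponent of the singular part. -/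
noncomputable def _root_.exponentConst (V : Type*) [NormedAddCommGroup V] [InnerProductSpace ℝ V]
    [MeasurableSpace V] [BorelSpace V] [FiniteDimensional ℝ V] (c : ℝ) : ℝ :=
  (2 / Real.pi ^ 2 * (1 / 4) ^ 2) * (2 * c)⁻¹ *
    ((1 / 4) ^ Module.finrank ℝ V * (volume : Measure V).real (Metric.ball 0 1))

theorem _root_.exponentConst_pos {c : ℝ} (hc : 1 ≤ c) : 0 < exponentConst V c := by
  have : 0 < (volume : Measure V).real (Metric.ball 0 1) :=
    ENNReal.toReal_pos (Metric.measure_ball_pos _ _ one_pos).ne' measure_ball_lt_top.ne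
  unfold exponentConst
  positivity

/-- With `ρ = 1/|ξ|`, integrate only over the ball of radius `ρ/4` about the point at distance `ρ/2`
in the direction of `ξ`. There `⟨ξ,y⟩` lies in `[1/4, 3/4]`, so `1 - cos` is bounded below, and `|y|
≤ ρ` makes the density at least of order `ρ^{-d-a}`. The volume `ρ^d` turns this into `ρ^{-a} =
|ξ|^a`. Large `ξ` keeps the ball in the region where `le_singularPart` applies. -/
theorem exponentConst_mul_rpow_le (hg : IsJumpDensity c F g)
    (hF : IsScalingProfile (Module.finrank ℝ V) a b F) (ha : 0 < a) (hb : b < 2) (hc : 1 ≤ c)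
    {ξ : V} (hξ : (2 * c) ^ a⁻¹ ≤ ‖ξ‖) :
    exponentConst V c * ‖ξ‖ ^ a ≤ symExponent (singularPart g) ξ := by
  set N := Module.finrank ℝ V with hN
  have hξ0 : 0 < ‖ξ‖ := lt_of_lt_of_le (by positivity) hξ
  set ρ := ‖ξ‖⁻¹ with hρ
  have hρ0 : 0 < ρ := by positivity
  have hξρ : ‖ξ‖ * ρ = 1 := mul_inv_cancel₀ hξ0.ne'
  set B := Metric.ball ((ρ / 2 * ρ) • ξ) (ρ * (1 / 4)) with hB
  set K := (2 / Real.pi ^ 2 * (1 / 4) ^ 2) * ((2 * c)⁻¹ * ρ ^ (-(N : ℝ) - a)) with hK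
  have hcn : ‖(ρ / 2 * ρ) • ξ‖ = ρ / 2 := by
    rw [norm_smul, Real.norm_of_nonneg (by positivity), mul_assoc, mul_comm ρ, hξρ, mul_one]
  have hint := integrable_one_sub_cos_mul hg.singularPart_measurable
    (hg.integrable_pow_mul_singularPart hF ha hb hc le_rfl) ξ
  have hpt : ∀ y ∈ B, K ≤ (1 - Real.cos ⟪ξ, y⟫) * singularPart g y := by
    intro y hy
    rw [hB, mem_ball_iff_norm] at hy
    have hy1 : ‖y‖ ≤ ρ := by
      have := norm_le_norm_add_norm_sub ((ρ / 2 * ρ) • ξ) y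
      rw [norm_sub_rev, hcn] at this
      linarith
    have hin : ⟪ξ, y⟫ = 1 / 2 + ⟪ξ, y - (ρ / 2 * ρ) • ξ⟫ := by
      rw [inner_sub_right, inner_smul_right, real_inner_self_eq_norm_sq]
      linear_combination ((1 / 2) * (‖ξ‖ * ρ + 1)) * hξρ
    have hin2 : |⟪ξ, y - (ρ / 2 * ρ) • ξ⟫| ≤ 1 / 4 := by
      refine (abs_real_inner_le_norm _ _).trans ?_
      calc ‖ξ‖ * ‖y - (ρ / 2 * ρ) • ξ‖ ≤ ‖ξ‖ * (ρ * (1 / 4)) := by gcongr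
        _ = 1 / 4 := by rw [← mul_assoc, hξρ, one_mul]
    obtain ⟨hl, hr⟩ := abs_le.1 hin2
    have hlow : 1 / 4 ≤ ⟪ξ, y⟫ := by linarith
    have hup : ⟪ξ, y⟫ ≤ 3 / 4 := by linarith
    have hcos := Real.cos_le_one_sub_mul_cos_sq (x := ⟪ξ, y⟫)
      (abs_le.2 ⟨by linarith [Real.pi_gt_three], by linarith [Real.pi_gt_three]⟩)
    have hy0 : y ≠ 0 := by
      rintro rfl
      rw [inner_zero_right] at hlow
      linarith
    have hsm : ‖y‖ ≤ (2 * c) ^ (-a⁻¹) := by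
      refine hy1.trans ?_
      rw [Real.rpow_neg (by linarith)]
      exact inv_anti₀ (by positivity) hξ
    rw [hK]
    refine mul_le_mul ?_ ((mul_le_mul_of_nonneg_left ?_ (by positivity)).trans
      (hg.le_singularPart hF ha hc hy0 hsm)) (by positivity) (by linarith [Real.cos_le_one ⟪ξ, y⟫])
    · have : 2 / Real.pi ^ 2 * (1 / 4) ^ 2 ≤ 2 / Real.pi ^ 2 * ⟪ξ, y⟫ ^ 2 := by gcongr
      linarith
    · exact Real.rpow_le_rpow_of_nonpos (norm_pos_iff.2 hy0) hy1
        (by linarith [(Nat.cast_nonneg N : (0 : ℝ) ≤ N)])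
  have hvol : (volume : Measure V).real B =
      ρ ^ N * ((1 / 4) ^ N * (volume : Measure V).real (Metric.ball 0 1)) := by
    rw [hB, measureReal_def, Measure.addHaar_ball_of_pos _ _ (by positivity), ENNReal.toReal_mul,
      ENNReal.toReal_ofReal (by positivity), mul_pow, measureReal_def]
    ring
  calc exponentConst V c * ‖ξ‖ ^ a = K * (volume : Measure V).real B := by
        rw [hvol, hK, exponentConst, ← hN]
        have : ‖ξ‖ ^ a = ρ ^ (-(N : ℝ) - a) * ρ ^ N := by
          rw [← Real.rpow_add_natCast hρ0.ne', hρ, Real.inv_rpow hξ0.le, ← Real.rpow_neg hξ0.le]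
          congr 1; ring
        rw [this]; ring
    _ = ∫ y in B, K := by rw [setIntegral_const, smul_eq_mul, mul_comm]
    _ ≤ ∫ y in B, (1 - Real.cos ⟪ξ, y⟫) * singularPart g y :=
        setIntegral_mono_on (integrableOn_const (measure_ball_lt_top.ne)) hint.integrableOn
          measurableSet_ball hpt
    _ ≤ symExponent (singularPart g) ξ :=
        setIntegral_le_integral hint (ae_of_all _ fun y =>
          mul_nonneg (by linarith [Real.cos_le_one ⟪ξ, y⟫]) (hg.singularPart_nonneg y))

theorem isRegularJumpDensity_singularPart (hg : IsJumpDensity c F g)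
    (hF : IsScalingProfile (Module.finrank ℝ V) a b F) (ha : 0 < a) (hb : b < 2) (hc : 1 ≤ c) :
    IsRegularJumpDensity a (exponentConst V c) (exponentConst V c * (2 * c))
      (fun k => ∫ y, momentMajorant V a b c k y) (singularPart g) where
  measurable := hg.singularPart_measurable
  nonneg := hg.singularPart_nonneg
  integrable k hk := hg.integrable_pow_mul_singularPart hF ha hb hc hk
  moment_le k hk := integral_mono (hg.integrable_pow_mul_singularPart hF ha hb hc hk)
    (integrable_momentMajorant hb k) (hg.pow_mul_singularPart_le hF ha hc hk)
  le_symExponent ξ := by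
    have h0 := exponentConst_pos (V := V) hc
    rcases le_total ((2 * c) ^ a⁻¹) ‖ξ‖ with h | h
    · exact le_trans (sub_le_self _ (by positivity))
        (hg.exponentConst_mul_rpow_le hF ha hb hc h)
    -- For small `ξ` the subtracted constant makes the required lower bound nonpositive.
    · have h1 : ‖ξ‖ ^ a ≤ 2 * c := by
        calc ‖ξ‖ ^ a ≤ ((2 * c) ^ a⁻¹) ^ a := Real.rpow_le_rpow (norm_nonneg _) h ha.le
          _ = 2 * c := by
            rw [← Real.rpow_mul (by linarith), inv_mul_cancel₀ ha.ne', Real.rpow_one]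
      have h2 := symExponent_nonneg hg.singularPart_nonneg ξ
      nlinarith

end IsJumpDensity

end JumpDensity

/-! ### Nonnegativity of the inverse transform of `exp (-Φ)` -/

section Positivity

variable {V : Type*} [NormedAddCommGroup V] [InnerProductSpace ℝ V] [FiniteDimensional ℝ V]
  [MeasurableSpace V] [BorelSpace V]

theorem integral_withDensity_ofReal {E : Type*} [NormedAddCommGroup E] [NormedSpace ℝ E]
    {H : V → ℝ} (hH : Measurable H) (h0 : ∀ y, 0 ≤ H y) (u : V → E) :
    ∫ y, u y ∂(volume.withDensity fun y => ENNReal.ofReal (H y)) = ∫ y, H y • u y := by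
  rw [integral_withDensity_eq_integral_toReal_smul hH.ennreal_ofReal
    (ae_of_all _ fun y => ENNReal.ofReal_lt_top)]
  simp_rw [ENNReal.toReal_ofReal (h0 _)]

theorem isFiniteMeasure_withDensity_of_integrable {H : V → ℝ} (h : Integrable H) :
    IsFiniteMeasure (volume.withDensity fun y => ENNReal.ofReal (H y)) :=
  isFiniteMeasure_withDensity_ofReal h.2

theorem charFun_withDensity_symm {H : V → ℝ} (hH : Measurable H) (h0 : ∀ y, 0 ≤ H y)
    (hs : ∀ y, H (-y) = H y) (hi : Integrable H) (ξ : V) :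
    charFun (volume.withDensity fun y => ENNReal.ofReal (H y)) ξ =
      (((∫ y, H y) - symExponent H ξ : ℝ) : ℂ) := by
  have hint : Integrable fun y => H y • Complex.exp ((⟪y, ξ⟫ : ℝ) * Complex.I) := by
    refine hi.norm.mono' (by fun_prop) (ae_of_all _ fun y => ?_)
    rw [norm_smul, Complex.norm_exp_ofReal_mul_I, mul_one]
  have hc : Integrable fun y => (1 - Real.cos ⟪ξ, y⟫) * H y := by
    refine (hi.norm.const_mul 2).mono' (by fun_prop) (ae_of_all _ fun y => ?_)
    rw [norm_mul]
    gcongr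
    rw [Real.norm_of_nonneg (by linarith [Real.cos_le_one ⟪ξ, y⟫])]
    linarith [Real.neg_one_le_cos ⟪ξ, y⟫]
  rw [charFun_apply, integral_withDensity_ofReal hH h0]
  have h1 : ∫ y, H y • Complex.exp ((⟪y, ξ⟫ : ℝ) * Complex.I) =
      ∫ y, H y • Complex.exp ((-⟪y, ξ⟫ : ℝ) * Complex.I) := by
    rw [← integral_neg_eq_self]
    simp_rw [hs, inner_neg_left]
  have hint' : Integrable fun y => H y • Complex.exp ((-⟪y, ξ⟫ : ℝ) * Complex.I) := by
    have := hint.comp_neg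
    simpa only [hs, inner_neg_left] using this
  -- Averaging the integral with its reflection removes the sine part.
  have h2 : (2 : ℂ) * ∫ y, H y • Complex.exp ((⟪y, ξ⟫ : ℝ) * Complex.I) =
      2 * (((∫ y, H y) - symExponent H ξ : ℝ) : ℂ) := by
    rw [two_mul]
    nth_rewrite 2 [h1]
    rw [← integral_add hint hint', symExponent, ← integral_sub hi hc, ← integral_complex_ofReal,
      ← integral_const_mul]
    refine integral_congr_ae (ae_of_all _ fun y => ?_)
    simp only [Complex.real_smul]
    rw [Complex.exp_mul_I, Complex.exp_mul_I, real_inner_comm y ξ]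
    push_cast
    rw [Complex.cos_neg, Complex.sin_neg]
    ring
  exact mul_left_cancel₀ two_ne_zero h2

theorem charFun_convExp_withDensity_symm {H : V → ℝ} (hH : Measurable H) (h0 : ∀ y, 0 ≤ H y)
    (hs : ∀ y, H (-y) = H y) (hi : Integrable H) (ξ : V) :
    charFun (convExp (volume.withDensity fun y => ENNReal.ofReal (H y))) ((2 * Real.pi) • ξ) =
      (Real.exp (∫ y, H y) : ℝ) * expSymExponent H ξ := by
  have := isFiniteMeasure_withDensity_of_integrable hi
  rw [charFun_convExp, charFun_withDensity_symm hH h0 hs hi, expSymExponent, ← Complex.ofReal_exp,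
    ← Complex.ofReal_mul, ← Real.exp_add, sub_eq_add_neg]

theorem fourier_gaussian_eq_ofReal {s : ℝ} (hs : 0 < s) (x : V) : ∃ r : ℝ, 0 ≤ r ∧
    𝓕 (fun v : V => Complex.exp (-(s : ℂ) * (‖v‖ : ℂ) ^ 2)) x = r := by
  refine ⟨(Real.pi / s) ^ (Module.finrank ℝ V / 2 : ℝ) * Real.exp (-Real.pi ^ 2 * ‖x‖ ^ 2 / s),
    by positivity, ?_⟩
  rw [fourier_gaussian_innerProductSpace (by simpa using hs)]
  push_cast
  rw [Complex.ofReal_cpow (by positivity)]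
  push_cast
  rfl

theorem norm_gaussian_le {s : ℝ} (hs : 0 ≤ s) (ξ : V) :
    ‖Complex.exp (-(s : ℂ) * (‖ξ‖ : ℂ) ^ 2)‖ ≤ 1 := by
  have h : -(s : ℂ) * (‖ξ‖ : ℂ) ^ 2 = ((-s * ‖ξ‖ ^ 2 : ℝ) : ℂ) := by push_cast; rfl
  rw [h, ← Complex.ofReal_exp, Complex.norm_real, Real.norm_of_nonneg (Real.exp_nonneg _)]
  exact Real.exp_le_one_iff.2 (by nlinarith [sq_nonneg ‖ξ‖])

theorem integrable_gaussian {s : ℝ} (hs : 0 < s) :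
    Integrable fun v : V => Complex.exp (-(s : ℂ) * (‖v‖ : ℂ) ^ 2) := by
  simpa using GaussianFourier.integrable_cexp_neg_mul_sq_norm_add (V := V) (b := (s : ℂ))
    (by simpa using hs) 0 0

theorem norm_expSymExponent_le_one {G : V → ℝ} (h0 : ∀ y, 0 ≤ G y) (ξ : V) :
    ‖expSymExponent G ξ‖ ≤ 1 := by
  rw [expSymExponent, Complex.norm_real, Real.norm_of_nonneg (Real.exp_nonneg _)]
  exact Real.exp_le_one_iff.2 (neg_nonpos.2 (symExponent_nonneg h0 _))

theorem tendsto_fourier_of_dominated {w : ℕ → V → ℂ} {w' : V → ℂ} {B : V → ℝ}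
    (hw : ∀ n, AEStronglyMeasurable (w n) volume) (hB : Integrable B)
    (hwB : ∀ n ξ, ‖w n ξ‖ ≤ B ξ) (h : ∀ ξ, Tendsto (fun n => w n ξ) atTop (𝓝 (w' ξ))) (x : V) :
    Tendsto (fun n => 𝓕 (w n) x) atTop (𝓝 (𝓕 w' x)) := by
  simp only [Real.fourier_eq]
  refine tendsto_integral_of_dominated_convergence B
    (fun n => aestronglyMeasurable_fourierChar_smul (hw n) x) hB
    (fun n => ae_of_all _ fun ξ => ?_) (ae_of_all _ fun ξ => (h ξ).const_smul _)
  rw [Circle.norm_smul]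
  exact hwB n ξ

open scoped ComplexOrder

/-- For integrable `H` this is a positive multiple of the convolution of a positive measure, the
convolution exponential, with a Gaussian density. -/
theorem fourier_expSymExponent_mul_gaussian_nonneg {H : V → ℝ} (hH : Measurable H)
    (h0 : ∀ y, 0 ≤ H y) (hs : ∀ y, H (-y) = H y) (hi : Integrable H) {s : ℝ} (hs0 : 0 < s)
    (x : V) :
    0 ≤ 𝓕 (fun ξ : V => expSymExponent H ξ * Complex.exp (-(s : ℂ) * (‖ξ‖ : ℂ) ^ 2)) x := by
  have := isFiniteMeasure_withDensity_of_integrable hi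
  have h1 : (fun ξ : V => expSymExponent H ξ * Complex.exp (-(s : ℂ) * (‖ξ‖ : ℂ) ^ 2)) =
      ((Real.exp (-∫ y, H y) : ℝ) : ℂ) • fun ξ =>
        charFun (convExp (volume.withDensity fun y => ENNReal.ofReal (H y)))
          ((2 * Real.pi) • ξ) • Complex.exp (-(s : ℂ) * (‖ξ‖ : ℂ) ^ 2) := by
    funext ξ
    rw [Pi.smul_apply, charFun_convExp_withDensity_symm hH h0 hs hi, smul_eq_mul, smul_eq_mul,
      ← mul_assoc, ← mul_assoc, ← Complex.ofReal_mul, ← Real.exp_add]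
    simp
  choose r hr0 hr using fun x : V => fourier_gaussian_eq_ofReal hs0 x
  have h2 : ∀ w : V → ℂ, ∀ z : ℂ, 𝓕 (z • w) x = z • 𝓕 w x := fun w z => by
    simp only [Real.fourier_eq, Pi.smul_apply, smul_comm _ z, integral_smul]
  rw [h1, h2, fourier_charFun_smul _ (integrable_gaussian hs0)]
  simp_rw [hr]
  rw [integral_complex_ofReal, smul_eq_mul, ← Complex.ofReal_mul]
  exact Complex.zero_le_real.2 (mul_nonneg (Real.exp_nonneg _) (integral_nonneg fun y => hr0 _))

theorem integrable_of_pow_two_of_le {G : V → ℝ} (hG : Measurable G) (h0 : ∀ y, 0 ≤ G y)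
    (h2 : Integrable fun y => ‖y‖ ^ 2 * G y) {ε : ℝ} (hε : 0 < ε) :
    Integrable ({y : V | ε ≤ ‖y‖}.indicator G) := by
  have hms : MeasurableSet {y : V | ε ≤ ‖y‖} := measurableSet_le measurable_const measurable_norm
  refine (h2.const_mul ((ε ^ 2)⁻¹)).mono' (hG.indicator hms).aestronglyMeasurable
    (ae_of_all _ fun y => ?_)
  by_cases hy : y ∈ {y : V | ε ≤ ‖y‖}
  · rw [Set.indicator_of_mem hy, Real.norm_of_nonneg (h0 y), ← mul_assoc, ← div_eq_inv_mul]
    refine le_mul_of_one_le_left (h0 y) ((one_le_div (by positivity)).2 ?_)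
    exact pow_le_pow_left₀ hε.le hy 2
  · rw [Set.indicator_of_notMem hy, norm_zero]
    have := h0 y
    positivity

theorem tendsto_symExponent_indicator {G : V → ℝ} (hG : Measurable G) (h0 : ∀ y, 0 ≤ G y)
    (h2 : Integrable fun y => ‖y‖ ^ 2 * G y) (ξ : V) :
    Tendsto (fun n : ℕ => symExponent ({y : V | 1 / ((n : ℝ) + 1) ≤ ‖y‖}.indicator G) ξ) atTop
      (𝓝 (symExponent G ξ)) := by
  have hms : ∀ n : ℕ, MeasurableSet {y : V | 1 / ((n : ℝ) + 1) ≤ ‖y‖} := fun n =>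
    measurableSet_le measurable_const measurable_norm
  refine tendsto_integral_of_dominated_convergence (fun y => (1 - Real.cos ⟪ξ, y⟫) * G y)
    (fun n => ?_) (integrable_one_sub_cos_mul hG h2 ξ) (fun n => ae_of_all _ fun y => ?_)
    (ae_of_all _ fun y => ?_)
  · have := hG.indicator (hms n)
    exact Measurable.aestronglyMeasurable (by fun_prop)
  · have hcos : 0 ≤ 1 - Real.cos ⟪ξ, y⟫ := by linarith [Real.cos_le_one ⟪ξ, y⟫]
    rw [Real.norm_of_nonneg (mul_nonneg hcos (Set.indicator_nonneg (fun y _ => h0 y) y))]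
    exact mul_le_mul_of_nonneg_left (Set.indicator_le_self' (fun y _ => h0 y) y) hcos
  · by_cases hy : y = 0
    · simp [hy]
    · refine tendsto_const_nhds.congr' ?_
      have h3 := (tendsto_one_div_add_atTop_nhds_zero_nat (𝕜 := ℝ)).eventually
        (gt_mem_nhds (norm_pos_iff.2 hy))
      filter_upwards [h3] with n hn
      rw [Set.indicator_of_mem (show y ∈ {y : V | 1 / ((n : ℝ) + 1) ≤ ‖y‖} from le_of_lt hn)]

theorem measurable_expSymExponent {G : V → ℝ} (hG : Measurable G) :
    Measurable (expSymExponent G) := by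
  have h : StronglyMeasurable fun ξ : V => symExponent G ξ :=
    StronglyMeasurable.integral_prod_right' (f := fun p : V × V =>
      (1 - Real.cos ⟪p.1, p.2⟫) * G p.2) (Measurable.stronglyMeasurable (by fun_prop))
  have h' := h.measurable
  unfold expSymExponent
  fun_prop

/-- Two limits. With a fixed Gaussian factor as dominating function, the jumps of size below
`1/(n+1)` are restored; then the Gaussian factor tends to `1`, dominated by `expSymExponent G`
itself. -/
theorem fourier_expSymExponent_nonneg {G : V → ℝ} (hG : Measurable G) (h0 : ∀ y, 0 ≤ G y)
    (hs : ∀ y, G (-y) = G y) (h2 : Integrable fun y => ‖y‖ ^ 2 * G y)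
    (hi : Integrable (expSymExponent G)) (x : V) : 0 ≤ 𝓕 (expSymExponent G) x := by
  have hgm : ∀ s : ℝ, Measurable fun ξ : V => Complex.exp (-(s : ℂ) * (‖ξ‖ : ℂ) ^ 2) :=
    fun s => by fun_prop
  have hstep : ∀ s : ℝ, 0 < s →
      0 ≤ 𝓕 (fun ξ : V => expSymExponent G ξ * Complex.exp (-(s : ℂ) * (‖ξ‖ : ℂ) ^ 2)) x := by
    intro s hs0
    have hind0 : ∀ (n : ℕ) (y : V), 0 ≤ {y : V | 1 / ((n : ℝ) + 1) ≤ ‖y‖}.indicator G y :=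
      fun n y => Set.indicator_nonneg (fun y _ => h0 y) y
    have hindm : ∀ n : ℕ, Measurable ({y : V | 1 / ((n : ℝ) + 1) ≤ ‖y‖}.indicator G) :=
      fun n => hG.indicator (measurableSet_le measurable_const measurable_norm)
    refine ge_of_tendsto' (tendsto_fourier_of_dominated
      (w := fun (n : ℕ) ξ => expSymExponent ({y : V | 1 / ((n : ℝ) + 1) ≤ ‖y‖}.indicator G) ξ *
        Complex.exp (-(s : ℂ) * (‖ξ‖ : ℂ) ^ 2))
      (fun n => ((measurable_expSymExponent (hindm n)).mul (hgm s)).aestronglyMeasurable)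
      (integrable_gaussian hs0).norm (fun n ξ => ?_) (fun ξ => ?_) x) fun n => ?_
    · rw [norm_mul]
      exact mul_le_of_le_one_left (norm_nonneg _) (norm_expSymExponent_le_one (hind0 n) ξ)
    · refine Tendsto.mul_const _ ?_
      exact ((Complex.continuous_ofReal.comp Real.continuous_exp).tendsto _).comp
        (tendsto_symExponent_indicator hG h0 h2 _).neg
    · refine fourier_expSymExponent_mul_gaussian_nonneg (hindm n) (hind0 n) (fun y => ?_)
        (integrable_of_pow_two_of_le hG h0 h2 (by positivity)) hs0 x
      simp [Set.indicator, hs]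
  refine ge_of_tendsto' (tendsto_fourier_of_dominated
    (w := fun (n : ℕ) ξ => expSymExponent G ξ *
      Complex.exp (-((1 / ((n : ℝ) + 1) : ℝ) : ℂ) * (‖ξ‖ : ℂ) ^ 2))
    (fun n => ((measurable_expSymExponent hG).mul (hgm _)).aestronglyMeasurable)
    hi.norm (fun n ξ => ?_) (fun ξ => ?_) x) fun n => hstep _ (by positivity)
  · rw [norm_mul]
    exact mul_le_of_le_one_right (norm_nonneg _) (norm_gaussian_le (by positivity) ξ)
  · have hc : Continuous fun s : ℝ => expSymExponent G ξ *
        Complex.exp (-(s : ℂ) * (‖ξ‖ : ℂ) ^ 2) := by fun_prop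
    have := (hc.tendsto 0).comp (tendsto_one_div_add_atTop_nhds_zero_nat (𝕜 := ℝ))
    simpa [Function.comp_def] using this

end Positivity

/-! ### Factoring off an integrable part of the jump density -/

section UnitTime

variable {V : Type*} [NormedAddCommGroup V] [InnerProductSpace ℝ V] [FiniteDimensional ℝ V]
  [MeasurableSpace V] [BorelSpace V]

open scoped ComplexOrder

theorem symExponent_add {G H : V → ℝ} (hG : Measurable G) (hH : Measurable H)
    (hG2 : Integrable fun y => ‖y‖ ^ 2 * G y) (hH0 : ∀ y, 0 ≤ H y) (hHi : Integrable H) (ξ : V) :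
    symExponent (fun y => G y + H y) ξ = symExponent G ξ + symExponent H ξ := by
  have hc : Integrable fun y => (1 - Real.cos ⟪ξ, y⟫) * H y := by
    refine (hHi.const_mul 2).mono' (by fun_prop) (ae_of_all _ fun y => ?_)
    rw [Real.norm_of_nonneg (mul_nonneg (by linarith [Real.cos_le_one ⟪ξ, y⟫]) (hH0 y))]
    exact mul_le_mul_of_nonneg_right (by linarith [Real.neg_one_le_cos ⟪ξ, y⟫]) (hH0 y)
  unfold symExponent
  rw [← integral_add (integrable_one_sub_cos_mul hG hG2 ξ) hc]
  simp_rw [mul_add]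

/-- Exponents add. The factor `exp (-∫ H)` normalises the convolution exponential to a compound
Poisson law. -/
theorem expSymExponent_add {G H : V → ℝ} (hG : Measurable G) (hH : Measurable H)
    (hG2 : Integrable fun y => ‖y‖ ^ 2 * G y) (hH0 : ∀ y, 0 ≤ H y) (hHs : ∀ y, H (-y) = H y)
    (hHi : Integrable H) :
    expSymExponent (fun y => G y + H y) = fun ξ => (Real.exp (-∫ y, H y) : ℂ) •
      charFun (convExp (volume.withDensity fun y => ENNReal.ofReal (H y))) ((2 * Real.pi) • ξ) •
        expSymExponent G ξ := by
  funext ξ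
  rw [charFun_convExp_withDensity_symm hH hH0 hHs hHi, expSymExponent,
    symExponent_add hG hH hG2 hH0 hHi, expSymExponent, expSymExponent]
  rw [smul_eq_mul, smul_eq_mul, neg_add, Real.exp_add, Real.exp_neg (∫ y, H y)]
  push_cast
  rw [← mul_assoc, ← mul_assoc, inv_mul_cancel₀ (Complex.exp_ne_zero _), one_mul, mul_comm]

/-- Every derivative of the density is the mixture of translates of the derivative of the density
of the singular part. -/
theorem iteratedFDeriv_fourier_expSymExponent_add {G H : V → ℝ} (hG : Measurable G)
    (hH : Measurable H) (hG2 : Integrable fun y => ‖y‖ ^ 2 * G y) (hH0 : ∀ y, 0 ≤ H y)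
    (hHs : ∀ y, H (-y) = H y) (hHi : Integrable H)
    (hint : ∀ k : ℕ, Integrable fun ξ => ‖ξ‖ ^ k * ‖expSymExponent G ξ‖) (k : ℕ) (x : V) :
    iteratedFDeriv ℝ k (𝓕 (expSymExponent fun y => G y + H y)) x =
      (Real.exp (-∫ y, H y) : ℂ) •
        ∫ y, iteratedFDeriv ℝ k (𝓕 (expSymExponent G)) (x - y)
          ∂(convExp (volume.withDensity fun y => ENNReal.ofReal (H y))) := by
  have hfin := isFiniteMeasure_withDensity_of_integrable hHi
  set π := convExp (volume.withDensity fun y => ENNReal.ofReal (H y)) with hπ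
  have hmG := (measurable_expSymExponent hG).aestronglyMeasurable (μ := volume)
  have hmGH := (measurable_expSymExponent (hG.add hH)).aestronglyMeasurable (μ := volume)
  have hint' : ∀ k : ℕ, Integrable fun ξ =>
      ‖ξ‖ ^ k * ‖expSymExponent (fun y => G y + H y) ξ‖ := by
    intro k
    -- Adding `H ≥ 0` increases the exponent, so integrability is inherited from `G`.
    refine (hint k).mono' ((continuous_norm.pow k).aestronglyMeasurable.mul hmGH.norm)
      (ae_of_all _ fun ξ => ?_)
    rw [Real.norm_of_nonneg (by positivity)]
    gcongr
    rw [expSymExponent, expSymExponent, Complex.norm_real, Complex.norm_real,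
      Real.norm_of_nonneg (Real.exp_nonneg _), Real.norm_of_nonneg (Real.exp_nonneg _),
      symExponent_add hG hH hG2 hH0 hHi, Real.exp_le_exp]
    linarith [symExponent_nonneg hH0 ((2 * Real.pi) • ξ)]
  rw [Real.iteratedFDeriv_fourier (N := ⊤) (fun k _ => hint' k) hmGH le_top,
    Real.iteratedFDeriv_fourier (N := ⊤) (fun k _ => hint k) hmG le_top]
  have hw : Integrable fun ξ =>
      VectorFourier.fourierPowSMulRight (innerSL ℝ) (expSymExponent G) ξ k :=
    VectorFourier.integrable_fourierPowSMulRight _ (hint k) hmG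
  rw [← fourier_charFun_smul π hw]
  have h1 : (fun ξ => VectorFourier.fourierPowSMulRight (innerSL ℝ)
      (expSymExponent fun y => G y + H y) ξ k) = fun ξ => (Real.exp (-∫ y, H y) : ℂ) •
      (fun ξ => charFun π ((2 * Real.pi) • ξ) •
        VectorFourier.fourierPowSMulRight (innerSL ℝ) (expSymExponent G) ξ k) ξ := by
    funext ξ
    ext m
    simp only [VectorFourier.fourierPowSMulRight_apply, smul_apply]
    rw [expSymExponent_add hG hH hG2 hH0 hHs hHi]
    simp only [smul_eq_mul, Complex.real_smul]
    ring
  rw [h1]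
  simp only [Real.fourier_eq, smul_comm _ (Real.exp (-∫ y, H y) : ℂ), integral_smul]

end UnitTime

/-! ### Truncated profiles under convolution with the large jumps -/

section ProfileConv

variable {V : Type*} [NormedAddCommGroup V] [InnerProductSpace ℝ V] [FiniteDimensional ℝ V]
  [MeasurableSpace V] [BorelSpace V] {a b c : ℝ} {F : ℝ → ℝ} {g : V → ℝ}

/-- A bound for the integral of a truncated profile. -/
noncomputable def profileMass (V : Type*) [NormedAddCommGroup V] [InnerProductSpace ℝ V]
    [MeasurableSpace V] [BorelSpace V] [FiniteDimensional ℝ V] (a : ℝ) : ℝ :=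
  ∫ y : V, 2 ^ ((Module.finrank ℝ V : ℝ) + a) * (1 + ‖y‖) ^ (-((Module.finrank ℝ V : ℝ) + a))

theorem profileMass_nonneg : 0 ≤ profileMass V a := integral_nonneg fun y => by positivity

theorem IsScalingProfile.integrable_trunc (hF : IsScalingProfile (Module.finrank ℝ V) a b F)
    (ha : 0 < a) : Integrable fun y : V => truncProfile F ‖y‖ := by
  have h := (integrable_one_add_norm (E := V) (μ := volume)
    (r := (Module.finrank ℝ V : ℝ) + a) (by linarith)).const_mul
      (2 ^ ((Module.finrank ℝ V : ℝ) + a))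
  refine h.mono' ((hF.trunc_measurable ha).comp measurable_norm).aestronglyMeasurable
    (ae_of_all _ fun y => ?_)
  rw [Real.norm_of_nonneg (hF.trunc_pos _).le]
  exact hF.trunc_le_rpow ha (norm_nonneg y)

theorem IsScalingProfile.integral_trunc_le (hF : IsScalingProfile (Module.finrank ℝ V) a b F)
    (ha : 0 < a) : ∫ y : V, truncProfile F ‖y‖ ≤ profileMass V a :=
  integral_mono (hF.integrable_trunc ha)
    ((integrable_one_add_norm (by linarith)).const_mul _)
    fun y => hF.trunc_le_rpow ha (norm_nonneg y)

theorem IsScalingProfile.lintegral_trunc_le (hF : IsScalingProfile (Module.finrank ℝ V) a b F)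
    (ha : 0 < a) :
    ∫⁻ y : V, ENNReal.ofReal (truncProfile F ‖y‖) ≤ ENNReal.ofReal (profileMass V a) := by
  rw [← ofReal_integral_eq_lintegral_ofReal (hF.integrable_trunc ha)
    (ae_of_all _ fun y => (hF.trunc_pos _).le)]
  exact ENNReal.ofReal_le_ofReal (hF.integral_trunc_le ha)

/-- One of `x - y` and `y` has norm at least `‖x‖ / 2`; by doubling its factor is bounded by the
profile at `x`, and the other factor remains to be integrated. -/
theorem IsScalingProfile.trunc_mul_trunc_le {n : ℕ} (hF : IsScalingProfile n a b F)
    (ha : 0 < a) (x y : V) : truncProfile F ‖x - y‖ * truncProfile F ‖y‖ ≤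
      2 ^ ((n : ℝ) + b) * truncProfile F ‖x‖ *
        (truncProfile F ‖x - y‖ + truncProfile F ‖y‖) := by
  have h0 := hF.trunc_pos ‖x - y‖
  have h1 := hF.trunc_pos ‖y‖
  have h2 := hF.trunc_pos ‖x‖
  have hx : ‖x‖ ≤ ‖x - y‖ + ‖y‖ := by simpa using norm_add_le (x - y) y
  have hp : (0 : ℝ) < 2 ^ ((n : ℝ) + b) := by positivity
  rcases le_total ‖x - y‖ ‖y‖ with h | h
  · have h3 := hF.trunc_le_two_rpow_mul ha (r := ‖y‖) (s := ‖x‖)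
      (by linarith [le_max_right 1 ‖y‖])
    nlinarith [mul_le_mul_of_nonneg_left h3 h0.le, mul_pos (mul_pos hp h2) h1]
  · have h3 := hF.trunc_le_two_rpow_mul ha (r := ‖x - y‖) (s := ‖x‖)
      (by linarith [le_max_right 1 ‖x - y‖])
    nlinarith [mul_le_mul_of_nonneg_right h3 h1.le, mul_pos (mul_pos hp h2) h0]

namespace IsJumpDensity

theorem integrable_boundedPart (hg : IsJumpDensity c F g)
    (hF : IsScalingProfile (Module.finrank ℝ V) a b F) (ha : 0 < a) (hc : 1 ≤ c) :
    Integrable (boundedPart g) := by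
  refine ((hF.integrable_trunc (V := V) ha).const_mul c).mono'
    hg.boundedPart_measurable.aestronglyMeasurable (ae_of_all _ fun y => ?_)
  rw [Real.norm_of_nonneg (hg.boundedPart_nonneg y)]
  exact hg.boundedPart_le hF ha hc y

theorem integral_boundedPart_le (hg : IsJumpDensity c F g)
    (hF : IsScalingProfile (Module.finrank ℝ V) a b F) (ha : 0 < a) (hc : 1 ≤ c) :
    ∫ y, boundedPart g y ≤ c * profileMass V a := by
  calc _ ≤ ∫ y : V, c * truncProfile F ‖y‖ :=
        integral_mono (hg.integrable_boundedPart hF ha hc)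
          ((hF.integrable_trunc ha).const_mul c) (hg.boundedPart_le hF ha hc)
    _ ≤ _ := by
        rw [integral_const_mul]
        exact mul_le_mul_of_nonneg_left (hF.integral_trunc_le ha) (by linarith)

/-- The law of the large jumps preserves truncated profiles up to a constant. -/
theorem lintegral_trunc_sub_le (hg : IsJumpDensity c F g)
    (hF : IsScalingProfile (Module.finrank ℝ V) a b F) (ha : 0 < a) (hc : 1 ≤ c) (x : V) :
    ∫⁻ y, ENNReal.ofReal (truncProfile F ‖x - y‖)
      ∂(volume.withDensity fun y => ENNReal.ofReal (boundedPart g y)) ≤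
      ENNReal.ofReal (c * 2 ^ ((Module.finrank ℝ V : ℝ) + b) *
        (profileMass V a + profileMass V a)) * ENNReal.ofReal (truncProfile F ‖x‖) := by
  have hm : Measurable fun y : V => ENNReal.ofReal (truncProfile F ‖y‖) :=
    ((hF.trunc_measurable ha).comp measurable_norm).ennreal_ofReal
  have hm' : Measurable fun y : V => ENNReal.ofReal (truncProfile F ‖x - y‖) :=
    hm.comp (by fun_prop : Measurable fun y => x - y)
  have hP := profileMass_nonneg (V := V) (a := a)
  rw [lintegral_withDensity_eq_lintegral_mul _ hg.boundedPart_measurable.ennreal_ofReal hm']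
  set K := c * 2 ^ ((Module.finrank ℝ V : ℝ) + b) * truncProfile F ‖x‖ with hK
  have hK0 : 0 ≤ K := mul_nonneg (by positivity) (hF.trunc_pos _).le
  calc _ ≤ ∫⁻ y, ENNReal.ofReal K * (ENNReal.ofReal (truncProfile F ‖x - y‖) +
          ENNReal.ofReal (truncProfile F ‖y‖)) := by
        refine lintegral_mono fun y => ?_
        rw [Pi.mul_apply, ← ENNReal.ofReal_mul (hg.boundedPart_nonneg y),
          ← ENNReal.ofReal_add (hF.trunc_pos _).le (hF.trunc_pos _).le,
          ← ENNReal.ofReal_mul hK0]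
        refine ENNReal.ofReal_le_ofReal ?_
        have h1 := hg.boundedPart_le hF ha hc y
        have h2 := hF.trunc_mul_trunc_le ha x y
        calc _ ≤ c * truncProfile F ‖y‖ * truncProfile F ‖x - y‖ :=
              mul_le_mul_of_nonneg_right h1 (hF.trunc_pos _).le
          _ = c * (truncProfile F ‖x - y‖ * truncProfile F ‖y‖) := by ring
          _ ≤ c * _ := mul_le_mul_of_nonneg_left h2 (by linarith)
          _ = _ := by rw [hK]; ring
    _ = ENNReal.ofReal K * ((∫⁻ y : V, ENNReal.ofReal (truncProfile F ‖y‖)) +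
          ∫⁻ y : V, ENNReal.ofReal (truncProfile F ‖y‖)) := by
        rw [lintegral_const_mul _ (by fun_prop), lintegral_add_left hm',
          lintegral_sub_left_eq_self (fun y : V => ENNReal.ofReal (truncProfile F ‖y‖)) x]
    _ ≤ ENNReal.ofReal K * (ENNReal.ofReal (profileMass V a) +
          ENNReal.ofReal (profileMass V a)) := by
        gcongr <;> exact hF.lintegral_trunc_le ha
    _ = _ := by
        rw [← ENNReal.ofReal_add hP hP, ← ENNReal.ofReal_mul hK0, ← ENNReal.ofReal_mul
          (by positivity), hK]
        congr 1; ring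

theorem lintegral_trunc_sub_convExp_le (hg : IsJumpDensity c F g)
    (hF : IsScalingProfile (Module.finrank ℝ V) a b F) (ha : 0 < a) (hc : 1 ≤ c) (x : V) :
    ∫⁻ y, ENNReal.ofReal (truncProfile F ‖x - y‖)
      ∂(convExp (volume.withDensity fun y => ENNReal.ofReal (boundedPart g y))) ≤
      ENNReal.ofReal (Real.exp (c * 2 ^ ((Module.finrank ℝ V : ℝ) + b) *
        (profileMass V a + profileMass V a)) * truncProfile F ‖x‖) := by
  have := isFiniteMeasure_withDensity_of_integrable (hg.integrable_boundedPart hF ha hc)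
  have hP := profileMass_nonneg (V := V) (a := a)
  rw [ENNReal.ofReal_mul (Real.exp_nonneg _)]
  exact lintegral_convExp_le _ (u := fun z => ENNReal.ofReal (truncProfile F ‖z‖))
    ((hF.trunc_measurable ha).comp measurable_norm).ennreal_ofReal
    (by positivity) (hg.lintegral_trunc_sub_le hF ha hc) x

end IsJumpDensity

end ProfileConv

/-! ### Uniform bounds for the density of the singular part -/

section UniformBounds

variable {V : Type*} [NormedAddCommGroup V] [InnerProductSpace ℝ V] [FiniteDimensional ℝ V]
  [MeasurableSpace V] [BorelSpace V]

open scoped ComplexOrder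

/-- Lower bound at the origin for the density of the singular part. -/
noncomputable def originConst (V : Type*) [NormedAddCommGroup V] [InnerProductSpace ℝ V]
    [MeasurableSpace V] [BorelSpace V] [FiniteDimensional ℝ V] (m : ℝ) : ℝ :=
  Real.exp (-((2 * Real.pi) ^ 2 * m)) * (volume : Measure V).real (Metric.ball 0 1)

theorem originConst_pos (m : ℝ) : 0 < originConst V m := by
  have : 0 < (volume : Measure V).real (Metric.ball 0 1) :=
    ENNReal.toReal_pos (Metric.measure_ball_pos _ _ one_pos).ne' measure_ball_lt_top.ne
  unfold originConst
  positivity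

namespace IsRegularJumpDensity

variable {a c C : ℝ} {M : ℕ → ℝ} {G : V → ℝ}

theorem integrable_pow_mul_expSymExponent (hG : IsRegularJumpDensity a c C M G) (ha : 0 < a)
    (hc : 0 < c) (k : ℕ) : Integrable fun ξ => ‖ξ‖ ^ k * ‖expSymExponent G ξ‖ := by
  simpa using hG.integrable_pow_mul_iteratedFDeriv ha hc k 0

theorem integrable_expSymExponent (hG : IsRegularJumpDensity a c C M G) (ha : 0 < a)
    (hc : 0 < c) : Integrable (expSymExponent G) := by
  have h := hG.integrable_pow_mul_expSymExponent ha hc 0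
  simp only [pow_zero, one_mul] at h
  exact (integrable_norm_iff (measurable_expSymExponent hG.measurable).aestronglyMeasurable).1 h

theorem contDiff_fourier (hG : IsRegularJumpDensity a c C M G) (ha : 0 < a)
    (hc : 0 < c) : ContDiff ℝ (⊤ : ℕ∞) (𝓕 (expSymExponent G)) :=
  Real.contDiff_fourier fun k _ => hG.integrable_pow_mul_expSymExponent ha hc k

/-- The value at `0` is the integral of `exp (-Φ)`; on the unit ball the second moment bounds the
exponent. -/
theorem originConst_le (hG : IsRegularJumpDensity a c C M G) (ha : 0 < a) (hc : 0 < c) :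
    originConst V (M 2) ≤ (𝓕 (expSymExponent G) 0).re := by
  have hint := hG.integrable_expSymExponent ha hc
  have h1 : (𝓕 (expSymExponent G) 0).re =
      ∫ ξ, Real.exp (-symExponent G ((2 * Real.pi) • ξ)) := by
    rw [Real.fourier_eq]
    simp only [inner_zero_right, neg_zero, AddChar.map_zero_eq_one, one_smul]
    unfold expSymExponent
    rw [integral_complex_ofReal, Complex.ofReal_re]
  have hint' : Integrable fun ξ => Real.exp (-symExponent G ((2 * Real.pi) • ξ)) := hint.re
  rw [h1]
  calc originConst V (M 2) = ∫ _ in Metric.ball (0 : V) 1,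
        Real.exp (-((2 * Real.pi) ^ 2 * M 2)) := by
        rw [setIntegral_const, originConst, smul_eq_mul, mul_comm]
    _ ≤ ∫ ξ in Metric.ball (0 : V) 1, Real.exp (-symExponent G ((2 * Real.pi) • ξ)) := by
        refine setIntegral_mono_on (integrableOn_const (measure_ball_lt_top.ne))
          hint'.integrableOn measurableSet_ball fun ξ hξ => ?_
        rw [mem_ball_zero_iff] at hξ
        rw [Real.exp_le_exp, neg_le_neg_iff]
        refine (symExponent_le hG.measurable hG.nonneg (hG.integrable 2 le_rfl) _).trans ?_
        have h2 := hG.moment_le 2 le_rfl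
        have h0 : 0 ≤ ∫ y, ‖y‖ ^ 2 * G y :=
          integral_nonneg fun y => mul_nonneg (by positivity) (hG.nonneg y)
        refine mul_le_mul ?_ h2 h0 (by positivity)
        rw [norm_smul, Real.norm_of_nonneg (by positivity), mul_pow]
        exact mul_le_of_le_one_right (by positivity) (pow_le_one₀ (norm_nonneg _) hξ.le)
    _ ≤ _ := setIntegral_le_integral hint' (ae_of_all _ fun ξ => Real.exp_nonneg _)

/-- Mean value inequality: within this radius at most half of the value at the origin is lost. -/
theorem le_re_fourier_of_norm_le (hG : IsRegularJumpDensity a c C M G) (ha : 0 < a) (hc : 0 < c)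
    {B : ℝ} (hB0 : 0 < B) (hB : ∀ x, ‖iteratedFDeriv ℝ 1 (𝓕 (expSymExponent G)) x‖ ≤ B) {x : V}
    (hx : ‖x‖ ≤ originConst V (M 2) / (2 * B)) :
    originConst V (M 2) / 2 ≤ (𝓕 (expSymExponent G) x).re := by
  have hd : Differentiable ℝ (𝓕 (expSymExponent G)) :=
    (hG.contDiff_fourier ha hc).differentiable (by simp)
  have h1 : ‖𝓕 (expSymExponent G) x - 𝓕 (expSymExponent G) 0‖ ≤ B * ‖x - 0‖ :=
    convex_univ.norm_image_sub_le_of_norm_fderiv_le (fun y _ => hd y)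
      (fun y _ => by
        have := hB y
        rwa [← norm_iteratedFDeriv_fderiv, norm_iteratedFDeriv_zero] at this)
      (Set.mem_univ 0) (Set.mem_univ x)
  rw [sub_zero] at h1
  have h2 := Complex.abs_re_le_norm (𝓕 (expSymExponent G) x - 𝓕 (expSymExponent G) 0)
  rw [Complex.sub_re] at h2
  have h3 := neg_abs_le ((𝓕 (expSymExponent G) x).re - (𝓕 (expSymExponent G) 0).re)
  have h4 := hG.originConst_le ha hc
  have h5 : B * ‖x‖ ≤ originConst V (M 2) / 2 := by
    rw [le_div_iff₀ (by positivity)] at hx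
    linarith
  linarith

end IsRegularJumpDensity

/-- Pointwise decay of the density of regular jump densities with respect to scaling profiles. -/
theorem exists_iteratedFDeriv_fourier_le_trunc {a c : ℝ} (C : ℝ) (M : ℕ → ℝ) (ha : 0 < a)
    (hc : 0 < c) (b : ℝ) (k : ℕ) : ∃ B : ℝ, 0 < B ∧ ∀ (G : V → ℝ) (F : ℝ → ℝ) (a' : ℝ),
      IsRegularJumpDensity a c C M G → IsScalingProfile (Module.finrank ℝ V) a' b F →
      ∀ x, ‖iteratedFDeriv ℝ k (𝓕 (expSymExponent G)) x‖ ≤ B * truncProfile F ‖x‖ := by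
  -- Decay of order `m` beats every admissible profile at infinity, and decay of order `0` handles
  -- the unit ball.
  obtain ⟨m, hm⟩ := exists_nat_ge ((Module.finrank ℝ V : ℝ) + b)
  obtain ⟨B₀, hB₀, h₀⟩ := exists_pow_mul_iteratedFDeriv_fourier_le (V := V) C M ha hc k 0
  obtain ⟨B₁, hB₁, h₁⟩ := exists_pow_mul_iteratedFDeriv_fourier_le (V := V) C M ha hc k m
  refine ⟨B₀ + B₁, by positivity, fun G F a' hG hF x => ?_⟩
  refine hF.le_trunc hm (by positivity) (norm_nonneg x) ?_ ?_
  · have := h₀ G hG x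
    rw [pow_zero, one_mul] at this
    linarith
  · have := h₁ G hG x
    linarith

/-- Fourier inversion; nonnegativity in the complex order makes `𝓕 w` real, so taking the real part
loses nothing. -/
theorem charFun_withDensity_re_fourier {w : V → ℂ} (hw : Continuous w) (hwi : Integrable w)
    (hwi' : Integrable (𝓕 w)) (h0 : ∀ x, 0 ≤ 𝓕 w x) (ξ : V) :
    charFun (volume.withDensity fun x => ENNReal.ofReal (𝓕 w x).re) ((2 * Real.pi) • ξ) = w ξ := by
  have hc : Continuous (𝓕 w) :=
    VectorFourier.fourierIntegral_continuous Real.continuous_fourierChar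
      (by exact continuous_inner) hwi
  rw [charFun_apply, integral_withDensity_ofReal (H := fun x => (𝓕 w x).re)
    (Complex.measurable_re.comp hc.measurable)
    (fun x => (Complex.le_def.1 (h0 x)).1)]
  have h1 := congrFun (hw.fourierInv_fourier_eq hwi hwi') ξ
  rw [← h1, Real.fourierInv_eq']
  refine integral_congr_ae (ae_of_all _ fun x => ?_)
  have h2 : ((𝓕 w x).re : ℂ) = 𝓕 w x :=
    Complex.ext rfl (by simpa using (Complex.le_def.1 (h0 x)).2)
  beta_reduce
  rw [← Complex.coe_smul, h2, inner_smul_right, smul_eq_mul, smul_eq_mul, mul_comm]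

end UniformBounds

/-! ### Two-sided bounds at time one -/

section Main

variable {V : Type*} [NormedAddCommGroup V] [InnerProductSpace ℝ V] [FiniteDimensional ℝ V]
  [MeasurableSpace V] [BorelSpace V] [Nontrivial V]

open scoped ComplexOrder

namespace IsJumpDensity

variable {a b c : ℝ} {F : ℝ → ℝ} {g : V → ℝ}

theorem singularPart_add_boundedPart (g : V → ℝ) :
    (fun y => singularPart g y + boundedPart g y) = g :=
  funext fun _ => sub_add_cancel _ _

variable (hg : IsJumpDensity c F g) (hF : IsScalingProfile (Module.finrank ℝ V) a b F)
  (ha : 0 < a) (hb : b < 2) (hc : 1 ≤ c)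

include hg hF ha hb hc

theorem iteratedFDeriv_fourier_expSymExponent (k : ℕ) (x : V) :
    iteratedFDeriv ℝ k (𝓕 (expSymExponent g)) x = (Real.exp (-∫ y, boundedPart g y) : ℂ) •
      ∫ y, iteratedFDeriv ℝ k (𝓕 (expSymExponent (singularPart g))) (x - y)
        ∂(convExp (volume.withDensity fun y => ENNReal.ofReal (boundedPart g y))) := by
  have hG := hg.isRegularJumpDensity_singularPart hF ha hb hc
  have := iteratedFDeriv_fourier_expSymExponent_add hg.singularPart_measurable
    hg.boundedPart_measurable (hG.integrable 2 le_rfl) hg.boundedPart_nonneg hg.boundedPart_neg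
    (hg.integrable_boundedPart hF ha hc)
    (hG.integrable_pow_mul_expSymExponent ha (exponentConst_pos hc)) k x
  rwa [singularPart_add_boundedPart] at this

theorem fourier_expSymExponent (x : V) :
    𝓕 (expSymExponent g) x = (Real.exp (-∫ y, boundedPart g y) : ℂ) •
      ∫ y, 𝓕 (expSymExponent (singularPart g)) (x - y)
        ∂(convExp (volume.withDensity fun y => ENNReal.ofReal (boundedPart g y))) := by
  have hG := hg.isRegularJumpDensity_singularPart hF ha hb hc
  have hfin := isFiniteMeasure_withDensity_of_integrable (hg.integrable_boundedPart hF ha hc)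
  have h := expSymExponent_add hg.singularPart_measurable
    hg.boundedPart_measurable (hG.integrable 2 le_rfl) hg.boundedPart_nonneg hg.boundedPart_neg
    (hg.integrable_boundedPart hF ha hc)
  rw [singularPart_add_boundedPart] at h
  rw [← fourier_charFun_smul _ (hG.integrable_expSymExponent ha (exponentConst_pos hc)), h]
  simp only [Real.fourier_eq, smul_comm _ (Real.exp (-∫ y, boundedPart g y) : ℂ), integral_smul]

theorem integrable_pow_mul_expSymExponent (k : ℕ) :
    Integrable fun ξ => ‖ξ‖ ^ k * ‖expSymExponent g ξ‖ := by
  have hG := hg.isRegularJumpDensity_singularPart hF ha hb hc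
  refine (hG.integrable_pow_mul_expSymExponent ha (exponentConst_pos hc) k).mono'
    ((continuous_norm.pow k).aestronglyMeasurable.mul
      (measurable_expSymExponent hg.measurable).aestronglyMeasurable.norm)
    (ae_of_all _ fun ξ => ?_)
  rw [Real.norm_of_nonneg (by positivity)]
  gcongr
  have h := symExponent_add hg.singularPart_measurable
    hg.boundedPart_measurable (hG.integrable 2 le_rfl) hg.boundedPart_nonneg
    (hg.integrable_boundedPart hF ha hc) ((2 * Real.pi) • ξ)
  rw [singularPart_add_boundedPart] at h
  rw [expSymExponent, expSymExponent, Complex.norm_real, Complex.norm_real,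
    Real.norm_of_nonneg (Real.exp_nonneg _), Real.norm_of_nonneg (Real.exp_nonneg _),
    h, Real.exp_le_exp]
  linarith [symExponent_nonneg hg.boundedPart_nonneg ((2 * Real.pi) • ξ)]

theorem fourier_singularPart_nonneg (x : V) :
    0 ≤ 𝓕 (expSymExponent (singularPart g)) x := by
  have hG := hg.isRegularJumpDensity_singularPart hF ha hb hc
  exact fourier_expSymExponent_nonneg hG.measurable hG.nonneg hg.singularPart_neg
    (hG.integrable 2 le_rfl) (hG.integrable_expSymExponent ha (exponentConst_pos hc)) x

theorem ofReal_re_fourier_singularPart (x : V) :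
    ((𝓕 (expSymExponent (singularPart g)) x).re : ℂ) =
      𝓕 (expSymExponent (singularPart g)) x :=
  Complex.ext rfl (by
    simpa using (Complex.le_def.1 (hg.fourier_singularPart_nonneg hF ha hb hc x)).2)

theorem fourier_expSymExponent_eq_ofReal (x : V) :
    𝓕 (expSymExponent g) x = ((Real.exp (-∫ y, boundedPart g y) *
      ∫ y, (𝓕 (expSymExponent (singularPart g)) (x - y)).re
        ∂(convExp (volume.withDensity fun y => ENNReal.ofReal (boundedPart g y))) : ℝ) : ℂ) := by
  rw [hg.fourier_expSymExponent hF ha hb hc, integral_congr_ae (ae_of_all _ fun y =>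
    (hg.ofReal_re_fourier_singularPart hF ha hb hc (x - y)).symm), integral_complex_ofReal, smul_eq_mul, ← Complex.ofReal_mul]

theorem fourier_nonneg (x : V) : 0 ≤ 𝓕 (expSymExponent g) x := by
  rw [hg.fourier_expSymExponent_eq_ofReal hF ha hb hc]
  exact Complex.zero_le_real.2 (mul_nonneg (Real.exp_nonneg _) (integral_nonneg fun y =>
    (Complex.le_def.1 (hg.fourier_singularPart_nonneg hF ha hb hc _)).1))

/-- Derivatives fall on the singular factor alone, and the large jumps preserve its profile bound up
to a constant. -/
theorem norm_iteratedFDeriv_fourier_le {k : ℕ} {B : ℝ} (hB : 0 ≤ B)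
    (h : ∀ x, ‖iteratedFDeriv ℝ k (𝓕 (expSymExponent (singularPart g))) x‖ ≤
      B * truncProfile F ‖x‖) (x : V) :
    ‖iteratedFDeriv ℝ k (𝓕 (expSymExponent g)) x‖ ≤
      B * Real.exp (c * 2 ^ ((Module.finrank ℝ V : ℝ) + b) *
        (profileMass V a + profileMass V a)) * truncProfile F ‖x‖ := by
  set ν := convExp (volume.withDensity fun y => ENNReal.ofReal (boundedPart g y)) with hν
  have hm : Measurable fun y : V => truncProfile F ‖x - y‖ :=
    (hF.trunc_measurable ha).comp (by fun_prop)
  have h1 : ∫ y, truncProfile F ‖x - y‖ ∂ν ≤ Real.exp (c * 2 ^ ((Module.finrank ℝ V : ℝ) + b) *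
        (profileMass V a + profileMass V a)) * truncProfile F ‖x‖ := by
    rw [integral_eq_lintegral_of_nonneg_ae (ae_of_all _ fun y => (hF.trunc_pos _).le)
      hm.aestronglyMeasurable]
    exact ENNReal.toReal_le_of_le_ofReal (mul_nonneg (Real.exp_nonneg _) (hF.trunc_pos _).le)
      (hg.lintegral_trunc_sub_convExp_le hF ha hc x)
  have hfin := isFiniteMeasure_withDensity_of_integrable (hg.integrable_boundedPart hF ha hc)
  have hint : Integrable (fun y => truncProfile F ‖x - y‖) ν := by
    refine (integrable_const (1 : ℝ)).mono' hm.aestronglyMeasurable (ae_of_all _ fun y => ?_)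
    rw [Real.norm_of_nonneg (hF.trunc_pos _).le]
    exact hF.trunc_le_one ha _
  have h2 : ‖(Real.exp (-∫ y, boundedPart g y) : ℂ)‖ ≤ 1 := by
    rw [Complex.norm_real, Real.norm_of_nonneg (Real.exp_nonneg _), Real.exp_le_one_iff]
    exact neg_nonpos.2 (integral_nonneg hg.boundedPart_nonneg)
  rw [hg.iteratedFDeriv_fourier_expSymExponent hF ha hb hc, norm_smul]
  refine (mul_le_of_le_one_left (norm_nonneg _) h2).trans ?_
  refine (norm_integral_le_of_norm_le (hint.const_mul B) (ae_of_all _ fun y => h (x - y))).trans ?_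
  rw [integral_const_mul, mul_assoc]
  exact mul_le_mul_of_nonneg_left h1 hB

/-- One large jump lands within `ε` of `x`, and the remaining displacement has density at least `δ`.
As `ε ≤ 1`, doubling compares the profile at the landing point with that at `x`. Small and large `x`
are covered at once, because the truncated profile is `1` on the unit ball. -/
theorem le_re_fourier {δ ε : ℝ} (hδ : 0 < δ) (hε1 : ε ≤ 1)
    (h : ∀ x, ‖x‖ ≤ ε → δ ≤ (𝓕 (expSymExponent (singularPart g)) x).re) (x : V) :
    Real.exp (-(c * profileMass V a)) * (δ * (c⁻¹ * (2 ^ ((Module.finrank ℝ V : ℝ) + b))⁻¹) *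
      (volume : Measure V).real (Metric.ball 0 ε)) * truncProfile F ‖x‖ ≤
      (𝓕 (expSymExponent g) x).re := by
  have hG := hg.isRegularJumpDensity_singularPart hF ha hb hc
  have hfin := isFiniteMeasure_withDensity_of_integrable (hg.integrable_boundedPart hF ha hc)
  set ν := volume.withDensity fun y => ENNReal.ofReal (boundedPart g y) with hν
  set q : V → ℝ := fun x => (𝓕 (expSymExponent (singularPart g)) x).re with hq
  have hcontF : Continuous (𝓕 (expSymExponent (singularPart g))) :=
    (hG.contDiff_fourier ha (exponentConst_pos hc)).continuous
  have hqc : Continuous q := Complex.continuous_re.comp hcontF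
  have hq0 : ∀ x, 0 ≤ q x := fun x =>
    (Complex.le_def.1 (hg.fourier_singularPart_nonneg hF ha hb hc x)).1
  have hqb : ∀ x, ‖q x‖ ≤ ∫ ξ, ‖expSymExponent (singularPart g) ξ‖ := fun x =>
    (Complex.abs_re_le_norm _).trans (VectorFourier.norm_fourierIntegral_le_integral_norm _ _ _ _ _)
  have hqi : ∀ μ : Measure V, IsFiniteMeasure μ → Integrable (fun y => q (x - y)) μ := fun μ _ =>
    (integrable_const (∫ ξ, ‖expSymExponent (singularPart g) ξ‖)).mono'
      (by fun_prop) (ae_of_all _ fun y => hqb _)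
  set κ := c⁻¹ * ((2 ^ ((Module.finrank ℝ V : ℝ) + b))⁻¹ * truncProfile F ‖x‖) with hκ
  have hm0 := hF.trunc_pos ‖x‖
  have hκ0 : 0 < κ := by positivity
  have h1 : δ * κ * (volume : Measure V).real (Metric.ball 0 ε) ≤ ∫ y, q (x - y) ∂ν := by
    have hint : Integrable (fun y => boundedPart g y • q (x - y)) := by
      refine ((hg.integrable_boundedPart hF ha hc).mul_const
        (∫ ξ, ‖expSymExponent (singularPart g) ξ‖)).mono' ?_ (ae_of_all _ fun y => ?_)
      · exact hg.boundedPart_measurable.aestronglyMeasurable.smul (by fun_prop)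
      · rw [norm_smul, Real.norm_of_nonneg (hg.boundedPart_nonneg y)]
        exact mul_le_mul_of_nonneg_left (hqb _) (hg.boundedPart_nonneg y)
    rw [hν, integral_withDensity_ofReal hg.boundedPart_measurable hg.boundedPart_nonneg]
    calc δ * κ * (volume : Measure V).real (Metric.ball 0 ε)
          = ∫ y in Metric.ball x ε, δ * κ := by
          rw [setIntegral_const, smul_eq_mul, Measure.addHaar_real_ball_center _ x, mul_comm]
      _ ≤ ∫ y in Metric.ball x ε, boundedPart g y • q (x - y) := by
          refine setIntegral_mono_on_ae (integrableOn_const (measure_ball_lt_top.ne))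
            hint.integrableOn measurableSet_ball ?_
          -- The lower bound on `g` fails to cover the origin, which is a null set.
          have hne : ∀ᵐ y : V, y ≠ 0 := compl_mem_ae_iff.2 (measure_singleton 0)
          filter_upwards [hne] with y hy0 hy
          rw [mem_ball_iff_norm] at hy
          rw [smul_eq_mul, mul_comm δ]
          refine mul_le_mul ?_ (h _ (by rw [norm_sub_rev]; exact hy.le)) hδ.le
            (hg.boundedPart_nonneg y)
          refine le_trans ?_ (hg.le_boundedPart hF ha hc hy0)
          refine mul_le_mul_of_nonneg_left ?_ (by positivity)
          rw [inv_mul_le_iff₀ (by positivity)]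
          refine hF.trunc_le_two_rpow_mul ha ?_
          have : ‖y‖ ≤ ‖x‖ + ‖y - x‖ := by simpa using norm_add_le x (y - x)
          linarith [le_max_left 1 ‖x‖, le_max_right 1 ‖x‖]
      _ ≤ _ := setIntegral_le_integral hint (ae_of_all _ fun y =>
          smul_nonneg (hg.boundedPart_nonneg y) (hq0 _))
  have h2 : ∫ y, q (x - y) ∂ν ≤ ∫ y, q (x - y) ∂(convExp ν) :=
    integral_mono_measure (le_convExp ν) (ae_of_all _ fun y => hq0 _) (hqi _ inferInstance)
  rw [hg.fourier_expSymExponent_eq_ofReal hF ha hb hc, Complex.ofReal_re]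
  calc _ = Real.exp (-(c * profileMass V a)) *
        (δ * κ * (volume : Measure V).real (Metric.ball 0 ε)) := by rw [hκ]; ring
    _ ≤ _ := by
      refine mul_le_mul ?_ (h1.trans h2) (by positivity) (Real.exp_nonneg _)
      rw [Real.exp_le_exp, neg_le_neg_iff]
      exact hg.integral_boundedPart_le hF ha hc

end IsJumpDensity

/-- Two-sided bounds and derivative bounds for the density at time one, with constants that depend
only on the dimension, the scaling exponents and the comparability constant. -/
theorem exists_uniform_density_bounds {a b c : ℝ} (ha : 0 < a) (hb : b < 2) (hc : 1 ≤ c) :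
    ∃ (K : ℝ) (B : ℕ → ℝ), 0 < K ∧ (∀ k, 0 < B k) ∧ ∀ (F : ℝ → ℝ) (g : V → ℝ),
      IsScalingProfile (Module.finrank ℝ V) a b F → IsJumpDensity c F g →
      ∃ p : V → ℝ, ContDiff ℝ (⊤ : ℕ∞) p ∧ (∀ x, 0 ≤ p x) ∧ Integrable p ∧
        (∀ ξ, charFun (volume.withDensity fun x => ENNReal.ofReal (p x)) ξ =
          (Real.exp (-symExponent g ξ) : ℝ)) ∧
        (∀ x, K * truncProfile F ‖x‖ ≤ p x) ∧
        ∀ k x, ‖iteratedFDeriv ℝ k p x‖ ≤ B k * truncProfile F ‖x‖ := by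
  set M : ℕ → ℝ := fun k => ∫ y, momentMajorant V a b c k y with hM
  have hc0 := exponentConst_pos (V := V) hc
  choose B hB hBb using exists_iteratedFDeriv_fourier_le_trunc (V := V)
    (exponentConst V c * (2 * c)) M ha hc0 b
  set δ := originConst V (M 2) with hδ
  have hδ0 : 0 < δ := originConst_pos _
  -- The bound `1` is for the doubling property, the other for the mean value inequality with
  -- gradient bound `B 1`.
  set ε := min 1 (δ / (2 * B 1)) with hε
  have hε0 : 0 < ε := lt_min one_pos (div_pos hδ0 (mul_pos two_pos (hB 1)))
  have hvol : 0 < (volume : Measure V).real (Metric.ball 0 ε) :=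
    ENNReal.toReal_pos (Metric.measure_ball_pos _ _ hε0).ne' measure_ball_lt_top.ne
  refine ⟨Real.exp (-(c * profileMass V a)) * (δ / 2 * (c⁻¹ *
      (2 ^ ((Module.finrank ℝ V : ℝ) + b))⁻¹) * (volume : Measure V).real (Metric.ball 0 ε)),
    fun k => B k * Real.exp (c * 2 ^ ((Module.finrank ℝ V : ℝ) + b) *
        (profileMass V a + profileMass V a)), by positivity,
    fun k => mul_pos (hB k) (Real.exp_pos _), fun F g hF hg => ?_⟩
  have hG := hg.isRegularJumpDensity_singularPart hF ha hb hc
  have hcd : ContDiff ℝ (⊤ : ℕ∞) (𝓕 (expSymExponent g)) :=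
    Real.contDiff_fourier fun k _ => hg.integrable_pow_mul_expSymExponent hF ha hb hc k
  have hupper : ∀ k x, ‖iteratedFDeriv ℝ k (𝓕 (expSymExponent g)) x‖ ≤
      B k * Real.exp (c * 2 ^ ((Module.finrank ℝ V : ℝ) + b) *
        (profileMass V a + profileMass V a)) * truncProfile F ‖x‖ := fun k x =>
    hg.norm_iteratedFDeriv_fourier_le hF ha hb hc (hB k).le (hBb k _ F a hG hF) x
  have hPint : Integrable (𝓕 (expSymExponent g)) := by
    refine ((hF.integrable_trunc ha).const_mul (B 0 * Real.exp (c * 2 ^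
      ((Module.finrank ℝ V : ℝ) + b) * (profileMass V a + profileMass V a)))).mono'
      hcd.continuous.aestronglyMeasurable (ae_of_all _ fun x => ?_)
    simpa using hupper 0 x
  have hwi : Integrable (expSymExponent g) := by
    have h := hg.integrable_pow_mul_expSymExponent hF ha hb hc 0
    simp only [pow_zero, one_mul] at h
    exact (integrable_norm_iff (measurable_expSymExponent hg.measurable).aestronglyMeasurable).1 h
  -- Continuity, needed for Fourier inversion, is read off the factorisation into a characteristic
  -- function and a smooth function.
  have hwc : Continuous (expSymExponent g) := by
    have hfin := isFiniteMeasure_withDensity_of_integrable (hg.integrable_boundedPart hF ha hc)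
    have h := expSymExponent_add hg.singularPart_measurable
      hg.boundedPart_measurable (hG.integrable 2 le_rfl) hg.boundedPart_nonneg hg.boundedPart_neg
      (hg.integrable_boundedPart hF ha hc)
    rw [IsJumpDensity.singularPart_add_boundedPart] at h
    rw [h]
    have h1 := hG.contDiff_expSymExponent.continuous
    have h2 : Continuous (charFun (convExp (volume.withDensity fun y =>
      ENNReal.ofReal (boundedPart g y)))) := continuous_charFun
    fun_prop
  refine ⟨fun x => (𝓕 (expSymExponent g) x).re, Complex.reCLM.contDiff.comp hcd,
    fun x => (Complex.le_def.1 (hg.fourier_nonneg hF ha hb hc x)).1, hPint.re, fun ξ => ?_,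
    fun x => ?_, fun k x => ?_⟩
  · have h := charFun_withDensity_re_fourier hwc hwi hPint (hg.fourier_nonneg hF ha hb hc)
      ((2 * Real.pi)⁻¹ • ξ)
    rwa [expSymExponent, smul_inv_smul₀ (by positivity)] at h
  · refine hg.le_re_fourier hF ha hb hc (half_pos hδ0) (min_le_left _ _) (fun y hy => ?_) x
    refine hG.le_re_fourier_of_norm_le ha hc0 (hB 1) (fun z => ?_) (hy.trans (min_le_right _ _))
    exact (hBb 1 _ F a hG hF z).trans (mul_le_of_le_one_right (hB 1).le (hF.trunc_le_one ha _))
  · refine le_trans ?_ (hupper k x)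
    have := Complex.reCLM.norm_iteratedFDeriv_comp_left (hcd.contDiffAt (x := x))
      (n := k) (by exact_mod_cast le_top)
    rwa [Complex.reCLM_norm, one_mul] at this

end Main

/-! ### The logarithmic profile and the length scale -/

section LogProfile

/-- The radial profile `r^{-d-α} [log (1 + r^{-κ})]^{-β}`. -/
noncomputable def logProfile (d : ℕ) (α κ β r : ℝ) : ℝ :=
  r ^ (-(d : ℝ) - α) * Real.log (1 + r ^ (-κ)) ^ (-β)

theorem log_one_add_rpow_pos {κ r : ℝ} (hr : 0 < r) : 0 < Real.log (1 + r ^ (-κ)) :=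
  Real.log_pos (by linarith [Real.rpow_pos_of_pos hr (-κ)])

theorem logProfile_pos (d : ℕ) (α κ β : ℝ) {r : ℝ} (hr : 0 < r) : 0 < logProfile d α κ β r :=
  mul_pos (Real.rpow_pos_of_pos hr _) (Real.rpow_pos_of_pos (log_one_add_rpow_pos hr) _)

theorem log_one_add_rpow_mul_le {κ r l : ℝ} (hκ : 0 < κ) (hr : 0 < r) (hl : 1 ≤ l) :
    Real.log (1 + (l * r) ^ (-κ)) ≤ Real.log (1 + r ^ (-κ)) := by
  refine Real.log_le_log (by positivity) (add_le_add_right ?_ 1)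
  exact Real.rpow_le_rpow_of_nonpos hr (le_mul_of_one_le_left hr.le hl) (by linarith)

/-- Bernoulli's inequality `(1 + u)^s ≤ 1 + s u` with `s = l^{-κ} ≤ 1` and `u = r^{-κ}`. -/
theorem le_log_one_add_rpow_mul {κ r l : ℝ} (hκ : 0 < κ) (hr : 0 < r) (hl : 1 ≤ l) :
    l ^ (-κ) * Real.log (1 + r ^ (-κ)) ≤ Real.log (1 + (l * r) ^ (-κ)) := by
  have hl0 : 0 < l := by linarith
  have h1 : l ^ (-κ) ≤ 1 := Real.rpow_le_one_of_one_le_of_nonpos hl (by linarith)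
  have h0 : 0 < r ^ (-κ) := by positivity
  have h2 : 0 < l ^ (-κ) := by positivity
  rw [← Real.log_rpow (by positivity), Real.mul_rpow hl0.le hr.le]
  refine Real.log_le_log (by positivity) ?_
  exact rpow_one_add_le_one_add_mul_self (by linarith) h2.le h1

theorem logProfile_mul {d : ℕ} {α κ β r l : ℝ} (hr : 0 < r) (hl : 0 < l) :
    logProfile d α κ β (l * r) = l ^ (-(d : ℝ) - α) *
      (Real.log (1 + (l * r) ^ (-κ)) / Real.log (1 + r ^ (-κ))) ^ (-β) *
        logProfile d α κ β r := by
  have h1 : 0 < Real.log (1 + r ^ (-κ)) := log_one_add_rpow_pos hr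
  have h2 : 0 < Real.log (1 + (l * r) ^ (-κ)) := log_one_add_rpow_pos (by positivity)
  unfold logProfile
  rw [Real.mul_rpow hl.le hr.le, Real.div_rpow h2.le h1.le]
  have h3 : Real.log (1 + r ^ (-κ)) ^ (-β) ≠ 0 := (Real.rpow_pos_of_pos h1 _).ne'
  field_simp

/-- Dilation by `l` multiplies the logarithm by a factor in `[l^{-κ}, 1]`, hence its power `-β` by a
factor between `1` and `l^{κβ}`. The sign of `β` decides which of `α` and `α - κβ` is the larger
exponent. -/
theorem logProfile_scaling {d : ℕ} {α κ β r l : ℝ} (hκ : 0 < κ) (hr : 0 < r) (hl : 1 ≤ l) :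
    l ^ (-(d : ℝ) - max α (α - κ * β)) * logProfile d α κ β r ≤ logProfile d α κ β (l * r) ∧
    logProfile d α κ β (l * r) ≤
      l ^ (-(d : ℝ) - min α (α - κ * β)) * logProfile d α κ β r := by
  have hl0 : 0 < l := by linarith
  have h1 : 0 < Real.log (1 + r ^ (-κ)) := log_one_add_rpow_pos hr
  have h2 : 0 < Real.log (1 + (l * r) ^ (-κ)) := log_one_add_rpow_pos (by positivity)
  set s := Real.log (1 + (l * r) ^ (-κ)) / Real.log (1 + r ^ (-κ)) with hs
  have hs1 : s ≤ 1 := (div_le_one h1).2 (log_one_add_rpow_mul_le hκ hr hl)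
  have hs2 : l ^ (-κ) ≤ s := (le_div_iff₀ h1).2 (le_log_one_add_rpow_mul hκ hr hl)
  have hs0 : 0 < s := div_pos h2 h1
  have hlk : (l ^ (-κ)) ^ (-β) = l ^ (κ * β) := by rw [← Real.rpow_mul hl0.le, neg_mul_neg]
  have hcomb : l ^ (-(d : ℝ) - α) * l ^ (κ * β) = l ^ (-(d : ℝ) - (α - κ * β)) := by
    rw [← Real.rpow_add hl0]; congr 1; ring
  rw [logProfile_mul hr hl0, ← hs]
  have hf := (logProfile_pos d α κ β hr).le
  rcases le_total 0 β with hβ | hβ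
  · have hκβ : 0 ≤ κ * β := by positivity
    rw [max_eq_left (by linarith), min_eq_right (by linarith), ← hcomb]
    have h3 : 1 ≤ s ^ (-β) := Real.one_le_rpow_of_pos_of_le_one_of_nonpos hs0 hs1 (by linarith)
    have h4 : s ^ (-β) ≤ l ^ (κ * β) := by
      rw [← hlk]
      exact Real.rpow_le_rpow_of_nonpos (by positivity) hs2 (by linarith)
    refine ⟨mul_le_mul_of_nonneg_right ?_ hf, ?_⟩
    · exact le_mul_of_one_le_right (by positivity) h3
    · gcongr
  · have hκβ : κ * β ≤ 0 := mul_nonpos_of_nonneg_of_nonpos hκ.le hβ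
    rw [max_eq_right (by linarith), min_eq_left (by linarith), ← hcomb]
    have h3 : s ^ (-β) ≤ 1 := Real.rpow_le_one hs0.le hs1 (by linarith)
    have h4 : l ^ (κ * β) ≤ s ^ (-β) := by
      rw [← hlk]
      exact Real.rpow_le_rpow (by positivity) hs2 (by linarith)
    refine ⟨?_, mul_le_mul_of_nonneg_right ?_ hf⟩
    · gcongr
    · exact mul_le_of_le_one_right (by positivity) h3

/-- The scaling inequalities are invariant under dilation and normalisation, so the exponents do not
depend on `h`, that is, on time. -/
theorem isScalingProfile_logProfile {d : ℕ} {α κ β h : ℝ} (hκ : 0 < κ) (hh : 0 < h) :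
    IsScalingProfile d (min α (α - κ * β)) (max α (α - κ * β))
      fun r => logProfile d α κ β (h * r) / logProfile d α κ β h where
  one := by rw [mul_one, div_self (logProfile_pos d α κ β hh).ne']
  le_mul r l hr hl := by
    rw [← mul_div_assoc, mul_left_comm]
    exact div_le_div_of_nonneg_right (logProfile_scaling hκ (mul_pos hh hr) hl).1
      (logProfile_pos d α κ β hh).le
  mul_le r l hr hl := by
    rw [← mul_div_assoc, mul_left_comm]
    exact div_le_div_of_nonneg_right (logProfile_scaling hκ (mul_pos hh hr) hl).2
      (logProfile_pos d α κ β hh).le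

/-- The natural length scale at time `t`. -/
noncomputable def spaceScale (α κ β t : ℝ) : ℝ :=
  if t < 1 then t ^ (1 / α) * Real.log (1 + 1 / t) ^ (-(β / α)) else t ^ (1 / (α - κ * β))

theorem log_one_add_inv_pos {t : ℝ} (ht : 0 < t) : 0 < Real.log (1 + 1 / t) :=
  Real.log_pos (by linarith [one_div_pos.2 ht])

theorem spaceScale_pos (α κ β : ℝ) {t : ℝ} (ht : 0 < t) : 0 < spaceScale α κ β t := by
  have := log_one_add_inv_pos ht
  unfold spaceScale
  split_ifs <;> positivity

theorem exists_abs_log_le {ε : ℝ} (hε : 0 < ε) :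
    ∃ C : ℝ, 0 ≤ C ∧ ∀ x : ℝ, Real.log 2 ≤ x → |Real.log x| ≤ ε * x + C := by
  refine ⟨|Real.log ε| + |Real.log (Real.log 2)|, by positivity, fun x hx => ?_⟩
  have h2 : 0 < Real.log 2 := Real.log_pos one_lt_two
  have hx0 : 0 < x := by linarith
  rw [abs_le]
  constructor
  · have h1 := Real.log_le_log h2 hx
    have h3 := neg_abs_le (Real.log (Real.log 2))
    have h4 := abs_nonneg (Real.log ε)
    have h5 : 0 ≤ ε * x := by positivity
    linarith
  · have h1 := Real.log_le_sub_one_of_pos (mul_pos hε hx0)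
    rw [Real.log_mul hε.ne' hx0.ne'] at h1
    have h3 := neg_abs_le (Real.log ε)
    have h4 := abs_nonneg (Real.log (Real.log 2))
    linarith

/-- `log (1 + s^p log(1+s)^q)` is comparable with `log (1 + s)` for `s ≥ 1`. -/
theorem exists_log_one_add_rpow_mul_log_comparable {p : ℝ} (hp : 0 < p) (q : ℝ) :
    ∃ K : ℝ, 1 ≤ K ∧ ∀ s : ℝ, 1 ≤ s →
      K⁻¹ ≤ Real.log (1 + s ^ p * Real.log (1 + s) ^ q) / Real.log (1 + s) ∧
      Real.log (1 + s ^ p * Real.log (1 + s) ^ q) / Real.log (1 + s) ≤ K := by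
  -- This choice gives `|q log ℓ| ≤ (p/2) ℓ + |q| C₀`, at most half of the main term `p ℓ` up to a
  -- constant; the `+ 1` covers `q = 0`.
  obtain ⟨C₀, hC₀, hlog⟩ := exists_abs_log_le (ε := p / (2 * (|q| + 1))) (by positivity)
  set C := p * Real.log 2 + |q| * C₀ with hC
  have h2 : 0 < Real.log 2 := Real.log_pos one_lt_two
  have hC0 : 0 < C := by positivity
  set m := Real.log (1 + Real.exp (-C)) with hm
  have hm0 : 0 < m := Real.log_pos (by linarith [Real.exp_pos (-C)])
  refine ⟨1 + 4 / p + 4 * C / (p * m) + (2 * p + (Real.log 2 + C) / Real.log 2),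
    ?_, fun s hs => ?_⟩
  · have : 0 < 4 / p + 4 * C / (p * m) + (2 * p + (Real.log 2 + C) / Real.log 2) := by positivity
    linarith
  set ℓ := Real.log (1 + s) with hℓ
  set u := s ^ p * ℓ ^ q with hu
  have hs0 : 0 < s := by linarith
  have hℓ2 : Real.log 2 ≤ ℓ := Real.log_le_log two_pos (by linarith)
  have hℓ0 : 0 < ℓ := by linarith
  have hu0 : 0 < u := by positivity
  have hlogu : Real.log u = p * Real.log s + q * Real.log ℓ := by
    rw [hu, Real.log_mul (by positivity) (by positivity), Real.log_rpow hs0, Real.log_rpow hℓ0]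
  have hls1 : Real.log s ≤ ℓ := Real.log_le_log hs0 (by linarith)
  have hls2 : ℓ - Real.log 2 ≤ Real.log s := by
    rw [sub_le_iff_le_add, ← Real.log_mul hs0.ne' two_ne_zero]
    exact Real.log_le_log (by linarith) (by linarith)
  have hq : |q * Real.log ℓ| ≤ p / 2 * ℓ + |q| * C₀ := by
    rw [abs_mul]
    calc |q| * |Real.log ℓ| ≤ |q| * (p / (2 * (|q| + 1)) * ℓ + C₀) := by
          gcongr; exact hlog ℓ hℓ2
      _ = p / 2 * ℓ * (|q| / (|q| + 1)) + |q| * C₀ := by field_simp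
      _ ≤ p / 2 * ℓ * 1 + |q| * C₀ := by
          gcongr
          exact (div_le_one (by positivity)).2 (by linarith)
      _ = _ := by ring
  obtain ⟨hq1, hq2⟩ := abs_le.1 hq
  have hlow : p / 2 * ℓ - C ≤ Real.log u := by
    rw [hlogu, hC]
    nlinarith [mul_le_mul_of_nonneg_left hls2 hp.le]
  have hupp : Real.log u ≤ 2 * p * ℓ + C := by
    rw [hlogu, hC]
    have : 0 ≤ p * Real.log 2 := by positivity
    nlinarith [mul_le_mul_of_nonneg_left hls1 hp.le, mul_pos hp hℓ0]
  constructor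
  · rw [le_div_iff₀ hℓ0, inv_mul_le_iff₀ (by positivity)]
    have hlu : Real.log u ≤ Real.log (1 + u) := Real.log_le_log hu0 (by linarith)
    have hL0 : 0 < Real.log (1 + u) := Real.log_pos (by linarith)
    have hK1 : 0 ≤ 4 * C / (p * m) := by positivity
    have hK2 : 0 ≤ 2 * p + (Real.log 2 + C) / Real.log 2 := by positivity
    have hK3 : 0 ≤ 4 / p := by positivity
    -- For large `ℓ` the constant `C` is absorbed into half of `(p/2) ℓ`. Otherwise `ℓ` is bounded,
    -- while `u ≥ e^{-C}` keeps `log (1 + u)` above `m`.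
    rcases le_total (4 * C / p) ℓ with h | h
    · have h3 : p / 4 * ℓ ≤ Real.log (1 + u) := by
        rw [div_le_iff₀ hp] at h
        linarith
      calc ℓ = 4 / p * (p / 4 * ℓ) := by field_simp
        _ ≤ 4 / p * Real.log (1 + u) := by gcongr
        _ ≤ _ := by gcongr; linarith
    · have h3 : m ≤ Real.log (1 + u) := by
        refine Real.log_le_log (by positivity) (add_le_add_right ?_ 1)
        rw [← Real.le_log_iff_exp_le hu0]
        have : 0 ≤ p / 2 * ℓ := by positivity
        linarith
      calc ℓ ≤ 4 * C / p := h
        _ = 4 * C / (p * m) * m := by field_simp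
        _ ≤ 4 * C / (p * m) * Real.log (1 + u) := by gcongr
        _ ≤ _ := by gcongr; linarith
  · rw [div_le_iff₀ hℓ0]
    have h3 : Real.log (1 + u) ≤ Real.log 2 + (2 * p * ℓ + C) := by
      rcases le_total u 1 with h | h
      · have : Real.log (1 + u) ≤ Real.log 2 := Real.log_le_log (by positivity) (by linarith)
        have : 0 ≤ 2 * p * ℓ := by positivity
        linarith
      · have : Real.log (1 + u) ≤ Real.log (2 * u) := Real.log_le_log (by positivity) (by linarith)
        rw [Real.log_mul two_ne_zero hu0.ne'] at this
        linarith
    have h4 : Real.log 2 + C ≤ (Real.log 2 + C) / Real.log 2 * ℓ := by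
      rw [div_mul_eq_mul_div, le_div_iff₀ h2]
      gcongr
    have h5 : 0 ≤ (1 + 4 / p + 4 * C / (p * m)) * ℓ := by positivity
    linarith

theorem rpow_mem_of_comparable {K x : ℝ} (hK : 1 ≤ K) (h1 : K⁻¹ ≤ x) (h2 : x ≤ K) (s : ℝ) :
    (K ^ |s|)⁻¹ ≤ x ^ s ∧ x ^ s ≤ K ^ |s| := by
  have hK0 : 0 < K := by linarith
  have hx0 : 0 < x := lt_of_lt_of_le (by positivity) h1
  rcases le_total 0 s with hs | hs
  · rw [abs_of_nonneg hs, ← Real.inv_rpow hK0.le]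
    exact ⟨Real.rpow_le_rpow (by positivity) h1 hs, Real.rpow_le_rpow hx0.le h2 hs⟩
  · rw [abs_of_nonpos hs, Real.rpow_neg hK0.le, inv_inv]
    refine ⟨Real.rpow_le_rpow_of_nonpos hx0 h2 hs, ?_⟩
    rw [← Real.inv_rpow hK0.le]
    exact Real.rpow_le_rpow_of_nonpos (by positivity) h1 hs

theorem mul_rpow_mul_logProfile {d : ℕ} {α κ β t h : ℝ} (hh : 0 < h) :
    t * h ^ (d : ℝ) * logProfile d α κ β h =
      t * h ^ (-α) * Real.log (1 + h ^ (-κ)) ^ (-β) := by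
  have h1 : h ^ (d : ℝ) * h ^ (-(d : ℝ) - α) = h ^ (-α) := by
    rw [← Real.rpow_add hh]; congr 1; ring
  rw [logProfile, ← h1]; ring

/-- The scale solves `t h^{-α} log(1 + h^{-κ})^{-β} ≈ 1`. For `t < 1` the quantity is a power of the
ratio of `log(1 + h^{-κ})` to `log(1 + 1/t)`, and `h^{-κ}` is a power of `1/t` times a power of its
logarithm. For `t ≥ 1` it is a power of `h^κ log(1 + h^{-κ})`, which lies in `[1/2, 1]`. -/
theorem exists_spaceScale_comparable (d : ℕ) {α κ β : ℝ} (hα : 0 < α) (hκ : 0 < κ)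
    (hκβ : κ * β < α) : ∃ A : ℝ, 1 ≤ A ∧ ∀ t : ℝ, 0 < t →
      A⁻¹ ≤ t * spaceScale α κ β t ^ (d : ℝ) * logProfile d α κ β (spaceScale α κ β t) ∧
      t * spaceScale α κ β t ^ (d : ℝ) * logProfile d α κ β (spaceScale α κ β t) ≤ A := by
  obtain ⟨K, hK, hKs⟩ := exists_log_one_add_rpow_mul_log_comparable (p := κ / α) (by positivity)
    (κ * β / α)
  have hK2 : 1 ≤ K + 2 := by linarith
  -- `K` serves small times and `2` large times.
  refine ⟨(K + 2) ^ |-β|, Real.one_le_rpow hK2 (abs_nonneg _), fun t ht => ?_⟩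
  have hh := spaceScale_pos α κ β ht
  have hγ : 0 < α - κ * β := by linarith
  rw [mul_rpow_mul_logProfile hh]
  set h := spaceScale α κ β t with hdef
  by_cases ht1 : t < 1
  · have hℓ := log_one_add_inv_pos ht
    set ℓ := Real.log (1 + 1 / t) with hℓdef
    have hh' : h = t ^ (1 / α) * ℓ ^ (-(β / α)) := by rw [hdef, spaceScale, if_pos ht1]
    have h1 : h ^ (-α) = t⁻¹ * ℓ ^ β := by
      rw [hh', Real.mul_rpow (by positivity) (by positivity), ← Real.rpow_mul ht.le,
        ← Real.rpow_mul hℓ.le, ← Real.rpow_neg_one]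
      congr 2 <;> field_simp
    have h2 : h ^ (-κ) = (1 / t) ^ (κ / α) * ℓ ^ (κ * β / α) := by
      rw [hh', Real.mul_rpow (by positivity) (by positivity), ← Real.rpow_mul ht.le,
        ← Real.rpow_mul hℓ.le, one_div t, Real.inv_rpow ht.le, ← Real.rpow_neg ht.le]
      congr 2 <;> field_simp
    have h3 := hKs (1 / t) ((one_le_div ht).2 ht1.le)
    rw [← hℓdef, ← h2] at h3
    have hL := log_one_add_rpow_pos (κ := κ) hh
    have h4 : t * h ^ (-α) * Real.log (1 + h ^ (-κ)) ^ (-β) =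
        (Real.log (1 + h ^ (-κ)) / ℓ) ^ (-β) := by
      rw [Real.div_rpow hL.le hℓ.le, h1, Real.rpow_neg hℓ.le, div_inv_eq_mul, ← mul_assoc,
        mul_inv_cancel₀ ht.ne', one_mul, mul_comm]
    rw [h4]
    exact rpow_mem_of_comparable hK2
      ((inv_anti₀ (by positivity) (by linarith)).trans h3.1) (by linarith [h3.2]) _
  · have hh' : h = t ^ (1 / (α - κ * β)) := by rw [hdef, spaceScale, if_neg ht1]
    have h1 : 1 ≤ h := by rw [hh']; exact Real.one_le_rpow (not_lt.1 ht1) (by positivity)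
    have ht' : t = h ^ (α - κ * β) := by
      rw [hh', ← Real.rpow_mul ht.le, one_div, inv_mul_cancel₀ hγ.ne', Real.rpow_one]
    have hL := log_one_add_rpow_pos (κ := κ) hh
    have h4 : t * h ^ (-α) * Real.log (1 + h ^ (-κ)) ^ (-β) =
        (h ^ κ * Real.log (1 + h ^ (-κ))) ^ (-β) := by
      rw [Real.mul_rpow (by positivity) hL.le, ← Real.rpow_mul hh.le, ht', ← Real.rpow_add hh]
      congr 2; ring
    have hu0 : 0 < h ^ (-κ) := by positivity
    have hu1 : h ^ (-κ) ≤ 1 := Real.rpow_le_one_of_one_le_of_nonpos h1 (by linarith)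
    have hu : h ^ κ * h ^ (-κ) = 1 := by rw [← Real.rpow_add hh]; simp
    have hκ0 : 0 < h ^ κ := by positivity
    have h5 : h ^ κ * Real.log (1 + h ^ (-κ)) ≤ 1 := by
      have := Real.log_le_sub_one_of_pos (show 0 < 1 + h ^ (-κ) by linarith)
      calc _ ≤ h ^ κ * h ^ (-κ) := by gcongr; linarith
        _ = 1 := hu
    have h6 : (1 : ℝ) / 2 ≤ h ^ κ * Real.log (1 + h ^ (-κ)) := by
      have h7 : h ^ (-κ) / 2 ≤ Real.log (1 + h ^ (-κ)) := by
        have := Real.one_sub_inv_le_log_of_pos (show 0 < 1 + h ^ (-κ) by linarith)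
        refine le_trans ?_ this
        rw [div_le_iff₀ two_pos, show 1 - (1 + h ^ (-κ))⁻¹ = h ^ (-κ) / (1 + h ^ (-κ)) by
          field_simp; ring, div_mul_eq_mul_div, le_div_iff₀ (by linarith)]
        nlinarith
      calc (1 : ℝ) / 2 = h ^ κ * (h ^ (-κ) / 2) := by rw [← mul_div_assoc, hu]
        _ ≤ _ := by gcongr
    rw [h4]
    refine rpow_mem_of_comparable hK2 (le_trans ?_ h6) (by linarith) _
    rw [one_div]
    exact inv_anti₀ two_pos (by linarith)

end LogProfile

/-! ### The Lévy–Khintchine exponent of a symmetric density -/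

section LevyExponent

variable {d : ℕ}

theorem norm_levy_integrand_le (ξ y : EuclideanSpace ℝ (Fin d)) :
    ‖Complex.exp (Complex.I * (⟪ξ, y⟫ : ℝ)) - 1 - Complex.I * (⟪ξ, y⟫ : ℝ) *
      (Metric.ball (0 : EuclideanSpace ℝ (Fin d)) 1).indicator (fun _ => (1 : ℂ)) y‖ ≤
      (2 + 3 * ‖ξ‖ ^ 2) * min 1 (‖y‖ ^ 2) := by
  by_cases hy : y ∈ Metric.ball (0 : EuclideanSpace ℝ (Fin d)) 1
  · rw [Set.indicator_of_mem hy, mul_one, mul_comm Complex.I]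
    rw [mem_ball_zero_iff] at hy
    rw [min_eq_right (pow_le_one₀ (norm_nonneg _) hy.le)]
    have h3 := abs_real_inner_le_norm ξ y
    have h4 : ⟪ξ, y⟫ ^ 2 ≤ (‖ξ‖ * ‖y‖) ^ 2 := sq_le_sq' (by linarith [neg_abs_le ⟪ξ, y⟫])
      (le_trans (le_abs_self _) h3)
    refine (norm_exp_mul_I_sub_sub_le _).trans ?_
    nlinarith [sq_nonneg ‖y‖]
  · rw [Set.indicator_of_notMem hy, mul_zero, sub_zero, mul_comm Complex.I]
    have h1 : 1 ≤ ‖y‖ := by simpa using hy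
    rw [min_eq_left (one_le_pow₀ h1), mul_one]
    calc _ ≤ ‖Complex.exp ((⟪ξ, y⟫ : ℝ) * Complex.I)‖ + ‖(1 : ℂ)‖ := norm_sub_le _ _
      _ = 2 := by rw [Complex.norm_exp_ofReal_mul_I, norm_one]; norm_num
      _ ≤ _ := by linarith [sq_nonneg ‖ξ‖]

/-- Averaging with the reflection `y ↦ -y` cancels the sine and the compensator, both odd, and
leaves the cosine. -/
theorem levyExponent_eq_symExponent {g : EuclideanSpace ℝ (Fin d) → ℝ} (hg : Measurable g)
    (hg0 : ∀ y, 0 ≤ g y) (hs : ∀ y, g (-y) = g y)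
    (hν : IsLevyMeasure (volume.withDensity fun y => ENNReal.ofReal (g y)))
    (ξ : EuclideanSpace ℝ (Fin d)) :
    levyExponent (volume.withDensity fun y => ENNReal.ofReal (g y)) 0 ξ =
      (symExponent g ξ : ℂ) := by
  set u : EuclideanSpace ℝ (Fin d) → ℂ := fun y =>
    Complex.exp (Complex.I * (⟪ξ, y⟫ : ℝ)) - 1 - Complex.I * (⟪ξ, y⟫ : ℝ) *
      (Metric.ball (0 : EuclideanSpace ℝ (Fin d)) 1).indicator (fun _ => (1 : ℂ)) y with hu
  have hind : Measurable fun y => (Metric.ball (0 : EuclideanSpace ℝ (Fin d)) 1).indicator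
      (fun _ => (1 : ℂ)) y := measurable_const.indicator measurableSet_ball
  have hum : Measurable u := by fun_prop
  have hmin : Integrable (fun y : EuclideanSpace ℝ (Fin d) => g y * min 1 (‖y‖ ^ 2)) := by
    have h1 := hν.2
    rw [lintegral_withDensity_eq_lintegral_mul _ hg.ennreal_ofReal (by fun_prop)] at h1
    refine ⟨by fun_prop, ?_⟩
    rw [hasFiniteIntegral_iff_ofReal (ae_of_all _ fun y => mul_nonneg (hg0 y) (by positivity))]
    refine lt_of_le_of_lt (le_of_eq (lintegral_congr fun y => ?_)) h1
    rw [Pi.mul_apply, ENNReal.ofReal_mul (hg0 y)]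
  have hint : Integrable fun y => g y • u y := by
    refine (hmin.const_mul (2 + 3 * ‖ξ‖ ^ 2)).mono' (by fun_prop) (ae_of_all _ fun y => ?_)
    rw [norm_smul, Real.norm_of_nonneg (hg0 y)]
    calc g y * ‖u y‖ ≤ g y * ((2 + 3 * ‖ξ‖ ^ 2) * min 1 (‖y‖ ^ 2)) :=
          mul_le_mul_of_nonneg_left (norm_levy_integrand_le ξ y) (hg0 y)
      _ = _ := by ring
  have hint' : Integrable fun y => g y • u (-y) := by
    have := hint.comp_neg
    simpa only [hs] using this
  have h1 : ∫ y, g y • u y = ∫ y, g y • u (-y) := by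
    rw [← integral_neg_eq_self]
    simp_rw [hs]
  have h2 : (2 : ℂ) * -∫ y, g y • u y = 2 * (symExponent g ξ : ℂ) := by
    rw [mul_neg, two_mul]
    nth_rewrite 2 [h1]
    rw [← integral_add hint hint', symExponent, ← integral_complex_ofReal,
      ← integral_const_mul, ← integral_neg]
    refine integral_congr_ae (ae_of_all _ fun y => ?_)
    have hsymm : (Metric.ball (0 : EuclideanSpace ℝ (Fin d)) 1).indicator (fun _ => (1 : ℂ)) (-y) =
        (Metric.ball (0 : EuclideanSpace ℝ (Fin d)) 1).indicator (fun _ => (1 : ℂ)) y := by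
      simp [Set.indicator]
    simp only [hu, hsymm, inner_neg_right, Complex.real_smul]
    rw [mul_comm Complex.I, mul_comm Complex.I, Complex.exp_mul_I, Complex.exp_mul_I]
    push_cast
    rw [Complex.cos_neg, Complex.sin_neg]
    ring
  rw [levyExponent, inner_zero_right, Complex.ofReal_zero, mul_zero, sub_zero,
    integral_withDensity_ofReal hg hg0]
  exact mul_left_cancel₀ two_ne_zero h2

end LevyExponent

/-! ### Rescaling in space and time -/

section Rescaling

variable {V : Type*} [NormedAddCommGroup V] [InnerProductSpace ℝ V] [FiniteDimensional ℝ V]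
  [MeasurableSpace V] [BorelSpace V]

theorem integral_comp_smul_of_pos {E : Type*} [NormedAddCommGroup E] [NormedSpace ℝ E]
    (f : V → E) {h : ℝ} (hh : 0 < h) :
    ∫ y, f (h • y) = (h ^ Module.finrank ℝ V)⁻¹ • ∫ y, f y := by
  rw [Measure.integral_comp_smul, abs_of_nonneg (by positivity)]

/-- The density on the left is the Lévy density of `X_t / h`; the identity reduces time `t` to time
one. -/
theorem symExponent_rescale (g : V → ℝ) {t h : ℝ} (hh : 0 < h) (ξ : V) :
    symExponent (fun y => t * h ^ Module.finrank ℝ V * g (h • y)) (h • ξ) =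
      t * symExponent g ξ := by
  have h1 := integral_comp_smul_of_pos (fun y : V => (1 - Real.cos ⟪ξ, y⟫) * g y) hh
  have h2 : ∀ y : V, (1 - Real.cos ⟪h • ξ, y⟫) * (t * h ^ Module.finrank ℝ V * g (h • y)) =
      (t * h ^ Module.finrank ℝ V) * ((1 - Real.cos ⟪ξ, h • y⟫) * g (h • y)) := fun y => by
    rw [inner_smul_left, inner_smul_right]; simp; ring
  unfold symExponent
  simp_rw [h2]
  rw [integral_const_mul, h1, smul_eq_mul]
  field_simp

theorem charFun_withDensity_rescale {p : V → ℝ} (hp : Measurable p) (hp0 : ∀ x, 0 ≤ p x) {h : ℝ}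
    (hh : 0 < h) (ξ : V) :
    charFun (volume.withDensity fun x =>
      ENNReal.ofReal ((h ^ Module.finrank ℝ V)⁻¹ * p (h⁻¹ • x))) ξ =
      charFun (volume.withDensity fun x => ENNReal.ofReal (p x)) (h • ξ) := by
  have hm : Measurable fun x : V => p (h⁻¹ • x) := hp.comp (measurable_const_smul _)
  rw [charFun_apply, charFun_apply, integral_withDensity_ofReal hp hp0,
    integral_withDensity_ofReal (hm.const_mul _) (fun x => mul_nonneg (by positivity) (hp0 _))]
  have h1 := integral_comp_smul_of_pos
    (fun x : V => p x • Complex.exp ((⟪x, h • ξ⟫ : ℝ) * Complex.I)) (inv_pos.2 hh)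
  rw [inv_pow, inv_inv] at h1
  have h2 : ∀ x : V, ((h ^ Module.finrank ℝ V)⁻¹ * p (h⁻¹ • x)) •
      Complex.exp ((⟪x, ξ⟫ : ℝ) * Complex.I) = (h ^ Module.finrank ℝ V)⁻¹ •
        (p (h⁻¹ • x) • Complex.exp ((⟪h⁻¹ • x, h • ξ⟫ : ℝ) * Complex.I)) := fun x => by
    rw [inner_smul_left, inner_smul_right, smul_smul]
    congr 4
    simp [hh.ne']
  simp_rw [h2]
  rw [integral_smul, h1, inv_smul_smul₀ (by positivity)]

theorem norm_iteratedFDeriv_rescale_le {p : V → ℝ} (hp : ContDiff ℝ (⊤ : ℕ∞) p) {h s : ℝ}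
    (hh : 0 < h) (hs : 0 ≤ s) (k : ℕ) (x : V) :
    ‖iteratedFDeriv ℝ k (fun x => s * p (h⁻¹ • x)) x‖ ≤
      s * (h ^ k)⁻¹ * ‖iteratedFDeriv ℝ k p (h⁻¹ • x)‖ := by
  have hk : ((k : ℕ∞) : WithTop ℕ∞) ≤ ((⊤ : ℕ∞) : WithTop ℕ∞) := by exact_mod_cast le_top
  have hcomp : iteratedFDeriv ℝ k (fun x => p (h⁻¹ • x)) x =
      h⁻¹ ^ k • iteratedFDeriv ℝ k p (h⁻¹ • x) := by
    exact congrFun (iteratedFDeriv_comp_const_smul (i := k) h⁻¹ (hp.of_le hk)) x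
  have hcd : ContDiff ℝ k fun x => p (h⁻¹ • x) := (hp.of_le hk).comp (contDiff_const_smul _)
  have h1 : iteratedFDeriv ℝ k (fun x => s * p (h⁻¹ • x)) x =
      s • iteratedFDeriv ℝ k (fun x => p (h⁻¹ • x)) x :=
    iteratedFDeriv_const_smul_apply' (a := s) hcd.contDiffAt
  rw [h1, hcomp, norm_smul, norm_smul, Real.norm_of_nonneg hs, Real.norm_of_nonneg (by positivity),
    inv_pow, mul_assoc]

end Rescaling

/-! ### Multi-index derivatives -/

section MultiDeriv

variable {d : ℕ}

/-- An iterated partial derivative is an iterated Fréchet derivative along basis vectors. -/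
theorem exists_multiDeriv_eq {f : EuclideanSpace ℝ (Fin d) → ℝ}
    (hf : ContDiff ℝ (⊤ : ℕ∞) f) (η : Fin d → ℕ) (l : List (Fin d)) :
    ∃ v : Fin (l.map η).sum → EuclideanSpace ℝ (Fin d), (∀ i, ‖v i‖ ≤ 1) ∧
      l.foldr (fun i g => (partialDeriv i)^[η i] g) f =
        fun x => iteratedFDeriv ℝ (l.map η).sum f x v := by
  have key : ∀ (i : Fin d) (m n : ℕ) (v : Fin n → EuclideanSpace ℝ (Fin d)),
      (∀ j, ‖v j‖ ≤ 1) → ∃ w : Fin (m + n) → EuclideanSpace ℝ (Fin d), (∀ j, ‖w j‖ ≤ 1) ∧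
      (partialDeriv i)^[m] (fun x => iteratedFDeriv ℝ n f x v) =
        fun x => iteratedFDeriv ℝ (m + n) f x w := by
    intro i m n v hv
    induction m with
    | zero => rw [zero_add]; exact ⟨v, hv, rfl⟩
    | succ m ih =>
      obtain ⟨w, hw, h⟩ := ih
      rw [Function.iterate_succ_apply', h, show m + 1 + n = (m + n) + 1 by omega]
      -- The newest derivative is the outermost one, so its direction goes first. Only the bound `1`
      -- on the directions matters afterwards.
      refine ⟨Fin.cons (EuclideanSpace.single i 1) w, fun j => ?_, ?_⟩
      · refine Fin.cases ?_ (fun j => ?_) j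
        · simp
        · simpa using hw j
      · funext x
        have hd : DifferentiableAt ℝ (iteratedFDeriv ℝ (m + n) f) x :=
          (hf.differentiable_iteratedFDeriv (by exact_mod_cast ENat.natCast_lt_top _)) x
        have hd' : HasFDerivAt (fun x => iteratedFDeriv ℝ (m + n) f x w)
            ((ContinuousMultilinearMap.apply ℝ (fun _ : Fin (m + n) =>
              EuclideanSpace ℝ (Fin d)) ℝ w).comp (fderiv ℝ (iteratedFDeriv ℝ (m + n) f) x)) x :=
          (ContinuousMultilinearMap.apply ℝ (fun _ : Fin (m + n) =>
              EuclideanSpace ℝ (Fin d)) ℝ w).hasFDerivAt.comp x hd.hasFDerivAt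
        rw [partialDeriv, hd'.differentiableAt.lineDeriv_eq_fderiv, hd'.fderiv,
          iteratedFDeriv_succ_apply_left]
        simp
  induction l with
  | nil => exact ⟨fun _ => 0, by simp, by funext x; exact (iteratedFDeriv_zero_apply _).symm⟩
  | cons i l ih =>
    obtain ⟨v, hv, h⟩ := ih
    rw [List.foldr_cons, h, List.map_cons, List.sum_cons]
    exact key i (η i) _ v hv

theorem abs_multiDeriv_le {f : EuclideanSpace ℝ (Fin d) → ℝ} (hf : ContDiff ℝ (⊤ : ℕ∞) f)
    (η : Fin d → ℕ) (x : EuclideanSpace ℝ (Fin d)) :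
    |multiDeriv η f x| ≤ ‖iteratedFDeriv ℝ (∑ i, η i) f x‖ := by
  obtain ⟨v, hv, h⟩ := exists_multiDeriv_eq hf η (List.finRange d)
  have hsum : ((List.finRange d).map η).sum = ∑ i, η i := by
    rw [← List.ofFn_eq_map, List.sum_ofFn]
  rw [← hsum, multiDeriv, h, ← Real.norm_eq_abs]
  refine (ContinuousMultilinearMap.le_opNorm _ _).trans ?_
  exact mul_le_of_le_one_right (norm_nonneg _)
    (Finset.prod_le_one (fun i _ => norm_nonneg _) fun i _ => hv i)

end MultiDeriv

/-! ### From truncated profiles to the stated minimum -/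

section SpaceScale

variable {α κ β t : ℝ}

theorem spaceScale_rpow_of_lt_one (ht : 0 < t) (ht1 : t < 1) (s : ℝ) :
    spaceScale α κ β t ^ s = t ^ (s / α) * Real.log (1 + 1 / t) ^ (-(s * β / α)) := by
  have hℓ := log_one_add_inv_pos ht
  rw [spaceScale, if_pos ht1, Real.mul_rpow (by positivity) (by positivity),
    ← Real.rpow_mul ht.le, ← Real.rpow_mul hℓ.le]
  congr 2 <;> ring

theorem spaceScale_rpow_of_one_le (ht1 : 1 ≤ t) (s : ℝ) :
    spaceScale α κ β t ^ s = t ^ (s / (α - κ * β)) := by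
  rw [spaceScale, if_neg (not_lt.2 ht1), ← Real.rpow_mul (by linarith)]
  congr 1; ring

variable {d : ℕ} (x : EuclideanSpace ℝ (Fin d))

theorem minLogStable_rescale {h : ℝ} (hh : 0 < h) :
    minLogStable α κ β (h ^ (-(d : ℝ))) t x =
      h ^ (-(d : ℝ)) * minLogStable α κ β 1 (t * h ^ (d : ℝ)) x := by
  have h1 : h ^ (-(d : ℝ)) * h ^ (d : ℝ) = 1 := by rw [← Real.rpow_add hh]; simp
  unfold minLogStable
  split_ifs with hx
  · rw [mul_one]
  · rw [mul_min_of_nonneg _ _ (by positivity), mul_one]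
    congr 1
    linear_combination (-(t * logStableDensity α κ β x)) * h1

theorem minLogStable_one_nonneg {B : ℝ} (hB : 0 ≤ B) : 0 ≤ minLogStable α κ β 1 B x := by
  unfold minLogStable
  split_ifs with hx
  · exact zero_le_one
  · exact le_min zero_le_one (mul_nonneg hB (logProfile_pos d α κ β (norm_pos_iff.2 hx)).le)

/-- For `x ≠ 0` the second entry of the minimum is `Q` times the normalised profile at `‖x‖ / h`,
where `Q = t h^d f(h)` lies in `[A⁻¹, A]`. -/
theorem truncProfile_logProfile_comparable {A h : ℝ} (hκ : 0 < κ) (ha : 0 < min α (α - κ * β))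
    (hh : 0 < h) (hA : 1 ≤ A) (h1 : A⁻¹ ≤ t * h ^ (d : ℝ) * logProfile d α κ β h)
    (h2 : t * h ^ (d : ℝ) * logProfile d α κ β h ≤ A) :
    A⁻¹ * minLogStable α κ β 1 (t * h ^ (d : ℝ)) x ≤
      truncProfile (fun r => logProfile d α κ β (h * r) / logProfile d α κ β h) ‖h⁻¹ • x‖ ∧
    truncProfile (fun r => logProfile d α κ β (h * r) / logProfile d α κ β h) ‖h⁻¹ • x‖ ≤
      A * minLogStable α κ β 1 (t * h ^ (d : ℝ)) x := by
  have hF := isScalingProfile_logProfile (d := d) (α := α) (β := β) hκ hh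
  have hA0 : 0 < A := by linarith
  have hA1 : A⁻¹ ≤ 1 := inv_le_one_of_one_le₀ hA
  unfold minLogStable
  split_ifs with hx
  · rw [hx, smul_zero, norm_zero, hF.trunc_of_le_one zero_le_one, mul_one, mul_one]
    exact ⟨hA1, hA⟩
  · have hx0 : 0 < ‖x‖ := norm_pos_iff.2 hx
    have hn : ‖h⁻¹ • x‖ = h⁻¹ * ‖x‖ := by rw [norm_smul, Real.norm_of_nonneg (by positivity)]
    rw [hn, hF.trunc_eq_min ha (by positivity), mul_inv_cancel_left₀ hh.ne']
    have hf := logProfile_pos d α κ β hh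
    have hfx : 0 < logProfile d α κ β ‖x‖ := logProfile_pos d α κ β hx0
    set z := logProfile d α κ β ‖x‖ / logProfile d α κ β h with hz
    set Q := t * h ^ (d : ℝ) * logProfile d α κ β h with hQ
    have hz0 : 0 < z := div_pos hfx hf
    have hQz : t * h ^ (d : ℝ) * logStableDensity α κ β x = Q * z := by
      change t * h ^ (d : ℝ) * logProfile d α κ β ‖x‖ = Q * z
      rw [hQ, hz]; field_simp
    clear_value Q z
    rw [hQz, mul_min_of_nonneg _ _ (by positivity), mul_min_of_nonneg _ _ hA0.le, mul_one, mul_one]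
    constructor
    · refine min_le_min hA1 ?_
      rw [← mul_assoc]
      refine mul_le_of_le_one_left hz0.le ?_
      rw [inv_mul_le_iff₀ hA0, mul_one]; exact h2
    · refine min_le_min hA ?_
      rw [← mul_assoc]
      refine le_mul_of_one_le_left hz0.le ?_
      rwa [inv_le_iff_one_le_mul₀' hA0] at h1

end SpaceScale

/-! ### Assembly: densities of the semigroup at all times -/

/-- Replacing the prefactor `t h^d` by `1 / f(h)` costs a factor `A`, so the comparability constant
`C * A` is the same for all times. -/
theorem isJumpDensity_rescale {d : ℕ} {α κ β C A t h : ℝ} (hC : 1 ≤ C) (ht : 0 < t) (hh : 0 < h)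
    (hA : 1 ≤ A) (h1 : A⁻¹ ≤ t * h ^ (d : ℝ) * logProfile d α κ β h)
    (h2 : t * h ^ (d : ℝ) * logProfile d α κ β h ≤ A)
    {g : EuclideanSpace ℝ (Fin d) → ℝ} (hg : IsJumpDensity C (logProfile d α κ β) g) :
    IsJumpDensity (C * A) (fun r => logProfile d α κ β (h * r) / logProfile d α κ β h)
      fun y => t * h ^ Module.finrank ℝ (EuclideanSpace ℝ (Fin d)) * g (h • y) where
  measurable := (hg.measurable.comp (measurable_const_smul h)).const_mul _
  nonneg y := mul_nonneg (by positivity) (hg.nonneg _)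
  symm y := by rw [smul_neg, hg.symm]
  le y hy := by
    have hf := logProfile_pos d α κ β hh
    have h3 := hg.le (h • y) (smul_ne_zero hh.ne' hy)
    have hfy := logProfile_pos d α κ β (norm_pos_iff.2 (smul_ne_zero hh.ne' hy))
    rw [← Real.rpow_natCast, finrank_euclideanSpace_fin]
    rw [norm_smul, Real.norm_of_nonneg hh.le] at h3 hfy
    rw [mul_inv]
    have h4 : A⁻¹ / logProfile d α κ β h ≤ t * h ^ (d : ℝ) := (div_le_iff₀ hf).2 h1
    calc _ = A⁻¹ / logProfile d α κ β h * (C⁻¹ * logProfile d α κ β (h * ‖y‖)) := by ring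
      _ ≤ _ := mul_le_mul h4 h3 (by positivity) (by positivity)
  ge y hy := by
    have hf := logProfile_pos d α κ β hh
    have h3 := hg.ge (h • y) (smul_ne_zero hh.ne' hy)
    rw [← Real.rpow_natCast, finrank_euclideanSpace_fin]
    rw [norm_smul, Real.norm_of_nonneg hh.le] at h3
    have h4 : t * h ^ (d : ℝ) ≤ A / logProfile d α κ β h := (le_div_iff₀ hf).2 h2
    calc _ ≤ A / logProfile d α κ β h * (C * logProfile d α κ β (h * ‖y‖)) :=
          mul_le_mul h4 h3 (hg.nonneg _) (by positivity)
      _ = _ := by ring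

/-- The value `g 0` is unconstrained and may be negative. Taking `max (g y) 0` repairs this without
changing the measure with density `ENNReal.ofReal (g y)`. -/
theorem exists_isJumpDensity_of_comparableOn {d : ℕ} {α κ β : ℝ}
    {g : EuclideanSpace ℝ (Fin d) → ℝ} (hg : Measurable g) (hs : ∀ y, g (-y) = g y)
    (h : ComparableOn {y | y ≠ 0} g (logStableDensity α κ β)) :
    ∃ C : ℝ, 1 ≤ C ∧ IsJumpDensity C (logProfile d α κ β) fun y => max (g y) 0 := by
  obtain ⟨c, hc, hcg⟩ := h
  refine ⟨max c 1, le_max_right _ _, hg.max measurable_const, fun y => le_max_right _ _,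
    fun y => by rw [hs], fun y hy => ?_, fun y hy => ?_⟩
  · obtain ⟨-, h2⟩ := hcg y hy
    have hf := logProfile_pos d α κ β (norm_pos_iff.2 hy)
    refine le_trans ?_ (le_max_left _ _)
    rw [inv_mul_le_iff₀ (by positivity)]
    have hg0 : 0 ≤ g y := by
      by_contra hneg
      have : logStableDensity α κ β y < 0 := lt_of_le_of_lt h2 (mul_neg_of_pos_of_neg hc
        (not_le.1 hneg))
      exact absurd hf (not_lt.2 this.le)
    exact h2.trans (mul_le_mul_of_nonneg_right (le_max_left _ _) hg0)
  · obtain ⟨h1, -⟩ := hcg y hy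
    have hf := logProfile_pos d α κ β (norm_pos_iff.2 hy)
    rw [inv_mul_le_iff₀ hc] at h1
    refine max_le (h1.trans ?_) (by positivity)
    exact mul_le_mul_of_nonneg_right (le_max_left _ _) hf.le

/-- Densities of the semigroup with bounds in terms of the length scale `spaceScale`. -/
theorem exists_density_spaceScale (d : ℕ) (hd : 1 ≤ d) (α κ β : ℝ)
    (hα0 : 0 < α) (hα2 : α < 2) (hκ : 0 < κ) (hκβ : κ * β < α) (hκβ' : α - 2 < κ * β)
    (g : EuclideanSpace ℝ (Fin d) → ℝ) (hg : Measurable g) (hg_symm : ∀ y, g (-y) = g y)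
    (hg_approx : ComparableOn {y | y ≠ 0} g (logStableDensity α κ β))
    (hν : IsLevyMeasure (volume.withDensity fun y => ENNReal.ofReal (g y)))
    (P : ℝ → Measure (EuclideanSpace ℝ (Fin d)))
    (hP : IsLevySemigroup (volume.withDensity fun y => ENNReal.ofReal (g y)) 0 P) :
    ∃ (K : ℝ) (B : ℕ → ℝ), 0 < K ∧ (∀ k, 0 < B k) ∧ ∀ t : ℝ, 0 < t →
      ∃ p : EuclideanSpace ℝ (Fin d) → ℝ,
        ContDiff ℝ (⊤ : ℕ∞) p ∧ (∀ x, 0 ≤ p x) ∧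
        P t = volume.withDensity (fun x => ENNReal.ofReal (p x)) ∧
        (∀ x, K * (spaceScale α κ β t ^ (-(d : ℝ)) *
          minLogStable α κ β 1 (t * spaceScale α κ β t ^ (d : ℝ)) x) ≤ p x) ∧
        ∀ (k : ℕ) x, ‖iteratedFDeriv ℝ k p x‖ ≤ B k * (spaceScale α κ β t ^ (-(d : ℝ) - k) *
          minLogStable α κ β 1 (t * spaceScale α κ β t ^ (d : ℝ)) x) := by
  have hfr : Module.finrank ℝ (EuclideanSpace ℝ (Fin d)) = d := finrank_euclideanSpace_fin
  have : Nontrivial (EuclideanSpace ℝ (Fin d)) :=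
    Module.nontrivial_of_finrank_pos (R := ℝ) (by rw [hfr]; omega)
  obtain ⟨C, hC, hjump⟩ := exists_isJumpDensity_of_comparableOn hg hg_symm hg_approx
  obtain ⟨A, hA, hscale⟩ := exists_spaceScale_comparable d hα0 hκ hκβ
  have ha : 0 < min α (α - κ * β) := lt_min hα0 (by linarith)
  obtain ⟨K, B, hK, hB, hunif⟩ := exists_uniform_density_bounds
    (V := EuclideanSpace ℝ (Fin d)) (a := min α (α - κ * β)) (b := max α (α - κ * β))
    (c := C * A) ha (max_lt hα2 (by linarith)) (one_le_mul_of_one_le_of_one_le hC hA)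
  have hA0 : 0 < A := by linarith
  refine ⟨K * A⁻¹, fun k => B k * A, by positivity, fun k => mul_pos (hB k) hA0, fun t ht => ?_⟩
  obtain ⟨h1, h2⟩ := hscale t ht
  have hh := spaceScale_pos α κ β ht
  set h := spaceScale α κ β t
  -- The time-one bounds are applied to the rescaled density; `K` and `B` were fixed before `t`.
  obtain ⟨p, hp, hp0, hpi, hpc, hplow, hpup⟩ := hunif _ _
    (by rw [hfr]; exact isScalingProfile_logProfile hκ hh)
    (isJumpDensity_rescale hC ht hh hA h1 h2 hjump)
  have htr := fun x : EuclideanSpace ℝ (Fin d) => truncProfile_logProfile_comparable (α := α) (κ := κ) (β := β) x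
    hκ ha hh hA h1 h2
  have hhd : (h ^ Module.finrank ℝ (EuclideanSpace ℝ (Fin d)))⁻¹ = h ^ (-(d : ℝ)) := by
    rw [hfr, Real.rpow_neg hh.le, Real.rpow_natCast]
  have hcd : ContDiff ℝ (⊤ : ℕ∞) fun x : EuclideanSpace ℝ (Fin d) => h ^ (-(d : ℝ)) * p (h⁻¹ • x) :=
    contDiff_const.mul (hp.comp (contDiff_const_smul _))
  have hofReal : (fun y => ENNReal.ofReal (g y)) = fun y => ENNReal.ofReal (max (g y) 0) := by
    funext y
    rcases le_total 0 (g y) with hy | hy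
    · rw [max_eq_left hy]
    · rw [max_eq_right hy, ENNReal.ofReal_of_nonpos hy, ENNReal.ofReal_zero]
  refine ⟨fun x => h ^ (-(d : ℝ)) * p (h⁻¹ • x), hcd,
    fun x => mul_nonneg (by positivity) (hp0 _), ?_, fun x => ?_, fun k x => ?_⟩
  · have hprob := hP.isProbabilityMeasure t ht.le
    have hfin : IsFiniteMeasure (volume.withDensity fun x =>
        ENNReal.ofReal (h ^ (-(d : ℝ)) * p (h⁻¹ • x))) :=
      isFiniteMeasure_withDensity_of_integrable
        ((hpi.comp_smul (inv_ne_zero hh.ne')).const_mul _)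
    -- The rescaled time-one density has the characteristic function of `P t`, which identifies the
    -- measures.
    refine Measure.ext_of_charFun (funext fun ξ => ?_)
    rw [hP.charFun_eq t ht.le]
    rw [hofReal] at hν ⊢
    rw [levyExponent_eq_symExponent hjump.measurable hjump.nonneg hjump.symm hν, ← hhd,
      charFun_withDensity_rescale hp.continuous.measurable hp0 hh, hpc,
      symExponent_rescale (fun y => max (g y) 0) hh]
    push_cast
    rw [neg_mul]
  · calc _ = h ^ (-(d : ℝ)) * (K * (A⁻¹ * minLogStable α κ β 1 (t * h ^ (d : ℝ)) x)) := by ring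
      _ ≤ h ^ (-(d : ℝ)) * p (h⁻¹ • x) := by
        refine mul_le_mul_of_nonneg_left ?_ (by positivity)
        exact (mul_le_mul_of_nonneg_left (htr x).1 hK.le).trans (hplow _)
  · have hpow : h ^ (-(d : ℝ) - k) = h ^ (-(d : ℝ)) * (h ^ k)⁻¹ := by
      rw [Real.rpow_sub_natCast hh.ne', div_eq_mul_inv]
    refine (norm_iteratedFDeriv_rescale_le hp hh (by positivity) k x).trans ?_
    rw [hpow]
    calc _ ≤ h ^ (-(d : ℝ)) * (h ^ k)⁻¹ *
          (B k * (A * minLogStable α κ β 1 (t * h ^ (d : ℝ)) x)) := by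
          refine mul_le_mul_of_nonneg_left ?_ (by positivity)
          exact (hpup k _).trans (mul_le_mul_of_nonneg_left (htr x).2 (hB k).le)
      _ = _ := by ring

theorem mainTheorem5 (d : ℕ) (hd : 1 ≤ d) (α κ β : ℝ)
    (hα0 : 0 < α) (hα2 : α < 2) (hκ : 0 < κ) (hκβ : κ * β < α) (hκβ' : α - 2 < κ * β)
    (g : EuclideanSpace ℝ (Fin d) → ℝ) (hg : Measurable g)
    (hg_symm : ∀ y, g (-y) = g y)
    (hg_approx : ComparableOn {y | y ≠ 0} g (logStableDensity α κ β))
    (ν : Measure (EuclideanSpace ℝ (Fin d)))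
    (hν : IsLevyMeasure ν)
    (hνg : ν = volume.withDensity (fun y => ENNReal.ofReal (g y)))
    (P : ℝ → Measure (EuclideanSpace ℝ (Fin d)))
    (hP : IsLevySemigroup ν 0 P) :
    (∀ t, 0 < t → P t ≪ volume) ∧
    ∃ p : ℝ → EuclideanSpace ℝ (Fin d) → ℝ,
      (∀ t, 0 < t →
        ContDiff ℝ (⊤ : ℕ∞) (p t) ∧ (∀ x, 0 ≤ p t x) ∧
        P t = volume.withDensity (fun x => ENNReal.ofReal (p t x))) ∧
      ComparableOn (Set.Ioo (0 : ℝ) 1 ×ˢ Set.univ)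
        (fun z : ℝ × EuclideanSpace ℝ (Fin d) => p z.1 z.2)
        (fun z => minLogStable α κ β
          (z.1 ^ (-(d : ℝ) / α) * Real.log (1 + 1 / z.1) ^ ((d : ℝ) * β / α)) z.1 z.2) ∧
      ComparableOn (Set.Ici (1 : ℝ) ×ˢ Set.univ)
        (fun z : ℝ × EuclideanSpace ℝ (Fin d) => p z.1 z.2)
        (fun z => minLogStable α κ β (z.1 ^ (-(d : ℝ) / (α - κ * β))) z.1 z.2) ∧
      ∀ η : Fin d → ℕ,
        (∃ C : ℝ, 0 < C ∧ ∀ t ∈ Set.Ioo (0 : ℝ) 1, ∀ x,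
          |multiDeriv η (p t) x| ≤
            C * t ^ ((-(d : ℝ) - ((∑ i, η i : ℕ) : ℝ)) / α) *
              Real.log (1 + 1 / t) ^ (((d : ℝ) + ((∑ i, η i : ℕ) : ℝ)) * β / α) *
              minLogStable α κ β 1
                (t ^ (1 + (d : ℝ) / α) / Real.log (1 + 1 / t) ^ ((d : ℝ) * β / α)) x) ∧
        (∃ C : ℝ, 0 < C ∧ ∀ t ∈ Set.Ici (1 : ℝ), ∀ x,
          |multiDeriv η (p t) x| ≤
            C * t ^ ((-(d : ℝ) - ((∑ i, η i : ℕ) : ℝ)) / (α - κ * β)) *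
              minLogStable α κ β 1 (t ^ (1 + (d : ℝ) / (α - κ * β))) x) := by
  subst hνg
  obtain ⟨K, B, hK, hB, H⟩ := exists_density_spaceScale d hd α κ β hα0 hα2 hκ hκβ hκβ' g hg
    hg_symm hg_approx hν P hP
  choose! p hp using H
  -- `B 0` comes from the upper bound and `K⁻¹` from the lower; their sum serves both directions.
  have hcomp : ∀ t, 0 < t → ∀ x,
      (B 0 + K⁻¹)⁻¹ * p t x ≤ minLogStable α κ β (spaceScale α κ β t ^ (-(d : ℝ))) t x ∧
      minLogStable α κ β (spaceScale α κ β t ^ (-(d : ℝ))) t x ≤ (B 0 + K⁻¹) * p t x := by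
    intro t ht x
    obtain ⟨-, h0, -, hlow, hup⟩ := hp t ht
    have hB0 := hB 0
    rw [minLogStable_rescale x (spaceScale_pos α κ β ht)]
    have h1 := hlow x
    have h2 := hup 0 x
    have hM := mul_nonneg (Real.rpow_nonneg (spaceScale_pos α κ β ht).le (-(d : ℝ)))
      (minLogStable_one_nonneg (α := α) (κ := κ) (β := β) x
        (mul_nonneg ht.le (Real.rpow_nonneg (spaceScale_pos α κ β ht).le (d : ℝ))))
    rw [norm_iteratedFDeriv_zero, Nat.cast_zero, sub_zero, Real.norm_of_nonneg (h0 x)] at h2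
    rw [mul_comm K, ← le_div_iff₀ hK, div_eq_mul_inv, mul_comm (p t x)] at h1
    constructor
    · rw [inv_mul_le_iff₀ (by positivity)]
      have : 0 ≤ K⁻¹ := by positivity
      nlinarith
    · nlinarith [mul_nonneg hB0.le (h0 x)]
  have hderiv : ∀ η : Fin d → ℕ, ∀ t, 0 < t → ∀ x, |multiDeriv η (p t) x| ≤
      B (∑ i, η i) * (spaceScale α κ β t ^ (-(d : ℝ) - ((∑ i, η i : ℕ) : ℝ)) *
        minLogStable α κ β 1 (t * spaceScale α κ β t ^ (d : ℝ)) x) := fun η t ht x =>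
    (abs_multiDeriv_le (hp t ht).1 η x).trans ((hp t ht).2.2.2.2 _ x)
  refine ⟨fun t ht => ?_, p, fun t ht => ⟨(hp t ht).1, (hp t ht).2.1, (hp t ht).2.2.1⟩,
    ⟨B 0 + K⁻¹, add_pos (hB 0) (inv_pos.2 hK), ?_⟩,
    ⟨B 0 + K⁻¹, add_pos (hB 0) (inv_pos.2 hK), ?_⟩, fun η =>
    ⟨⟨B (∑ i, η i), hB _, fun t ht x => ?_⟩, ⟨B (∑ i, η i), hB _, fun t ht x => ?_⟩⟩⟩
  · rw [(hp t ht).2.2.1]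
    exact withDensity_absolutelyContinuous _ _
  · rintro ⟨t, x⟩ ⟨ht, -⟩
    have h := hcomp t ht.1 x
    rw [spaceScale_rpow_of_lt_one ht.1 ht.2, neg_mul, neg_div _ ((d : ℝ) * β), neg_neg] at h
    exact h
  · rintro ⟨t, x⟩ ⟨ht, -⟩
    have ht1 : 1 ≤ t := ht
    have h := hcomp t (by linarith) x
    rw [spaceScale_rpow_of_one_le ht1] at h
    exact h
  · refine (hderiv η t ht.1 x).trans (le_of_eq ?_)
    have hℓ := log_one_add_inv_pos ht.1
    have h1 : t * spaceScale α κ β t ^ (d : ℝ) =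
        t ^ (1 + (d : ℝ) / α) / Real.log (1 + 1 / t) ^ ((d : ℝ) * β / α) := by
      rw [spaceScale_rpow_of_lt_one ht.1 ht.2, Real.rpow_add ht.1, Real.rpow_one,
        Real.rpow_neg hℓ.le]
      ring
    rw [h1, spaceScale_rpow_of_lt_one ht.1 ht.2,
      show -((-(d : ℝ) - ((∑ i, η i : ℕ) : ℝ)) * β / α) =
        ((d : ℝ) + ((∑ i, η i : ℕ) : ℝ)) * β / α by ring]
    ring
  · have ht1 : 1 ≤ t := ht
    have ht0 : 0 < t := by linarith
    refine (hderiv η t ht0 x).trans (le_of_eq ?_)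
    have h1 : t * spaceScale α κ β t ^ (d : ℝ) = t ^ (1 + (d : ℝ) / (α - κ * β)) := by
      rw [spaceScale_rpow_of_one_le ht1, Real.rpow_add ht0, Real.rpow_one]
    rw [h1, spaceScale_rpow_of_one_le ht1]
    ring
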